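/- **Setting.** Consider $N\ge 1$ agents. Agent $i$ chooses $x_i\in\Omega_i\subset\mathbb R^{\bar n}$; write $\boldsymbol x=(x_1,\dots,x_N)$, $\boldsymbol\Omega=\prod_i\Omega_i$ and $\operatorname{avg}(\boldsymbol x)=\frac1N\sum_i x_i$. The cost of agent $i$ is $\mathbb J_i(\boldsymbol x)=\mathbb E[f_i(x_i,\operatorname{avg}(\boldsymbol x),\xi_i)]+g_i(x_i)$, where $\xi=(\xi_1,\dots,\xi_N)$ has law $\mathbb P$. The coupling constraint is $\sum_i A_ix_i\le\sum_i b_i$ in $\mathbb R^m$, and $\boldsymbol{\mathcal X}$ is the set of $\boldsymbol x\in\boldsymbol\Omega$ that satisfy it. Assume: 1. $g_i$ is convex and lower semicontinuous, and its domain $\Omega_i$ is nonempty, compact and convex. 2. Slater's condition: some $\boldsymbol x\in\boldsymbol\Omega$ satisfies $\sum_i A_ix_i<\sum_i b_i$ componentwise. 3. $f_i(\cdot,\cdot,\xi_i)$ is continuously differentiable on $\mathbb R^{\bar n}\times\mathbb R^{\bar n}$ and $f_i(x,y,\cdot)$ is measurable. For $\boldsymbol x_{-i}\in\prod_{j\ne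 i}\Omega_j$, the map $x_i\mapsto f_i(x_i,\operatorname{avg}(\boldsymbol x),\xi_i)$ is convex on $\Omega_i$, and Lipschitz there with a constant integrable in $\xi_i$. The costs $f_i(x_i,\operatorname{avg}(\boldsymbol x),\xi_i)$, for $\boldsymbol x\in\boldsymbol\Omega$, and the gradients $G_i(x,y,\xi_i)=\nabla_xf_i(x,y,\xi_i)+\frac1N\nabla_yf_i(x,y,\xi_i)$, for all $x,y\in\mathbb R^{\bar n}$, are integrable. 4. The pseudogradient $\mathbb F(\boldsymbol x)=(\mathbb E[\nabla_{x_i}(f_i(x_i,\operatorname{avg}(\boldsymbol x),\xi_i))])_i$ is strongly monotone on $\boldsymbol\Omega$ and Lipschitz continuous on $\mathbb R^{N\bar n}$. 5. For every $R$ there is $\sigma>0$ with $\mathbb E\big[\sum_i\|G_i(x_i,y_i,\xi_i)-\mathbb E[G_i(x_i,y_i,\xi_i)]\|^2\big]\le\sigma^2$ for all $\boldsymbol x\in\boldsymbol\Omega$ and all $y_1,\dots,y_N$ of norm at most $R$. 6. The communication graph is undirected and connected, with symmetric weights $w_{ij}$ that are positive on edges and zero otherwise. A v-SGNE is a point $\boldsymbol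 x^*\in\boldsymbol{\mathcal X}$ such that no agent can lower its cost by a unilateral change that keeps the decisions in $\boldsymbol{\mathcal X}$, and such that $\sum_i\big(\langle\mathbb F_i(\boldsymbol x^*),y_i-x_i^*\rangle+g_i(y_i)-g_i(x_i^*)\big)\ge0$ for all $\boldsymbol y\in\boldsymbol{\mathcal X}$. **Algorithm** (edge-based). Start from $x_i^0\in\Omega_i$, $\lambda_i^0\in\mathbb R^m_{\ge0}$ (possibly random), $s_i^0=0$, $z_i^0=0$. With $u_i^k=x_i^k+s_i^k$, iterate for all $i$ $$\begin{aligned} x_i^{k+1}&=\operatorname{prox}_{\alpha_ig_i}\Big[x_i^k-\alpha_i\Big(\tfrac1{M_k}\sum_{t=1}^{M_k}G_i(x_i^k,u_i^k,\xi_i^{k,t})+A_i^\top\lambda_i^k+c\sum_jw_{ij}(u_i^k-u_j^k)\Big)\Big],\\ s_i^{k+1}&=s_i^k-\gamma\sum_jw_{ij}(u_i^k-u_j^k),\\ z_i^{k+1}&=z_i^k+\nu\sum_jw_{ij}(\lambda_i^k-\lambda_j^k),\\ \lambda_i^{k+1}&=\operatorname{proj}_{\mathbb R^m_{\ge0}}\big[\lambda_i^k+\delta_i(2A_ix_i^{k+1}-A_ix_i^k-b_i-2z_i^{k+1}+z_i^k)\big].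 \end{aligned}$$ The samples $\xi^{k,t}$ are i.i.d. with law $\mathbb P$ and independent of $(\boldsymbol x^0,\boldsymbol\lambda^0)$. The batch sizes $M_k\ge1$ satisfy $M_k\ge C(k+k_0)^{a+1}$ for all $k\ge1$, for some $C,k_0,a>0$. **Theorem.** There is exactly one v-SGNE $\boldsymbol x^*$, and: * there is $c_{\min}\ge0$ such that for every $c>c_{\min}$ there are $\bar\alpha,\bar\gamma,\bar\nu,\bar\delta>0$ such that, for all $\alpha_i\in(0,\bar\alpha)$, $\gamma\in(0,\bar\gamma)$, $\nu\in(0,\bar\nu)$, $\delta_i\in(0,\bar\delta)$, the sequence $(\boldsymbol x^k)$ generated by the algorithm converges almost surely to $\boldsymbol x^*$; * for every $c>0$ there is $\bar\gamma>0$ such that for every $\gamma\in(0,\bar\gamma)$ there are $\bar\alpha,\bar\nu,\bar\delta>0$ such that, for all $\alpha_i\in(0,\bar\alpha)$, $\nu\in(0,\bar\nu)$, $\delta_i\in(0,\bar\delta)$, the sequence $(\boldsymbol x^k)$ converges almost surely to $\boldsymbol x^*$. The bounds depend on the game, the weighted graph and $c$ (in the second item also on $\gamma$), but not on the batch sizes,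 the samples or the initialization. -/

import Mathlib

open MeasureTheory ProbabilityTheory Filter Topology

universe u v

noncomputable section

/-- The Euclidean space `ℝ^d`. -/
abbrev Vec (d : ℕ) : Type := EuclideanSpace ℝ (Fin d)

/-- Average of the strategies of the `N` agents. -/
def avg {N d : ℕ} (x : Fin N → Vec d) : Vec d := (N : ℝ)⁻¹ • ∑ i, x i

/-- Euclidean projection onto the nonnegative orthant. -/
def projNonneg {d : ℕ} (v : Vec d) : Vec d := WithLp.toLp 2 (fun j => max (v j) 0)

/-- `p` is the proximal point at `v` of the function that equals `a • g` on `S` and `+∞` off `S`. -/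
def IsProx {d : ℕ} (S : Set (Vec d)) (g : Vec d → ℝ) (a : ℝ) (v p : Vec d) : Prop :=
  p ∈ S ∧ ∀ y ∈ S, a * g p + ‖p - v‖ ^ 2 / 2 ≤ a * g y + ‖y - v‖ ^ 2 / 2

/-- Nonnegative symmetric weights on the edges of a connected undirected graph. -/
structure IsGraphWeight {N : ℕ} (Γ : SimpleGraph (Fin N)) (w : Fin N → Fin N → ℝ) : Prop where
  connected : Γ.Connected
  symm : ∀ i j, w i j = w j i
  pos : ∀ i j, Γ.Adj i j → 0 < w i j
  zero : ∀ i j, ¬ Γ.Adj i j → w i j = 0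

/-- The weighted graph Laplacian, acting on a stacked vector: `∑_j w_ij (u_i - u_j)`. -/
def laplacian {N d : ℕ} (w : Fin N → Fin N → ℝ) (u : Fin N → Vec d) (i : Fin N) : Vec d :=
  ∑ j, w i j • (u i - u j)

/-- Batch sizes growing at least like `C (k + k₀)^(a+1)`. -/
def IsBatchSize (M : ℕ → ℕ) : Prop :=
  (∀ k, 0 < M k) ∧ ∃ C k₀ a : ℝ, 0 < C ∧ 0 < k₀ ∧ 0 < a ∧
    ∀ k : ℕ, 1 ≤ k → C * ((k : ℝ) + k₀) ^ (a + 1) ≤ (M k : ℝ)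

/-- The data of a stochastic aggregative game with `N` agents, decisions in `ℝ^n` and `m` coupling
constraints. Agent `i` has the smooth cost `f i (own decision) (aggregate) (sample)`, the
nonsmooth cost `g i` on its domain `S i` (understood as `+∞` off `S i`), and the portion `A i`,
`b i` of the constraint `∑ i, A i (x i) ≤ ∑ i, b i`. `law` is the joint law of the uncertainty. -/
structure AggGame (N n m : ℕ) (Ξ : Fin N → Type u) [∀ i, MeasurableSpace (Ξ i)] where
  f : ∀ i, Vec n → Vec n → Ξ i → ℝ
  g : Fin N → Vec n → ℝ
  S : Fin N → Set (Vec n)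
  A : Fin N → (Vec n →L[ℝ] Vec m)
  b : Fin N → Vec m
  law : Measure (∀ i, Ξ i)

namespace AggGame

variable {N n m : ℕ} {Ξ : Fin N → Type u} [∀ i, MeasurableSpace (Ξ i)] (G : AggGame N n m Ξ)

/-- Product of the local strategy sets. -/
def localSet : Set (Fin N → Vec n) := {x | ∀ i, x i ∈ G.S i}

/-- Collective feasible set. -/
def feasible : Set (Fin N → Vec n) :=
  {x | x ∈ G.localSet ∧ ∀ r, (∑ i, G.A i (x i)) r ≤ (∑ i, G.b i) r}

/-- Smooth cost of agent `i` as a function of all the decisions. -/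
def smooth (i : Fin N) (x : Fin N → Vec n) (ξ : Ξ i) : ℝ := G.f i (x i) (avg x) ξ

/-- Expected-value cost of agent `i`. -/
def cost (i : Fin N) (x : Fin N → Vec n) : ℝ := (∫ ω, G.smooth i x (ω i) ∂G.law) + G.g i (x i)

/-- Pseudogradient: expected gradient of the cost of each agent in its own decision, the aggregate
varying along with this decision. -/
def pseudograd (i : Fin N) (x : Fin N → Vec n) : Vec n :=
  ∫ ω, gradient (fun t => G.smooth i (Function.update x i t) (ω i)) (x i) ∂G.law

/-- Sampled gradient of agent `i` at its decision `x` and an estimate `y` of the aggregate. -/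
def sampleGrad (i : Fin N) (x y : Vec n) (ξ : Ξ i) : Vec n :=
  gradient (fun t => G.f i t y ξ) x + (N : ℝ)⁻¹ • gradient (fun t => G.f i x t ξ) y

/-- Expected gradient of agent `i` at its decision `x` and an estimate `y` of the aggregate. -/
def extGrad (i : Fin N) (x y : Vec n) : Vec n := ∫ ω, G.sampleGrad i x y (ω i) ∂G.law

/-- Stochastic generalized Nash equilibrium. -/
def IsSGNE (x : Fin N → Vec n) : Prop :=
  x ∈ G.feasible ∧ ∀ i y, Function.update x i y ∈ G.feasible →
    G.cost i x ≤ G.cost i (Function.update x i y)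

/-- Variational equilibrium: an equilibrium that solves the stochastic variational inequality of
the pseudogradient (and of the nonsmooth costs) over the collective feasible set. -/
def IsVSGNE (x : Fin N → Vec n) : Prop :=
  G.IsSGNE x ∧ ∀ y ∈ G.feasible,
    0 ≤ ∑ i, (inner ℝ (G.pseudograd i x) (y i - x i) + (G.g i (y i) - G.g i (x i)))

/-- Local nonsmooth costs: convex and lower semicontinuous, with nonempty compact convex domain. -/
def LocalCosts : Prop :=
  ∀ i, (G.S i).Nonempty ∧ IsCompact (G.S i) ∧ Convex ℝ (G.S i) ∧
    ConvexOn ℝ (G.S i) (G.g i) ∧ LowerSemicontinuousOn (G.g i) (G.S i)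

/-- Slater's constraint qualification for the coupling constraints. -/
def Slater : Prop := ∃ x ∈ G.localSet, ∀ r, (∑ i, G.A i (x i)) r < (∑ i, G.b i) r

/-- Convexity and regularity of the smooth costs; the expected values are well defined. -/
structure SmoothCosts : Prop where
  contDiff : ∀ i ξ, ContDiff ℝ 1 (fun p : Vec n × Vec n => G.f i p.1 p.2 ξ)
  measurable : ∀ i x y, Measurable (G.f i x y)
  convex : ∀ i ξ, ∀ x ∈ G.localSet,
    ConvexOn ℝ (G.S i) (fun t => G.smooth i (Function.update x i t) ξ)
  lipschitz : ∀ i, ∀ x ∈ G.localSet, ∃ l : Ξ i → ℝ, Integrable (fun ω => l (ω i)) G.law ∧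
    ∀ ξ, ∀ t ∈ G.S i, ∀ t' ∈ G.S i,
      |G.smooth i (Function.update x i t) ξ - G.smooth i (Function.update x i t') ξ|
        ≤ l ξ * ‖t - t'‖
  integrable_cost : ∀ i, ∀ x ∈ G.localSet, Integrable (fun ω => G.smooth i x (ω i)) G.law
  integrable_grad : ∀ i x y, Integrable (fun ω => G.sampleGrad i x y (ω i)) G.law

/-- The pseudogradient is strongly monotone (on the local strategies) and Lipschitz. -/
def StronglyMonotone : Prop :=
  (∃ η : ℝ, 0 < η ∧ ∀ x ∈ G.localSet, ∀ y ∈ G.localSet,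
    η * ∑ i, ‖x i - y i‖ ^ 2 ≤ ∑ i, inner ℝ (G.pseudograd i x - G.pseudograd i y) (x i - y i)) ∧
  (∃ l : ℝ, 0 < l ∧ ∀ x y : Fin N → Vec n,
    ∑ i, ‖G.pseudograd i x - G.pseudograd i y‖ ^ 2 ≤ l ^ 2 * ∑ i, ‖x i - y i‖ ^ 2)

/-- The variance of the sampled gradients is bounded for feasible decisions, uniformly on bounded
sets of estimates of the aggregate. -/
def BoundedVariance : Prop :=
  ∀ R : ℝ, ∃ σ : ℝ, 0 < σ ∧ ∀ x ∈ G.localSet, ∀ y : Fin N → Vec n, (∀ i, ‖y i‖ ≤ R) →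
    ∫⁻ ω, ENNReal.ofReal (∑ i, ‖G.sampleGrad i (x i) (y i) (ω i) - G.extGrad i (x i) (y i)‖ ^ 2)
      ∂G.law ≤ ENNReal.ofReal (σ ^ 2)

/-- Stochastic approximation of the gradient of agent `i` with a batch of `M` samples. -/
def gradSA (M : ℕ) (ζ : ℕ → ∀ i, Ξ i) (i : Fin N) (x y : Vec n) : Vec n :=
  (M : ℝ)⁻¹ • ∑ t ∈ Finset.range M, G.sampleGrad i x y (ζ t i)

/-- `(x, s, z, lam)` is the sequence generated by the edge-based algorithm from the samples
`ζ k t` (`t`-th sample of the batch of iteration `k`). -/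
structure IsRun (w : Fin N → Fin N → ℝ) (M : ℕ → ℕ) (c γ ν : ℝ) (α δ : Fin N → ℝ)
    (ζ : ℕ → ℕ → ∀ i, Ξ i) (x s : ℕ → Fin N → Vec n) (z lam : ℕ → Fin N → Vec m) : Prop where
  init_x : ∀ i, x 0 i ∈ G.S i
  init_s : ∀ i, s 0 i = 0
  init_z : ∀ i, z 0 i = 0
  init_lam : ∀ i r, 0 ≤ lam 0 i r
  step_x : ∀ k i, IsProx (G.S i) (G.g i) (α i)
    (x k i - α i • (G.gradSA (M k) (ζ k) i (x k i) (x k i + s k i)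
      + (G.A i).adjoint (lam k i) + c • laplacian w (x k + s k) i)) (x (k + 1) i)
  step_s : ∀ k i, s (k + 1) i = s k i - γ • laplacian w (x k + s k) i
  step_z : ∀ k i, z (k + 1) i = z k i + ν • laplacian w (lam k) i
  step_lam : ∀ k i, lam (k + 1) i = projNonneg (lam k i +
    δ i • (2 • G.A i (x (k + 1) i) - G.A i (x k i) - G.b i - 2 • z (k + 1) i + z k i))

/-- With these parameters, the decisions generated by the algorithm converge almost surely to
`xs`, whatever the batch sizes, the probability space, the i.i.d. samples and the (possibly
random) initialization, independent of the samples. -/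
def ConvergesAS (w : Fin N → Fin N → ℝ) (c γ ν : ℝ) (α δ : Fin N → ℝ) (xs : Fin N → Vec n) :
    Prop :=
  ∀ (M : ℕ → ℕ), IsBatchSize M →
  ∀ (Θ : Type v) [MeasurableSpace Θ] (μ : Measure Θ) [IsProbabilityMeasure μ]
    (ζ : ℕ → ℕ → Θ → ∀ i, Ξ i)
    (x s : ℕ → Θ → Fin N → Vec n) (z lam : ℕ → Θ → Fin N → Vec m),
    (∀ k t, Measurable (ζ k t)) →
    (∀ k t, μ.map (ζ k t) = G.law) →
    iIndepFun (fun p : ℕ × ℕ => ζ p.1 p.2) μ →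
    Measurable (x 0) → Measurable (lam 0) →
    IndepFun (fun θ => (x 0 θ, lam 0 θ)) (fun θ (p : ℕ × ℕ) => ζ p.1 p.2 θ) μ →
    (∀ θ, G.IsRun w M c γ ν α δ (fun k t => ζ k t θ)
      (fun k => x k θ) (fun k => s k θ) (fun k => z k θ) (fun k => lam k θ)) →
    ∀ᵐ θ ∂μ, Tendsto (fun k => x k θ) atTop (𝓝 xs)

end AggGame

end

/-! The equilibrium solves a strongly monotone, Lipschitz variational inequality over a compact
convex set, so it is the fixed point of a contractive proximal-gradient map
(`exists_variational_solution`). Slater's condition supplies a multiplier shared by all the agents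
(`exists_multiplier`, `AggGame.exists_kkt`).

The algorithm is a preconditioned primal-dual forward-backward iteration. Since `z` stays in the
range of the Laplacian L, it can be replaced by a preimage ζ that obeys ζ' = ζ + νλ. Measured by the
quadratic form `pdForm`, nonnegative for small steps, the distance to a primal-dual solution drops
by the form of the increment, up to the pairing of the forward error with x' - x* (`pdForm_step`,
`le_pdForm`). The forward error consists of the variation of the pseudogradient, the effect of using
the estimate u = x + s instead of the average, the consensus term c L u, and the batch noise ε. With
e = x - x*, strong monotonicity contributes -2η‖e‖², and whatever is paired with x' - x is absorbed
by the form of the increment once α is small.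

There remains the deviation of u from its average, which is handled in two ways. For large c, the
term (c/γ)‖s - s*‖² is added to the potential. Its cross term cancels c⟨Lu, e⟩ and leaves a multiple
of -⟨Lu, u⟩, which beats the estimation error by the Poincaré inequality
(`AggGame.descentBound_of_large_gain`). For any c, the deviation contracts at a rate fixed by γ and
is driven only by x' - x, so a large multiple of its square is added to the potential and α is
reduced accordingly (`AggGame.descentBound_of_small_steps`).

Either way, along every path a multiple of ∑‖e_k‖² is at most V(x⁰, λ⁰) + ∑(‖ε_k‖² - 2⟨ε_k, e_k⟩).
The estimates stay bounded (`AggGame.exists_estimate_bound`), so the variance is uniform and E‖ε_k‖²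
≤ σ²/M_k is summable. The cross terms have mean zero because the samples are independent of the
past. Hence ∑‖e_k‖² has finite expectation on each event {V ≤ r}, and e_k → 0 almost surely
(`AggGame.convergesAS_of_descentBound`). -/

noncomputable section

/-! ### Proximal points and variational inequalities. -/

section Prox

variable {E : Type*} [NormedAddCommGroup E] [InnerProductSpace ℝ E]

lemma nonneg_of_forall_add_mul_nonneg {a b : ℝ}
    (h : ∀ t : ℝ, 0 < t → t ≤ 1 → 0 ≤ a + t * b) : 0 ≤ a := by
  have hlim : Tendsto (fun t : ℝ => a + t * b) (𝓝[>] 0) (𝓝 (a + 0 * b)) := by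
    apply Tendsto.mono_left _ nhdsWithin_le_nhds
    exact (continuous_const.add (continuous_id.mul continuous_const)).tendsto 0
  simp only [zero_mul, add_zero] at hlim
  refine ge_of_tendsto hlim ?_
  filter_upwards [Ioc_mem_nhdsGT (zero_lt_one (α := ℝ))] with t ht using h t ht.1 ht.2

/-- Variational characterization of a proximal point. -/
lemma prox_variational {S : Set E} {g : E → ℝ} (hg : ConvexOn ℝ S g) {a : ℝ} (ha : 0 ≤ a)
    {v p : E} (hp : p ∈ S)
    (hmin : ∀ y ∈ S, a * g p + ‖p - v‖ ^ 2 / 2 ≤ a * g y + ‖y - v‖ ^ 2 / 2)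
    {y : E} (hy : y ∈ S) : 0 ≤ inner ℝ (p - v) (y - p) + a * (g y - g p) := by
  refine nonneg_of_forall_add_mul_nonneg (b := ‖y - p‖ ^ 2 / 2) fun t ht0 ht1 => ?_
  have hq : (1 - t) • p + t • y ∈ S := hg.1 hp hy (by linarith) ht0.le (by ring)
  have h1 := hmin _ hq
  have h2 : g ((1 - t) • p + t • y) ≤ (1 - t) * g p + t * g y := by
    simpa using hg.2 hp hy (by linarith) ht0.le (by ring)
  have h3 : (1 - t) • p + t • y - v = (p - v) + t • (y - p) := by module
  rw [h3, norm_add_sq_real, inner_smul_right, norm_smul, mul_pow, Real.norm_eq_abs, sq_abs] at h1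
  have h4 := mul_le_mul_of_nonneg_left h2 ha
  have h5 : 0 ≤ t * (inner ℝ (p - v) (y - p) + a * (g y - g p) + t * (‖y - p‖ ^ 2 / 2)) := by
    nlinarith
  exact nonneg_of_mul_nonneg_right h5 ht0

/-- Testing the variational inequality of each proximal point at the other and adding cancels `g`
and leaves ‖p - p'‖² ≤ ⟨v - v', p - p'⟩. -/
lemma prox_nonexpansive {S : Set E} {g : E → ℝ} (hg : ConvexOn ℝ S g) {a : ℝ} (ha : 0 ≤ a)
    {v p v' p' : E} (hp : p ∈ S)
    (hmin : ∀ y ∈ S, a * g p + ‖p - v‖ ^ 2 / 2 ≤ a * g y + ‖y - v‖ ^ 2 / 2)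
    (hp' : p' ∈ S)
    (hmin' : ∀ y ∈ S, a * g p' + ‖p' - v'‖ ^ 2 / 2 ≤ a * g y + ‖y - v'‖ ^ 2 / 2) :
    ‖p - p'‖ ≤ ‖v - v'‖ := by
  have h1 := prox_variational hg ha hp hmin hp'
  have h2 := prox_variational hg ha hp' hmin' hp
  have h3 : inner ℝ (p - v) (p' - p) + inner ℝ (p' - v') (p - p')
      = inner ℝ (v - v') (p - p') - ‖p - p'‖ ^ 2 := by
    rw [← real_inner_self_eq_norm_sq, ← inner_sub_left, ← neg_sub p p', inner_neg_right,
      ← inner_neg_left, ← inner_add_left]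
    congr 1; module
  have h4 := real_inner_le_norm (v - v') (p - p')
  by_contra hlt
  push Not at hlt
  nlinarith [norm_nonneg (v - v')]

lemma exists_prox {E : Type*} [NormedAddCommGroup E] {S : Set E} {g : E → ℝ} (hne : S.Nonempty) (hS : IsCompact S)
    (hg : LowerSemicontinuousOn g S) {a : ℝ} (ha : 0 ≤ a) (v : E) :
    ∃ p ∈ S, ∀ y ∈ S, a * g p + ‖p - v‖ ^ 2 / 2 ≤ a * g y + ‖y - v‖ ^ 2 / 2 := by
  have h1 : LowerSemicontinuousOn (fun y => a * g y + ‖y - v‖ ^ 2 / 2) S := by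
    refine LowerSemicontinuousOn.add ?_ ?_
    · have : Continuous (fun x : ℝ => a * x) := by fun_prop
      exact this.comp_lowerSemicontinuousOn hg (fun x y hxy => mul_le_mul_of_nonneg_left hxy ha)
    · exact ContinuousOn.lowerSemicontinuousOn (by fun_prop)
  obtain ⟨p, hp, hmin⟩ := h1.exists_isMinOn hne hS
  exact ⟨p, hp, fun y hy => hmin hy⟩

/-- A variational inequality for a strongly monotone and Lipschitz operator is solvable. -/
lemma exists_variational_solution {K : Set E} (hne : K.Nonempty) (hK : IsCompact K) {g : E → ℝ}
    (hg : ConvexOn ℝ K g) (hgl : LowerSemicontinuousOn g K) {F : E → E} {η l : ℝ} (hη : 0 < η)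
    (hmono : ∀ x ∈ K, ∀ y ∈ K, η * ‖x - y‖ ^ 2 ≤ inner ℝ (F x - F y) (x - y))
    (hlip : ∀ x ∈ K, ∀ y ∈ K, ‖F x - F y‖ ≤ l * ‖x - y‖) :
    ∃ x ∈ K, ∀ y ∈ K, 0 ≤ inner ℝ (F x) (y - x) + (g y - g x) := by
  -- Enlarging the Lipschitz constant to at least `η` keeps 1 - η²/L² nonnegative under the square
  -- root.
  set L := max l η with hL
  have hLη : η ≤ L := le_max_right _ _
  have hL0 : 0 < L := hη.trans_le hLη
  have hlipL : ∀ x ∈ K, ∀ y ∈ K, ‖F x - F y‖ ≤ L * ‖x - y‖ := fun x hx y hy =>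
    (hlip x hx y hy).trans (mul_le_mul_of_nonneg_right (le_max_left _ _) (norm_nonneg _))
  -- This step minimizes 1 - 2τη + τ²L², the squared contraction factor of the proximal-gradient
  -- map.
  set τ := η / L ^ 2 with hτ
  have hτ0 : 0 < τ := by positivity
  choose P hPK hPmin using fun v : E => exists_prox hne hK hgl hτ0.le v
  set T : E → E := fun x => P (x - τ • F x) with hT
  have hq0 : 0 ≤ 1 - η ^ 2 / L ^ 2 := by
    rw [sub_nonneg, div_le_one (by positivity)]; gcongr
  have hq1 : 1 - η ^ 2 / L ^ 2 < 1 := by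
    have : 0 < η ^ 2 / L ^ 2 := by positivity
    linarith
  have hTl : ∀ x ∈ K, ∀ y ∈ K, ‖T x - T y‖ ≤ √(1 - η ^ 2 / L ^ 2) * ‖x - y‖ := by
    intro x hx y hy
    refine (prox_nonexpansive hg hτ0.le (hPK _) (hPmin _) (hPK _) (hPmin _)).trans ?_
    have h1 : x - τ • F x - (y - τ • F y) = (x - y) - τ • (F x - F y) := by module
    rw [h1]
    refine abs_le_of_sq_le_sq' ?_ (by positivity) |>.2
    rw [mul_pow, Real.sq_sqrt hq0, norm_sub_sq_real, inner_smul_right, norm_smul, mul_pow,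
      Real.norm_eq_abs, sq_abs, real_inner_comm]
    have h2 := hmono x hx y hy
    have h3 : ‖F x - F y‖ ^ 2 ≤ L ^ 2 * ‖x - y‖ ^ 2 := by
      rw [← mul_pow]; exact pow_le_pow_left₀ (norm_nonneg _) (hlipL x hx y hy) 2
    have h4 := mul_le_mul_of_nonneg_left h3 (sq_nonneg τ)
    have h5 := mul_le_mul_of_nonneg_left h2 hτ0.le
    have h6 : τ ^ 2 * (L ^ 2 * ‖x - y‖ ^ 2) = η ^ 2 / L ^ 2 * ‖x - y‖ ^ 2 := by
      rw [hτ]; field_simp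
    have h7 : τ * (η * ‖x - y‖ ^ 2) = η ^ 2 / L ^ 2 * ‖x - y‖ ^ 2 := by
      rw [hτ]; field_simp
    nlinarith
  have hmaps : Set.MapsTo T K K := fun x _ => hPK _
  have hcon : ContractingWith (Real.toNNReal √(1 - η ^ 2 / L ^ 2)) (hmaps.restrict T K K) := by
    refine ⟨?_, LipschitzWith.of_dist_le_mul ?_⟩
    · rw [← NNReal.coe_lt_coe, Real.coe_toNNReal _ (Real.sqrt_nonneg _), NNReal.coe_one]
      rw [Real.sqrt_lt' one_pos]; simpa using hq1
    · rintro ⟨x, hx⟩ ⟨y, hy⟩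
      rw [Real.coe_toNNReal _ (Real.sqrt_nonneg _)]
      simp only [Subtype.dist_eq, Set.MapsTo.val_restrict_apply, dist_eq_norm]
      exact hTl x hx y hy
  obtain ⟨x0, hx0⟩ := hne
  obtain ⟨x, hx, hfix, -⟩ := hcon.exists_fixedPoint' hK.isComplete hmaps hx0 (edist_ne_top _ _)
  refine ⟨x, hx, fun y hy => ?_⟩
  have h1 := prox_variational hg hτ0.le (hPK (x - τ • F x)) (hPmin _) hy
  have h2 : P (x - τ • F x) = x := hfix
  rw [h2, sub_sub_cancel, inner_smul_left] at h1
  simp only [conj_trivial] at h1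
  rw [← mul_add] at h1
  exact nonneg_of_mul_nonneg_right h1 hτ0

end Prox

/-! ### Convex duality. -/

/-- Lagrange multipliers of a convex program under Slater's condition. -/
lemma exists_multiplier {E : Type*} [AddCommGroup E] [Module ℝ E] {m : ℕ} {C : Set E}
    {φ : E → ℝ} {h : Fin m → E → ℝ} (hφ : ConvexOn ℝ C φ) (hh : ∀ r, ConvexOn ℝ C (h r))
    (hslater : ∃ y ∈ C, ∀ r, h r y < 0)
    (hmin : ∀ y ∈ C, (∀ r, h r y ≤ 0) → 0 ≤ φ y) :
    ∃ lam : Fin m → ℝ, (∀ r, 0 ≤ lam r) ∧ ∀ y ∈ C, 0 ≤ φ y + ∑ r, lam r * h r y := by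
  -- The strict inequalities make this upper image open without any continuity of `φ` or `h`. It is
  -- convex and misses the origin, so Hahn-Banach separates the two; the multipliers are the
  -- coordinates of the negated functional.
  set D : Set (ℝ × (Fin m → ℝ)) := {p | ∃ y ∈ C, φ y < p.1 ∧ ∀ r, h r y < p.2 r} with hD
  have hDo : IsOpen D := by
    have : D = ⋃ y ∈ C, {p : ℝ × (Fin m → ℝ) | φ y < p.1} ∩ ⋂ r, {p | h r y < p.2 r} := by
      ext p; simp [hD, and_left_comm]
    rw [this]
    refine isOpen_biUnion fun y _ => (isOpen_lt (by fun_prop) (by fun_prop)).inter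
      (isOpen_iInter_of_finite fun r => isOpen_lt (by fun_prop) (by fun_prop))
  have hcomb : ∀ {s t a b a' b' : ℝ}, 0 ≤ s → 0 ≤ t → s + t = 1 → a < a' → b < b' →
      s * a + t * b < s * a' + t * b' := by
    intro s t a b a' b' hs ht hst h1 h2
    rcases hs.eq_or_lt with rfl | hs
    · have : t = 1 := by linarith
      subst this; linarith
    · have := mul_lt_mul_of_pos_left h1 hs
      have := mul_le_mul_of_nonneg_left h2.le ht
      linarith
  have hDc : Convex ℝ D := by
    rintro p ⟨y, hy, hy1, hy2⟩ q ⟨y', hy', hy1', hy2'⟩ s t hs ht hst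
    refine ⟨s • y + t • y', hφ.1 hy hy' hs ht hst, ?_, fun r => ?_⟩
    · refine (hφ.2 hy hy' hs ht hst).trans_lt ?_
      simpa using hcomb hs ht hst hy1 hy1'
    · refine ((hh r).2 hy hy' hs ht hst).trans_lt ?_
      simpa using hcomb hs ht hst (hy2 r) (hy2' r)
  have h0 : (0 : ℝ × (Fin m → ℝ)) ∉ D := by
    rintro ⟨y, hy, hy1, hy2⟩
    exact absurd (hmin y hy fun r => (hy2 r).le) (not_le.2 hy1)
  obtain ⟨f, hf⟩ := geometric_hahn_banach_open_point hDc hDo h0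
  rw [map_zero] at hf
  set τ := -f (1, 0) with hτ
  set l : Fin m → ℝ := fun r => -f (0, Pi.single r 1) with hl
  have hrep : ∀ p : ℝ × (Fin m → ℝ), -f p = τ * p.1 + ∑ r, l r * p.2 r := by
    intro p
    have hp : p = p.1 • ((1 : ℝ), (0 : Fin m → ℝ)) + ∑ r, p.2 r • ((0 : ℝ), Pi.single r (1 : ℝ)) := by
      ext j
      · simp [Prod.fst_sum]
      · simp [Prod.snd_sum, Finset.sum_apply, Pi.single_apply]
    conv_lhs => rw [hp]
    rw [map_add, map_sum, map_smul]
    simp only [map_smul, smul_eq_mul, hτ, hl, neg_add, neg_mul, Finset.sum_neg_distrib]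
    rw [mul_comm]
    congr 2
    exact Finset.sum_congr rfl fun r _ => mul_comm _ _
  have hpos : ∀ p ∈ D, 0 < τ * p.1 + ∑ r, l r * p.2 r := fun p hp => by
    rw [← hrep]; linarith [hf p hp]
  obtain ⟨y0, hy0, hs0⟩ := hslater
  have hlim : ∀ y ∈ C, 0 ≤ τ * φ y + ∑ r, l r * h r y := by
    intro y hy
    refine nonneg_of_forall_add_mul_nonneg (b := τ + ∑ r, l r) fun t ht0 _ => ?_
    have h1 := hpos (φ y + t, fun r => h r y + t) ⟨y, hy, by simpa, fun r => by simpa⟩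
    simp only [mul_add, Finset.sum_add_distrib, ← Finset.sum_mul] at h1
    linarith
  -- `D` is closed under increasing any coordinate, so a negative coefficient would make the
  -- functional change sign along a ray.
  have hray : ∀ {a b : ℝ}, (∀ t : ℝ, 0 ≤ t → 0 < a + t * b) → 0 ≤ b := by
    intro a b hab
    by_contra hb
    push Not at hb
    have ha := hab 0 le_rfl
    have h1 := hab (-a / b) (div_nonneg_of_nonpos (by linarith) hb.le)
    rw [div_mul_cancel₀ _ hb.ne] at h1
    linarith
  have hτ0 : 0 ≤ τ := by
    refine hray (a := τ * (φ y0 + 1) + ∑ r, l r * 0) fun t ht => ?_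
    have h1 := hpos (φ y0 + 1 + t, fun r => 0) ⟨y0, hy0, by simp only []; linarith, hs0⟩
    simp only at h1
    linarith
  have hl0 : ∀ r, 0 ≤ l r := by
    intro r
    refine hray (a := τ * (φ y0 + 1)) fun t ht => ?_
    have h1 := hpos (φ y0 + 1, fun r' => if r' = r then t else 0)
      ⟨y0, hy0, by simp only []; linarith, fun r' => ?_⟩
    · simp only [mul_ite, mul_zero, Finset.sum_ite_eq', Finset.mem_univ, if_true] at h1
      linarith
    · simp only
      split_ifs
      · exact (hs0 r').trans_le ht
      · exact hs0 r'
  -- Slater's point puts (φ y0 + 1, 0) in `D`, where the functional reduces to τ(φ y0 + 1) and must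
  -- be positive.
  have hτpos : 0 < τ := by
    rcases hτ0.eq_or_lt with h1 | h1
    · exfalso
      have h2 := hlim y0 hy0
      have h3 := hpos (φ y0 + 1, fun r => 0) ⟨y0, hy0, by simp, hs0⟩
      simp [← h1] at h3
    · exact h1
  refine ⟨fun r => l r / τ, fun r => div_nonneg (hl0 r) hτ0, fun y hy => ?_⟩
  have h1 := hlim y hy
  have h2 : φ y + ∑ r, l r / τ * h r y = (τ * φ y + ∑ r, l r * h r y) / τ := by
    rw [add_div, mul_div_cancel_left₀ _ hτpos.ne', Finset.sum_div]
    congr 1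
    exact Finset.sum_congr rfl fun r _ => by ring
  rw [h2]
  exact div_nonneg h1 hτpos.le

/-! ### Stacked vectors, gradients of the game, and its variational equilibrium. -/

/-- Stacked vectors of all the agents, with the Euclidean norm. -/
abbrev Stack (N d : ℕ) : Type := PiLp 2 (fun _ : Fin N => Vec d)

lemma Stack.inner_eq {N d : ℕ} (x y : Stack N d) : inner ℝ x y = ∑ i, inner ℝ (x i) (y i) :=
  PiLp.inner_apply x y

lemma Stack.norm_sq_eq {N d : ℕ} (x : Stack N d) : ‖x‖ ^ 2 = ∑ i, ‖x i‖ ^ 2 :=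
  PiLp.norm_sq_eq_of_L2 _ x

lemma avg_update {N d : ℕ} (x : Fin N → Vec d) (i : Fin N) (t : Vec d) :
    avg (Function.update x i t) = avg x + (N : ℝ)⁻¹ • (t - x i) := by
  unfold avg
  rw [← smul_add]
  congr 1
  rw [Finset.sum_update_of_mem (Finset.mem_univ i),
    ← Finset.add_sum_erase Finset.univ x (Finset.mem_univ i), Finset.erase_eq]
  abel

lemma avg_const {N d : ℕ} (hN : 0 < N) (a : Vec d) : avg (fun _ : Fin N => a) = a := by
  unfold avg
  rw [Finset.sum_const, Finset.card_univ, Fintype.card_fin, ← Nat.cast_smul_eq_nsmul ℝ, smul_smul,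
    inv_mul_cancel₀ (by positivity), one_smul]

namespace AggGame

variable {N n m : ℕ} {Ξ : Fin N → Type u} [∀ i, MeasurableSpace (Ξ i)] {G : AggGame N n m Ξ}

lemma SmoothCosts.differentiable (h : G.SmoothCosts) (i : Fin N) (ξ : Ξ i) :
    Differentiable ℝ (fun p : Vec n × Vec n => G.f i p.1 p.2 ξ) :=
  (h.contDiff i ξ).differentiable one_ne_zero

/-- Moving the own decision by v moves the average by v/N, so both partial gradients combine into
one directional derivative of `f`. This form gives the chain rule, the measurability and the
continuity of the sampled gradient. -/
lemma SmoothCosts.inner_sampleGrad (h : G.SmoothCosts) (i : Fin N) (x y : Vec n) (ξ : Ξ i)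
    (v : Vec n) : inner ℝ (G.sampleGrad i x y ξ) v
      = fderiv ℝ (fun p : Vec n × Vec n => G.f i p.1 p.2 ξ) (x, y) (v, (N : ℝ)⁻¹ • v) := by
  have hd := (h.differentiable i ξ (x, y)).hasFDerivAt
  set D := fderiv ℝ (fun p : Vec n × Vec n => G.f i p.1 p.2 ξ) (x, y)
  have h1 : HasFDerivAt (fun t => G.f i t y ξ)
      (D.comp ((ContinuousLinearMap.id ℝ (Vec n)).prod 0)) x := by
    have := hd.comp x ((hasFDerivAt_id (𝕜 := ℝ) x).prodMk (hasFDerivAt_const y x))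
    exact this
  have h2 : HasFDerivAt (fun t => G.f i x t ξ)
      (D.comp ((0 : Vec n →L[ℝ] Vec n).prod (ContinuousLinearMap.id ℝ (Vec n)))) y := by
    have := hd.comp y ((hasFDerivAt_const (𝕜 := ℝ) x y).prodMk (hasFDerivAt_id y))
    exact this
  unfold sampleGrad
  rw [inner_add_left, real_inner_smul_left, inner_gradient_left, inner_gradient_left, h1.fderiv,
    h2.fderiv]
  have h3 : ((v, (N : ℝ)⁻¹ • v) : Vec n × Vec n) = (v, 0) + (N : ℝ)⁻¹ • (0, v) := by simp
  rw [h3, map_add, map_smul]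
  simp

lemma SmoothCosts.hasGradientAt_smooth (h : G.SmoothCosts) (i : Fin N) (x : Fin N → Vec n)
    (ξ : Ξ i) : HasGradientAt (fun t => G.smooth i (Function.update x i t) ξ)
      (G.sampleGrad i (x i) (avg x) ξ) (x i) := by
  have hd := (h.differentiable i ξ (x i, avg x)).hasFDerivAt
  rw [hasGradientAt_iff_hasFDerivAt]
  have h1 : HasFDerivAt (fun t : Vec n => ((t, avg x + (N : ℝ)⁻¹ • (t - x i)) : Vec n × Vec n))
      ((ContinuousLinearMap.id ℝ (Vec n)).prod ((N : ℝ)⁻¹ • ContinuousLinearMap.id ℝ (Vec n)))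
      (x i) :=
    (hasFDerivAt_id (𝕜 := ℝ) (x i)).prodMk
      ((((hasFDerivAt_id (𝕜 := ℝ) (x i)).sub_const (x i)).const_smul (N : ℝ)⁻¹).const_add (avg x))
  have h2 : (x i, avg x) = (x i, avg x + (N : ℝ)⁻¹ • (x i - x i)) := by simp
  have h3 := HasFDerivAt.comp (x i) (h2 ▸ hd) h1
  have h4 : (fun t => G.smooth i (Function.update x i t) ξ)
      = (fun p : Vec n × Vec n => G.f i p.1 p.2 ξ) ∘ fun t => (t, avg x + (N : ℝ)⁻¹ • (t - x i)) := by
    ext t; simp [smooth, avg_update]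
  rw [h4]
  refine h3.congr_fderiv ?_
  ext v
  rw [InnerProductSpace.toDual_apply_apply, h.inner_sampleGrad]
  simp

lemma SmoothCosts.pseudograd_eq (h : G.SmoothCosts) (i : Fin N) (x : Fin N → Vec n) :
    G.pseudograd i x = G.extGrad i (x i) (avg x) := by
  unfold pseudograd extGrad
  congr 1
  ext1 ω
  exact (h.hasGradientAt_smooth i x (ω i)).gradient

/-- The extended pseudogradient is Lipschitz on the estimates that track the average. -/
lemma exists_extGrad_lipschitz (hN : 0 < N) (h : G.SmoothCosts) (hm : G.StronglyMonotone) :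
    ∃ C : ℝ, 0 ≤ C ∧ ∀ x u x' u' : Fin N → Vec n, avg u = avg x → avg u' = avg x' →
      ∑ i, ‖G.extGrad i (x i) (u i) - G.extGrad i (x' i) (u' i)‖ ^ 2
        ≤ C * ∑ i, (‖x i - x' i‖ ^ 2 + ‖u i - u' i‖ ^ 2) := by
  obtain ⟨-, l, hl, hlip⟩ := hm
  simp only [h.pseudograd_eq] at hlip
  rcases Nat.lt_or_ge 1 N with hN2 | hN1
  · have hNr : (1 : ℝ) ≤ (N : ℝ) - 1 := by
      have : (2 : ℝ) ≤ N := by exact_mod_cast hN2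
      linarith
    set r : ℝ := ((N : ℝ) - 1)⁻¹ with hr
    have hr1 : r ≤ 1 := inv_le_one_of_one_le₀ hNr
    have hr0 : 0 ≤ r := inv_nonneg.2 (by linarith)
    refine ⟨l ^ 2 * (1 + 2 * N * (N ^ 2 + 1)), by positivity, fun x u x' u' _ _ => ?_⟩
    rw [Finset.mul_sum]
    refine Finset.sum_le_sum fun i _ => ?_
    -- Only the pseudogradient is assumed Lipschitz. With at least two agents, any pair (own
    -- decision a, aggregate b) is realized by a genuine profile: agent i plays a and all the others
    -- play (Nb - a)/(N - 1).
    set X : Vec n → Vec n → Fin N → Vec n := fun a b =>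
      Function.update (fun _ => r • ((N : ℝ) • b - a)) i a with hX
    have hXi : ∀ a b, X a b i = a := fun a b => by simp [hX]
    have hXa : ∀ a b, avg (X a b) = b := fun a b => by
      simp only [hX]
      rw [avg_update, avg_const hN]
      have h1 : r * ((N : ℝ) - 1) = 1 := inv_mul_cancel₀ (by linarith)
      have h2 : (N : ℝ)⁻¹ * N = 1 := inv_mul_cancel₀ (by positivity)
      set q := (N : ℝ)⁻¹
      have e1 : r • ((N : ℝ) • b - a) + q • (a - r • ((N : ℝ) • b - a))
          = (r * N - q * r * N) • b + (q + q * r - r) • a := by module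
      have e2 : r * N - q * r * N = 1 := by linear_combination h1 - r * h2
      have e3 : q + q * r - r = 0 := by linear_combination (-q) * h1 + r * h2
      rw [e1, e2, e3]; simp
    have h1 := hlip (X (x i) (u i)) (X (x' i) (u' i))
    simp only [hXa] at h1
    have h2 := (Finset.single_le_sum (f := fun j => ‖G.extGrad j (X (x i) (u i) j) (u i)
      - G.extGrad j (X (x' i) (u' i) j) (u' i)‖ ^ 2) (fun j _ => sq_nonneg _)
      (Finset.mem_univ i)).trans h1
    simp only [hXi] at h2
    refine h2.trans ?_
    rw [mul_assoc]
    refine mul_le_mul_of_nonneg_left ?_ (sq_nonneg l)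
    have h3 : ∀ j, ‖X (x i) (u i) j - X (x' i) (u' i) j‖ ^ 2 ≤ (if j = i then ‖x i - x' i‖ ^ 2 else 0)
        + 2 * (N ^ 2 + 1) * (‖x i - x' i‖ ^ 2 + ‖u i - u' i‖ ^ 2) := by
      intro j
      by_cases hj : j = i
      · subst hj
        simp only [hXi, if_true, le_add_iff_nonneg_right]
        positivity
      · simp only [hX, Function.update_of_ne hj, if_neg hj, zero_add]
        have e1 : r • ((N : ℝ) • u i - x i) - r • ((N : ℝ) • u' i - x' i)
            = r • ((N : ℝ) • (u i - u' i) - (x i - x' i)) := by module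
        rw [e1, norm_smul, mul_pow, Real.norm_eq_abs, sq_abs]
        have h4 : ‖(N : ℝ) • (u i - u' i) - (x i - x' i)‖ ≤ N * ‖u i - u' i‖ + ‖x i - x' i‖ := by
          refine (norm_sub_le _ _).trans ?_
          rw [norm_smul]; simp
        have h5 := pow_le_pow_left₀ (norm_nonneg _) h4 2
        have h6 : r ^ 2 ≤ 1 := by nlinarith
        refine (mul_le_mul h6 h5 (sq_nonneg _) zero_le_one).trans ?_
        nlinarith [sq_nonneg ((N : ℝ) * ‖u i - u' i‖ - ‖x i - x' i‖), sq_nonneg ‖u i - u' i‖,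
          sq_nonneg ((N : ℝ) * ‖x i - x' i‖)]
    refine (Finset.sum_le_sum fun j _ => h3 j).trans ?_
    rw [Finset.sum_add_distrib, Finset.sum_ite_eq', if_pos (Finset.mem_univ _), Finset.sum_const,
      Finset.card_univ, Fintype.card_fin, nsmul_eq_mul]
    nlinarith [sq_nonneg ‖u i - u' i‖]
  · obtain rfl : N = 1 := by omega
    refine ⟨l ^ 2, sq_nonneg l, fun x u x' u' hu hu' => ?_⟩
    have key : ∀ x u : Fin 1 → Vec n, avg u = avg x → ∀ i, u i = avg x := by
      intro x u hu i
      rw [← hu]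
      simp [avg, Subsingleton.elim i 0]
    have h1 := hlip x x'
    simp only [key x u hu, key x' u' hu']
    refine h1.trans (mul_le_mul_of_nonneg_left ?_ (sq_nonneg l))
    exact Finset.sum_le_sum fun i _ => le_add_of_nonneg_right (sq_nonneg _)

lemma update_mem_localSet {x : Fin N → Vec n} (hx : x ∈ G.localSet) {i : Fin N} {y : Vec n}
    (hy : y ∈ G.S i) : Function.update x i y ∈ G.localSet := by
  intro j
  by_cases hj : j = i
  · subst hj; simpa
  · simpa [hj] using hx j

/-- First-order lower bound of the expected smooth cost. -/
lemma SmoothCosts.inner_pseudograd_le (h : G.SmoothCosts) {x : Fin N → Vec n}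
    (hx : x ∈ G.localSet) (i : Fin N) {y : Vec n} (hy : y ∈ G.S i) :
    inner ℝ (G.pseudograd i x) (y - x i) ≤
      (∫ ω, G.smooth i (Function.update x i y) (ω i) ∂G.law) - ∫ ω, G.smooth i x (ω i) ∂G.law := by
  rw [h.pseudograd_eq, ← integral_sub (h.integrable_cost i _ (update_mem_localSet hx hy))
    (h.integrable_cost i x hx), real_inner_comm]
  unfold extGrad
  rw [← integral_inner (h.integrable_grad i _ _)]
  refine integral_mono ((h.integrable_grad i _ _).const_inner _)
    ((h.integrable_cost i _ (update_mem_localSet hx hy)).sub (h.integrable_cost i x hx)) fun ω => ?_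
  have hgr := h.hasGradientAt_smooth i x (ω i)
  have hcv := h.convex i (ω i) x hx
  set φ := fun t => G.smooth i (Function.update x i t) (ω i) with hφ
  have hφx : G.smooth i x (ω i) = φ (x i) := by simp [hφ]
  have hline : HasDerivAt (fun s : ℝ => x i + s • (y - x i)) (y - x i) 0 := by
    simpa using ((hasDerivAt_id (0 : ℝ)).smul_const (y - x i)).const_add (x i)
  have hder : HasDerivAt (fun s : ℝ => φ (x i + s • (y - x i)))
      (inner ℝ (G.sampleGrad i (x i) (avg x) (ω i)) (y - x i)) 0 := by
    have h0 : x i + (0 : ℝ) • (y - x i) = x i := by simp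
    have h1 := hasGradientAt_iff_hasFDerivAt.1 hgr
    have h2 := (HasFDerivAt.comp_hasDerivAt (0 : ℝ) (h0.symm ▸ h1) hline)
    exact h2.congr_deriv (by simp)
  have hslope := hder.tendsto_slope_zero_right
  rw [real_inner_comm]
  simp only
  rw [hφx]
  -- By convexity, each difference quotient along the segment is at most the full increment; the
  -- derivative is their limit from the right.
  refine le_of_tendsto hslope ?_
  filter_upwards [Ioc_mem_nhdsGT (zero_lt_one (α := ℝ))] with t ht
  have h3 : x i + t • (y - x i) = (1 - t) • x i + t • y := by module
  have h4 := hcv.2 (hx i) hy (by linarith [ht.2] : (0 : ℝ) ≤ 1 - t) ht.1.le (by ring)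
  simp only [zero_add, zero_smul, add_zero, smul_eq_mul] at h4 ⊢
  rw [h3, inv_mul_le_iff₀ ht.1]
  change φ _ ≤ _ at h4
  linarith

/-- At a unilateral deviation only one summand of the inequality survives, and convexity bounds its
linear part by the change of expected cost. -/
lemma isSGNE_of_variational (h : G.SmoothCosts) {x : Fin N → Vec n} (hx : x ∈ G.feasible)
    (hvi : ∀ y ∈ G.feasible,
      0 ≤ ∑ i, (inner ℝ (G.pseudograd i x) (y i - x i) + (G.g i (y i) - G.g i (x i)))) :
    G.IsSGNE x := by
  refine ⟨hx, fun i y hy => ?_⟩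
  have h1 := hvi _ hy
  rw [Finset.sum_eq_single i] at h1
  · have hyi : y ∈ G.S i := by simpa using hy.1 i
    have h2 := h.inner_pseudograd_le hx.1 i hyi
    simp only [Function.update_self] at h1
    simp only [cost, Function.update_self]
    linarith
  · intro j _ hj
    simp [Function.update_of_ne hj]
  · simp

/-- The stacked pseudogradient. -/
def stackGrad (G : AggGame N n m Ξ) (x : Stack N n) : Stack N n :=
  WithLp.toLp 2 fun i => G.pseudograd i x

lemma exists_variational (hloc : G.LocalCosts) (hs : G.Slater) (hm : G.StronglyMonotone) :
    ∃ x ∈ G.feasible, ∀ y ∈ G.feasible,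
      0 ≤ ∑ i, (inner ℝ (G.pseudograd i x) (y i - x i) + (G.g i (y i) - G.g i (x i))) := by
  obtain ⟨⟨η, hη, hmono⟩, l, hl, hlip⟩ := hm
  obtain ⟨x0, hx0, hx0s⟩ := hs
  set K : Set (Stack N n) := {x | WithLp.ofLp x ∈ G.feasible} with hK
  have hKne : K.Nonempty := ⟨WithLp.toLp 2 x0, hx0, fun r => (hx0s r).le⟩
  have hfc : IsCompact G.feasible := by
    have h1 : G.localSet = Set.pi Set.univ G.S := by ext; simp [localSet]
    have h2 : IsCompact G.localSet := by
      rw [h1]; exact isCompact_univ_pi fun i => (hloc i).2.1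
    have h3 : G.feasible
        = G.localSet ∩ {x | ∀ r, (∑ i, G.A i (x i)) r ≤ (∑ i, G.b i) r} := rfl
    rw [h3]
    refine h2.inter_right ?_
    simp only [Set.ofPred_forall]
    exact isClosed_iInter fun r => isClosed_le (by fun_prop) continuous_const
  have hKc : IsCompact K := by
    have : K = (PiLp.continuousLinearEquiv 2 ℝ (fun _ : Fin N => Vec n)).symm '' G.feasible := by
      rw [ContinuousLinearEquiv.image_symm_eq_preimage]; rfl
    rw [this]
    exact hfc.image (ContinuousLinearEquiv.continuous _)
  have hKconv : Convex ℝ K := by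
    intro x hx y hy a b ha hb hab
    refine ⟨fun i => (hloc i).2.2.1 (hx.1 i) (hy.1 i) ha hb hab, fun r => ?_⟩
    have h1 : (∑ i, G.A i ((a • x + b • y) i)) r
        = a * (∑ i, G.A i (x i)) r + b * (∑ i, G.A i (y i)) r := by
      simp [Finset.mul_sum, Finset.sum_add_distrib]
    change (∑ i, G.A i ((a • x + b • y) i)) r ≤ _
    rw [h1]
    have h2 := mul_le_mul_of_nonneg_left (hx.2 r) ha
    have h3 := mul_le_mul_of_nonneg_left (hy.2 r) hb
    have h4 : a * (∑ i, G.b i) r + b * (∑ i, G.b i) r = (∑ i, G.b i) r := by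
      rw [← add_mul, hab, one_mul]
    linarith
  set g : Stack N n → ℝ := fun x => ∑ i, G.g i (x i) with hg
  have hgc : ConvexOn ℝ K g := by
    refine ⟨hKconv, fun x hx y hy a b ha hb hab => ?_⟩
    simp only [hg, smul_eq_mul, Finset.mul_sum, ← Finset.sum_add_distrib]
    exact Finset.sum_le_sum fun i _ => (hloc i).2.2.2.1.2 (hx.1 i) (hy.1 i) ha hb hab
  have hgl : LowerSemicontinuousOn g K := by
    refine lowerSemicontinuousOn_sum fun i _ => ?_
    refine (hloc i).2.2.2.2.comp (g := fun x : Stack N n => x i) ?_ ?_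
    · fun_prop
    · exact fun x hx => hx.1 i
  obtain ⟨x, hx, hvi⟩ := exists_variational_solution (F := G.stackGrad) (l := l) hKne hKc hgc hgl hη
    (fun x hx y hy => by
      rw [Stack.norm_sq_eq, Stack.inner_eq]; exact hmono x hx.1 y hy.1)
    (fun x hx y hy => by
      refine abs_le_of_sq_le_sq' ?_ (by positivity) |>.2
      rw [mul_pow, Stack.norm_sq_eq, Stack.norm_sq_eq]; exact hlip x y)
  refine ⟨x, hx, fun y hy => ?_⟩
  have h1 := hvi (WithLp.toLp 2 y) hy
  rw [Stack.inner_eq] at h1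
  simpa [Finset.sum_add_distrib, hg, stackGrad] using h1

/-- Testing each solution at the other and adding cancels `g` and contradicts strong monotonicity
unless they coincide. -/
lemma variational_unique (hm : G.StronglyMonotone) {x y : Fin N → Vec n}
    (hx : x ∈ G.feasible) (hy : y ∈ G.feasible)
    (hxv : ∀ y ∈ G.feasible,
      0 ≤ ∑ i, (inner ℝ (G.pseudograd i x) (y i - x i) + (G.g i (y i) - G.g i (x i))))
    (hyv : ∀ x ∈ G.feasible,
      0 ≤ ∑ i, (inner ℝ (G.pseudograd i y) (x i - y i) + (G.g i (x i) - G.g i (y i)))) :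
    y = x := by
  obtain ⟨⟨η, hη, hmono⟩, -⟩ := hm
  have h1 := add_nonneg (hxv y hy) (hyv x hx)
  have h2 := hmono x hx.1 y hy.1
  rw [← Finset.sum_add_distrib] at h1
  have h3 : ∑ i, (inner ℝ (G.pseudograd i x) (y i - x i) + (G.g i (y i) - G.g i (x i)) +
      (inner ℝ (G.pseudograd i y) (x i - y i) + (G.g i (x i) - G.g i (y i))))
      = - ∑ i, inner ℝ (G.pseudograd i x - G.pseudograd i y) (x i - y i) := by
    rw [← Finset.sum_neg_distrib]
    refine Finset.sum_congr rfl fun i _ => ?_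
    rw [← neg_sub (x i) (y i), inner_neg_right, inner_sub_left]; ring
  rw [h3] at h1
  have h4 : ∑ i, ‖x i - y i‖ ^ 2 ≤ 0 := by
    by_contra h5
    push Not at h5
    have := mul_pos hη h5
    linarith
  have h5 := (Finset.sum_eq_zero_iff_of_nonneg fun i _ => sq_nonneg ‖x i - y i‖).1
    (le_antisymm h4 (Finset.sum_nonneg fun i _ => sq_nonneg _))
  ext1 i
  have h6 := h5 i (Finset.mem_univ i)
  exact (sub_eq_zero.1 (norm_eq_zero.1 (pow_eq_zero_iff two_ne_zero |>.1 h6))).symm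

/-- Karush-Kuhn-Tucker multiplier of the coupling constraints. -/
lemma exists_kkt (hloc : G.LocalCosts) (hs : G.Slater) {x : Fin N → Vec n} (hx : x ∈ G.feasible)
    (hvi : ∀ y ∈ G.feasible,
      0 ≤ ∑ i, (inner ℝ (G.pseudograd i x) (y i - x i) + (G.g i (y i) - G.g i (x i)))) :
    ∃ lam : Vec m, (∀ r, 0 ≤ lam r) ∧ inner ℝ lam (∑ i, (G.A i (x i) - G.b i)) = 0 ∧
      ∀ i, ∀ y ∈ G.S i, 0 ≤ inner ℝ (G.pseudograd i x + (G.A i).adjoint lam) (y - x i)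
        + (G.g i y - G.g i (x i)) := by
  have hCconv : Convex ℝ G.localSet := fun x hx y hy a b ha hb hab i =>
    (hloc i).2.2.1 (hx i) (hy i) ha hb hab
  have hdual : ∃ l : Fin m → ℝ, (∀ r, 0 ≤ l r) ∧ ∀ y ∈ G.localSet,
      0 ≤ (∑ i, (inner ℝ (G.pseudograd i x) (y i - x i) + (G.g i (y i) - G.g i (x i))))
        + ∑ r, l r * (∑ i, (G.A i (y i) - G.b i)) r := by
    refine exists_multiplier (C := G.localSet)
      (φ := fun y => ∑ i, (inner ℝ (G.pseudograd i x) (y i - x i) + (G.g i (y i) - G.g i (x i))))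
      (h := fun r y => (∑ i, (G.A i (y i) - G.b i)) r) ?_ ?_ ?_ ?_
    · refine ⟨hCconv, fun y hy z hz a b ha hb hab => ?_⟩
      simp only [smul_eq_mul, Finset.mul_sum, ← Finset.sum_add_distrib]
      refine Finset.sum_le_sum fun i _ => ?_
      have h1 := (hloc i).2.2.2.1.2 (hy i) (hz i) ha hb hab
      have h2 : a • y i + b • z i - x i = a • (y i - x i) + b • (z i - x i) := by
        have : x i = (a + b) • x i := by rw [hab, one_smul]
        conv_lhs => rw [this]
        module
      simp only [Pi.add_apply, Pi.smul_apply, smul_eq_mul] at h1 ⊢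
      rw [h2, inner_add_right, inner_smul_right, inner_smul_right]
      have h3 : G.g i (x i) = a * G.g i (x i) + b * G.g i (x i) := by rw [← add_mul, hab, one_mul]
      linarith
    · intro r
      refine ⟨hCconv, fun y hy z hz a b ha hb hab => le_of_eq ?_⟩
      have h1 : (∑ i, G.b i) r = a * (∑ i, G.b i) r + b * (∑ i, G.b i) r := by
        rw [← add_mul, hab, one_mul]
      simp only [Finset.sum_sub_distrib, PiLp.sub_apply, Pi.add_apply, Pi.smul_apply, map_add,
        map_smul, Finset.sum_add_distrib, ← Finset.smul_sum, PiLp.add_apply, PiLp.smul_apply,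
        smul_eq_mul]
      linarith
    · obtain ⟨y, hy, hys⟩ := hs
      refine ⟨y, hy, fun r => ?_⟩
      have := hys r
      simp only [Finset.sum_sub_distrib, PiLp.sub_apply]
      linarith
    · intro y hy hyr
      refine hvi y ⟨hy, fun r => ?_⟩
      have := hyr r
      simp only [Finset.sum_sub_distrib, PiLp.sub_apply] at this
      linarith
  obtain ⟨l, hl0, hl⟩ := hdual
  set lam : Vec m := WithLp.toLp 2 l with hlam
  have hin : ∀ v : Vec m, ∑ r, l r * v r = inner ℝ lam v := by
    intro v
    rw [PiLp.inner_apply]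
    exact Finset.sum_congr rfl fun r _ => by simp [hlam, mul_comm]
  simp only [hin] at hl
  have hcs : inner ℝ lam (∑ i, (G.A i (x i) - G.b i)) = 0 := by
    refine le_antisymm ?_ ?_
    · rw [← hin]
      refine Finset.sum_nonpos fun r _ => mul_nonpos_of_nonneg_of_nonpos (hl0 r) ?_
      have := hx.2 r
      simp only [Finset.sum_sub_distrib, PiLp.sub_apply]
      linarith
    · simpa using hl x hx.1
  refine ⟨lam, hl0, hcs, fun i y hy => ?_⟩
  -- The dual inequality involves only the product of the local sets, so it can be tested with a
  -- change of agent `i` alone; complementary slackness removes the constraint value at `x`.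
  have h1 := hl _ (update_mem_localSet hx.1 hy)
  rw [Finset.sum_eq_single i (fun j _ hj => by simp [Function.update_of_ne hj]) (by simp)] at h1
  have h2 : ∑ j, (G.A j (Function.update x i y j) - G.b j)
      = ∑ j, (G.A j (x j) - G.b j) + G.A i (y - x i) := by
    rw [← sub_eq_iff_eq_add', ← Finset.sum_sub_distrib,
      Finset.sum_eq_single i (fun j _ hj => by simp [Function.update_of_ne hj]) (by simp)]
    simp
  rw [h2, inner_add_right, hcs, Function.update_self] at h1
  rw [inner_add_left, ContinuousLinearMap.adjoint_inner_left]
  linarith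

end AggGame

/-! ### The weighted graph Laplacian. -/

section Laplacian

variable {N d : ℕ} {w : Fin N → Fin N → ℝ} {Γ : SimpleGraph (Fin N)}

lemma norm_sum_sq_le {ι E : Type*} [SeminormedAddCommGroup E] (s : Finset ι) (v : ι → E) :
    ‖∑ i ∈ s, v i‖ ^ 2 ≤ (s.card : ℝ) * ∑ i ∈ s, ‖v i‖ ^ 2 :=
  (pow_le_pow_left₀ (norm_nonneg _) (norm_sum_le s v) 2).trans sq_sum_le_card_mul_sum_sq

/-- The Laplacian as a linear map on stacked vectors. -/
def lap (w : Fin N → Fin N → ℝ) (d : ℕ) : Stack N d →ₗ[ℝ] Stack N d where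
  toFun u := WithLp.toLp 2 (laplacian w u)
  map_add' u v := by
    ext1 i
    simp only [laplacian, PiLp.add_apply, ← Finset.sum_add_distrib]
    exact Finset.sum_congr rfl fun j _ => by module
  map_smul' c u := by
    ext1 i
    simp only [laplacian, PiLp.smul_apply, RingHom.id_apply, Finset.smul_sum]
    exact Finset.sum_congr rfl fun j _ => by module

lemma lap_apply (u : Stack N d) (i : Fin N) : lap w d u i = ∑ j, w i j • (u i - u j) := rfl

/-- Deviation of a stacked vector from its average. -/
def deviation (N d : ℕ) : Stack N d →ₗ[ℝ] Stack N d where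
  toFun u := WithLp.toLp 2 fun i => u i - avg u
  map_add' u v := by
    ext1 i
    simp only [avg, PiLp.add_apply, Finset.sum_add_distrib, smul_add]
    abel
  map_smul' c u := by
    ext1 i
    simp only [avg, PiLp.smul_apply, RingHom.id_apply, smul_sub, ← Finset.smul_sum]
    rw [smul_comm]

lemma deviation_apply (u : Stack N d) (i : Fin N) : deviation N d u i = u i - avg u := rfl

lemma deviation_eq_self {u : Stack N d} (h : ∑ i, u i = 0) : deviation N d u = u := by
  ext1 i
  rw [deviation_apply, avg, h, smul_zero, sub_zero]

lemma sum_deviation (u : Stack N d) : ∑ i, deviation N d u i = 0 := by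
  rcases Nat.eq_zero_or_pos N with rfl | hN
  · simp
  · simp only [deviation_apply, Finset.sum_sub_distrib, Finset.sum_const, Finset.card_univ,
      Fintype.card_fin, avg]
    rw [← Nat.cast_smul_eq_nsmul ℝ, smul_smul, mul_inv_cancel₀ (by positivity), one_smul, sub_self]

lemma norm_deviation_le (u : Stack N d) : ‖deviation N d u‖ ≤ ‖u‖ := by
  refine abs_le_of_sq_le_sq' ?_ (norm_nonneg _) |>.2
  rw [Stack.norm_sq_eq, Stack.norm_sq_eq]
  have h1 : ∀ i, ‖u i‖ ^ 2 = ‖deviation N d u i‖ ^ 2 + 2 * inner ℝ (deviation N d u i) (avg u)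
      + ‖avg u‖ ^ 2 := by
    intro i
    rw [← norm_add_sq_real, deviation_apply, sub_add_cancel]
  simp only [h1, Finset.sum_add_distrib, ← Finset.mul_sum, ← sum_inner, sum_deviation,
    inner_zero_left, mul_zero, add_zero]
  exact le_add_of_nonneg_right (Finset.sum_nonneg fun _ _ => sq_nonneg _)

lemma lap_eq_zero_of_const {u : Stack N d} {a : Vec d} (h : ∀ i, u i = a) : lap w d u = 0 := by
  ext1 i
  rw [lap_apply]
  simp [h]

lemma lap_deviation (u : Stack N d) : lap w d (deviation N d u) = lap w d u := by
  ext1 i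
  simp [lap_apply, deviation_apply]

namespace IsGraphWeight

lemma nonneg (hw : IsGraphWeight Γ w) (i j : Fin N) : 0 ≤ w i j := by
  by_cases h : Γ.Adj i j
  · exact (hw.pos i j h).le
  · exact (hw.zero i j h).ge

lemma inner_lap (hw : IsGraphWeight Γ w) (u v : Stack N d) :
    inner ℝ (lap w d u) v = (1 / 2) * ∑ i, ∑ j, w i j * inner ℝ (u i - u j) (v i - v j) := by
  have h1 : inner ℝ (lap w d u) v = ∑ i, ∑ j, w i j * inner ℝ (u i - u j) (v i) := by
    rw [Stack.inner_eq]
    refine Finset.sum_congr rfl fun i _ => ?_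
    rw [lap_apply, sum_inner]
    exact Finset.sum_congr rfl fun j _ => by rw [real_inner_smul_left]
  have h2 : ∑ i, ∑ j, w i j * inner ℝ (u i - u j) (v j)
      = - ∑ i, ∑ j, w i j * inner ℝ (u i - u j) (v i) := by
    rw [Finset.sum_comm, ← Finset.sum_neg_distrib]
    refine Finset.sum_congr rfl fun i _ => ?_
    rw [← Finset.sum_neg_distrib]
    refine Finset.sum_congr rfl fun j _ => ?_
    rw [hw.symm j i, ← neg_sub (u i), inner_neg_left]; ring
  simp only [inner_sub_right, mul_sub, Finset.sum_sub_distrib, h2]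
  rw [h1]; ring

lemma lap_symm (hw : IsGraphWeight Γ w) (u v : Stack N d) :
    inner ℝ (lap w d u) v = inner ℝ u (lap w d v) := by
  rw [hw.inner_lap, real_inner_comm, hw.inner_lap]
  congr 1
  exact Finset.sum_congr rfl fun i _ => Finset.sum_congr rfl fun j _ => by rw [real_inner_comm]

lemma inner_lap_self (hw : IsGraphWeight Γ w) (u : Stack N d) :
    inner ℝ (lap w d u) u = (1 / 2) * ∑ i, ∑ j, w i j * ‖u i - u j‖ ^ 2 := by
  rw [hw.inner_lap]
  simp only [real_inner_self_eq_norm_sq]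

lemma inner_lap_self_nonneg (hw : IsGraphWeight Γ w) (u : Stack N d) :
    0 ≤ inner ℝ (lap w d u) u := by
  rw [hw.inner_lap_self]
  have : 0 ≤ ∑ i, ∑ j, w i j * ‖u i - u j‖ ^ 2 :=
    Finset.sum_nonneg fun i _ => Finset.sum_nonneg fun j _ =>
      mul_nonneg (hw.nonneg i j) (sq_nonneg _)
  positivity

lemma sum_lap (hw : IsGraphWeight Γ w) (u : Stack N d) : ∑ i, lap w d u i = 0 := by
  have h1 : ∑ i, lap w d u i = - ∑ i, lap w d u i := by
    simp only [lap_apply]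
    conv_lhs => rw [Finset.sum_comm]
    rw [← Finset.sum_neg_distrib]
    refine Finset.sum_congr rfl fun i _ => ?_
    rw [← Finset.sum_neg_distrib]
    refine Finset.sum_congr rfl fun j _ => ?_
    rw [hw.symm j i]; module
  have h2 : (2 : ℝ) • ∑ i, lap w d u i = 0 := by
    rw [two_smul]
    nth_rewrite 1 [h1]
    exact neg_add_cancel _
  exact (smul_eq_zero.1 h2).resolve_left two_ne_zero

/-- Cauchy-Schwarz over the neighbors, each weight being at most the total weight. The constant does
not depend on `d`, since it serves both the decisions and the multipliers. -/
lemma exists_norm_lap_le (hw : IsGraphWeight Γ w) :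
    ∃ κ : ℝ, 0 < κ ∧ ∀ (d : ℕ) (u : Stack N d), ‖lap w d u‖ ^ 2 ≤ κ * inner ℝ (lap w d u) u := by
  set W : ℝ := ∑ i, ∑ j, w i j with hW
  have hW0 : 0 ≤ W := Finset.sum_nonneg fun i _ => Finset.sum_nonneg fun j _ => hw.nonneg i j
  have hwW : ∀ i j, w i j ≤ W := fun i j =>
    (Finset.single_le_sum (f := fun j => w i j) (fun j _ => hw.nonneg i j)
      (Finset.mem_univ j)).trans
    (Finset.single_le_sum (f := fun i => ∑ j, w i j)
      (fun i _ => Finset.sum_nonneg fun j _ => hw.nonneg i j) (Finset.mem_univ i))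
  refine ⟨2 * N * W + 1, by positivity, fun d u => ?_⟩
  have h1 : ‖lap w d u‖ ^ 2 ≤ N * W * ∑ i, ∑ j, w i j * ‖u i - u j‖ ^ 2 := by
    rw [Stack.norm_sq_eq, Finset.mul_sum]
    refine Finset.sum_le_sum fun i _ => ?_
    rw [lap_apply]
    refine (norm_sum_sq_le _ _).trans ?_
    rw [Finset.card_univ, Fintype.card_fin, mul_assoc]
    refine mul_le_mul_of_nonneg_left ?_ (Nat.cast_nonneg _)
    rw [Finset.mul_sum]
    refine Finset.sum_le_sum fun j _ => ?_
    rw [norm_smul, mul_pow, Real.norm_eq_abs, sq_abs, sq, mul_assoc]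
    exact mul_le_mul_of_nonneg_right (hwW i j) (mul_nonneg (hw.nonneg i j) (sq_nonneg _))
  have h2 := hw.inner_lap_self_nonneg u
  have h3 := hw.inner_lap_self u
  have h4 : ∑ i, ∑ j, w i j * ‖u i - u j‖ ^ 2 = 2 * inner ℝ (lap w d u) u := by linarith
  rw [h4] at h1
  nlinarith

/-- Poincaré inequality on a connected weighted graph. -/
lemma exists_poincare (hw : IsGraphWeight Γ w) :
    ∃ C : ℝ, 0 < C ∧ ∀ (d : ℕ) (u : Stack N d),
      ‖deviation N d u‖ ^ 2 ≤ C * inner ℝ (lap w d u) u := by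
  have hpath : ∀ i j, ∃ C : ℝ, 0 ≤ C ∧ ∀ (d : ℕ) (u : Stack N d),
      ‖u i - u j‖ ^ 2 ≤ C * inner ℝ (lap w d u) u := by
    intro i j
    obtain ⟨p⟩ := hw.connected.preconnected i j
    -- Connectivity enters here: each edge difference is bounded by the energy, and (a + b)² ≤ 2a² +
    -- 2b² adds one edge of the walk at a time.
    induction p with
    | nil => exact ⟨0, le_rfl, fun d u => by simp⟩
    | @cons a b c hab p ih =>
      obtain ⟨C, hC, hCu⟩ := ih
      have hwp := hw.pos a b hab
      refine ⟨2 * C + 4 / w a b, by positivity, fun d u => ?_⟩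
      have h1 : w a b * ‖u a - u b‖ ^ 2 ≤ 2 * inner ℝ (lap w d u) u := by
        rw [hw.inner_lap_self, ← mul_assoc, mul_one_div_cancel two_ne_zero, one_mul]
        exact (Finset.single_le_sum (f := fun j => w a j * ‖u a - u j‖ ^ 2)
          (fun j _ => mul_nonneg (hw.nonneg a j) (sq_nonneg _)) (Finset.mem_univ b)).trans
          (Finset.single_le_sum (f := fun i => ∑ j, w i j * ‖u i - u j‖ ^ 2)
          (fun i _ => Finset.sum_nonneg fun j _ => mul_nonneg (hw.nonneg i j) (sq_nonneg _))
          (Finset.mem_univ a))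
      have h2 : ‖u a - u b‖ ^ 2 ≤ 2 / w a b * inner ℝ (lap w d u) u := by
        rw [div_mul_eq_mul_div, le_div_iff₀ hwp]; linarith
      have h3 := hCu d u
      have h4 : ‖u a - u c‖ ≤ ‖u a - u b‖ + ‖u b - u c‖ := norm_sub_le_norm_sub_add_norm_sub _ _ _
      have h5 := pow_le_pow_left₀ (norm_nonneg _) h4 2
      have h6 : (2 * C + 4 / w a b) * inner ℝ (lap w d u) u
        = 2 * (C * inner ℝ (lap w d u) u) + 2 * (2 / w a b * inner ℝ (lap w d u) u) := by ring
      rw [h6]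
      nlinarith [sq_nonneg (‖u a - u b‖ - ‖u b - u c‖)]
  choose C hC hCu using hpath
  have hS : 0 ≤ ∑ i, ∑ j, C i j :=
    Finset.sum_nonneg fun i _ => Finset.sum_nonneg fun j _ => hC i j
  have hN : 0 < N := by
    obtain ⟨i⟩ := hw.connected.nonempty
    exact i.pos
  refine ⟨∑ i, ∑ j, C i j + 1, by positivity, fun d u => ?_⟩
  have h1 : ‖deviation N d u‖ ^ 2 ≤ (∑ i, ∑ j, C i j) * inner ℝ (lap w d u) u := by
    rw [Stack.norm_sq_eq, Finset.sum_mul]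
    refine Finset.sum_le_sum fun i _ => ?_
    have e1 : deviation N d u i = (N : ℝ)⁻¹ • ∑ j, (u i - u j) := by
      rw [deviation_apply, Finset.sum_sub_distrib, smul_sub, avg, Finset.sum_const,
        Finset.card_univ, Fintype.card_fin, ← Nat.cast_smul_eq_nsmul ℝ, smul_smul,
        inv_mul_cancel₀ (by positivity), one_smul]
    rw [e1, norm_smul, mul_pow, Finset.sum_mul]
    have h2 := norm_sum_sq_le Finset.univ fun j => u i - u j
    rw [Finset.card_univ, Fintype.card_fin] at h2
    have h3 := mul_le_mul_of_nonneg_left h2 (sq_nonneg ‖(N : ℝ)⁻¹‖)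
    refine h3.trans ?_
    have hNr : (1 : ℝ) ≤ N := by exact_mod_cast hN
    have h4 : ‖(N : ℝ)⁻¹‖ ^ 2 * N ≤ 1 := by
      rw [Real.norm_eq_abs, sq_abs, sq, mul_assoc, inv_mul_cancel₀ (by positivity), mul_one]
      exact inv_le_one_of_one_le₀ hNr
    rw [← mul_assoc]
    have h5 : 0 ≤ ∑ j, ‖u i - u j‖ ^ 2 := Finset.sum_nonneg fun _ _ => sq_nonneg _
    refine (mul_le_of_le_one_left h5 h4).trans ?_
    exact Finset.sum_le_sum fun j _ => hCu i j d u
  have := hw.inner_lap_self_nonneg u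
  linarith

/-- The range of a symmetric operator is the orthogonal complement of its kernel, and by the
Poincaré inequality the kernel contains only consensus vectors. -/
lemma exists_lap_eq (hw : IsGraphWeight Γ w) {z : Stack N d} (hz : ∑ i, z i = 0) :
    ∃ ζ, lap w d ζ = z := by
  have hsymm : (lap w d).IsSymmetric := fun u v => hw.lap_symm u v
  have h1 : z ∈ (LinearMap.range (lap w d))ᗮᗮ := by
    rw [hsymm.orthogonal_range, Submodule.mem_orthogonal]
    intro u hu
    rw [LinearMap.mem_ker] at hu
    obtain ⟨C, -, hC⟩ := hw.exists_poincare
    have h2 := hC d u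
    rw [hu, inner_zero_left, mul_zero] at h2
    have h3 : deviation N d u = 0 :=
      norm_eq_zero.1 (pow_eq_zero_iff two_ne_zero |>.1 (le_antisymm h2 (sq_nonneg _)))
    have h4 : ∀ i, u i = avg u := fun i => by
      have : deviation N d u i = 0 := by rw [h3]; rfl
      rwa [deviation_apply, sub_eq_zero] at this
    rw [Stack.inner_eq]
    have h5 : ∑ i, inner ℝ (u i) (z i) = ∑ i, inner ℝ (avg u) (z i) :=
      Finset.sum_congr rfl fun i _ => by rw [← h4 i]
    rw [h5, ← inner_sum, hz, inner_zero_right]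
  rw [Submodule.orthogonal_orthogonal] at h1
  exact h1

end IsGraphWeight

end Laplacian

/-! ### One step of the preconditioned primal-dual iteration. -/

section PrimalDual

variable {X Y : Type*} [NormedAddCommGroup X] [InnerProductSpace ℝ X] [NormedAddCommGroup Y]
  [InnerProductSpace ℝ Y]

/-- The quadratic form that preconditions the primal-dual forward-backward iteration. -/
def pdForm (D : X →ₗ[ℝ] X) (D' K : Y →ₗ[ℝ] Y) (A : X →ₗ[ℝ] Y) (ν : ℝ) (p : X) (ζ l : Y) : ℝ :=
  inner ℝ (D p) p + ν⁻¹ * inner ℝ (K ζ) ζ + inner ℝ (D' l) l - 2 * inner ℝ l (A p)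
    + 2 * inner ℝ l (K ζ)

/-- This is the three-point identity of the quadratic form. Its off-diagonal terms are chosen so
that the extrapolations A(2x' - x) and K(2ζ' - ζ) of the dual step cancel the skew coupling between
primal and dual variables. -/
lemma pdForm_step {D : X →ₗ[ℝ] X} {D' K : Y →ₗ[ℝ] Y} {A : X →ₗ[ℝ] Y} {ν : ℝ} (hν : ν ≠ 0)
    (hD : ∀ u v, inner ℝ (D u) v = inner ℝ u (D v))
    (hD' : ∀ u v, inner ℝ (D' u) v = inner ℝ u (D' v))
    (hK : ∀ u v, inner ℝ (K u) v = inner ℝ u (K v))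
    {x x' xs q : X} {ζ ζ' ζs l l' ls : Y} (hζ : ζ' = ζ + ν • l) (hls : K ls = 0)
    (hx : 0 ≤ inner ℝ (D (x' - x)) (xs - x') + inner ℝ q (xs - x') + inner ℝ (l - ls) (A (xs - x')))
    (hl : 0 ≤ inner ℝ (D' (l' - l)) (ls - l')
      - inner ℝ (A (x' - xs) + A (x' - x) - (K (ζ' - ζs) + K (ζ' - ζ))) (ls - l')) :
    pdForm D D' K A ν (x' - xs) (ζ' - ζs) (l' - ls) ≤ pdForm D D' K A ν (x - xs) (ζ - ζs) (l - ls)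
      - pdForm D D' K A ν (x' - x) (ζ' - ζ) (l' - l) - 2 * inner ℝ q (x' - xs) := by
  -- In terms of the new errors and the increments, the claim becomes linear in inner products. The
  -- consensus multiplier disappears because `K ls = 0`.
  obtain ⟨p, rfl⟩ : ∃ p, x' = xs + p := ⟨x' - xs, by abel⟩
  obtain ⟨dx, rfl⟩ : ∃ dx, x = xs + p - dx := ⟨xs + p - x, by abel⟩
  obtain ⟨r, rfl⟩ : ∃ r, l' = ls + r := ⟨l' - ls, by abel⟩
  obtain ⟨dl, rfl⟩ : ∃ dl, l = ls + r - dl := ⟨ls + r - l, by abel⟩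
  obtain ⟨ρ, rfl⟩ : ∃ ρ, ζ' = ζs + ρ := ⟨ζ' - ζs, by abel⟩
  obtain ⟨dz, rfl⟩ : ∃ dz, ζ = ζs + ρ - dz := ⟨ζs + ρ - ζ, by abel⟩
  have hdz : dz = ν • (ls + r - dl) := by
    have : dz = (ζs + ρ) - (ζs + ρ - dz) := by abel
    rw [this]; nth_rewrite 1 [hζ]; abel
  have hKdz : K dz = ν • (K r - K dl) := by
    rw [hdz, map_smul, map_sub, map_add, hls, zero_add]
  have e1 : xs + p - xs = p := by abel
  have e2 : xs + p - (xs + p - dx) = dx := by abel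
  have e3 : xs - (xs + p) = -p := by abel
  have e4 : ls + r - ls = r := by abel
  have e5 : ls + r - (ls + r - dl) = dl := by abel
  have e6 : ls - (ls + r) = -r := by abel
  have e7 : ζs + ρ - ζs = ρ := by abel
  have e8 : ζs + ρ - (ζs + ρ - dz) = dz := by abel
  have e9 : xs + p - dx - xs = p - dx := by abel
  have e10 : ls + r - dl - ls = r - dl := by abel
  have e11 : ζs + ρ - dz - ζs = ρ - dz := by abel
  rw [e2, e3, e10] at hx
  rw [e5, e6, e1, e2, e7, e8] at hl
  rw [e1, e7, e4, e9, e11, e10, e2, e8, e5]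
  have c1 : inner ℝ (D p) dx = inner ℝ (D dx) p := by rw [hD, real_inner_comm]
  have c2 : inner ℝ (D' r) dl = inner ℝ (D' dl) r := by rw [hD', real_inner_comm]
  have c3 : inner ℝ (K ρ) dz = inner ℝ (K dz) ρ := by rw [hK, real_inner_comm]
  have c4 : ν⁻¹ * inner ℝ (K dz) ρ = inner ℝ r (K ρ) - inner ℝ dl (K ρ) := by
    rw [hKdz, real_inner_smul_left, ← mul_assoc, inv_mul_cancel₀ hν, one_mul, inner_sub_left, hK, hK]
  simp only [pdForm, map_sub, map_neg, inner_add_left, inner_sub_left, inner_neg_right,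
    inner_sub_right] at hx hl ⊢
  rw [c1, c2, c3]
  rw [real_inner_comm r (A p), real_inner_comm r (A dx), real_inner_comm r (K ρ),
    real_inner_comm r (K dz)] at hl
  linarith

/-- Completing the squares ‖l - Ap‖² and ‖κl + Kζ‖² costs (1 + κ)‖l‖², a‖p‖² and one copy of ⟨Kζ,
ζ⟩, paid by `D'`, by `D` and by `ν ≤ 1` respectively. `β` is the reserve kept for the increment of
the decisions. -/
lemma le_pdForm {D : X →ₗ[ℝ] X} {D' K : Y →ₗ[ℝ] Y} {A : X →ₗ[ℝ] Y} {ν κ a β : ℝ}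
    (hν : 0 < ν) (hν1 : ν ≤ 1) (hκ : 0 < κ) (hK : ∀ u, ‖K u‖ ^ 2 ≤ κ * inner ℝ (K u) u)
    (hA : ∀ p, ‖A p‖ ^ 2 ≤ a * ‖p‖ ^ 2) (hD : ∀ p, (a + β) * ‖p‖ ^ 2 ≤ inner ℝ (D p) p)
    (hD' : ∀ l, (1 + κ) * ‖l‖ ^ 2 ≤ inner ℝ (D' l) l) (p : X) (ζ l : Y) :
    β * ‖p‖ ^ 2 ≤ pdForm D D' K A ν p ζ l := by
  have hKn : 0 ≤ inner ℝ (K ζ) ζ := nonneg_of_mul_nonneg_right ((sq_nonneg _).trans (hK ζ)) hκ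
  have h1 : inner ℝ (K ζ) ζ ≤ ν⁻¹ * inner ℝ (K ζ) ζ :=
    le_mul_of_one_le_left hKn ((one_le_inv₀ hν).2 hν1)
  have h2 := norm_sub_sq_real l (A p)
  have h3 := norm_add_sq_real (κ • l) (K ζ)
  rw [norm_smul, mul_pow, Real.norm_eq_abs, sq_abs, real_inner_smul_left] at h3
  have h4 : 0 ≤ κ ^ 2 * ‖l‖ ^ 2 + 2 * (κ * inner ℝ l (K ζ)) + κ * inner ℝ (K ζ) ζ := by
    have := hK ζ
    have := sq_nonneg ‖κ • l + K ζ‖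
    linarith
  have h5 : 0 ≤ κ * ‖l‖ ^ 2 + 2 * inner ℝ l (K ζ) + inner ℝ (K ζ) ζ := by
    refine nonneg_of_mul_nonneg_right (a := κ) ?_ hκ
    linarith
  have h6 := sq_nonneg ‖l - A p‖
  have h7 := hA p
  have h8 := hD p
  have h9 := hD' l
  unfold pdForm
  nlinarith

/-- Young's inequality for the error terms of one iteration. -/
lemma forward_error_le {b : ℝ} (hb : 0 < b) (B ε e Δ : X) :
    -2 * inner ℝ (B + ε) (e + Δ) ≤ -2 * inner ℝ B e - 2 * inner ℝ ε e + b * ‖B‖ ^ 2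
      + (b⁻¹ + 1) * ‖Δ‖ ^ 2 + ‖ε‖ ^ 2 := by
  have h1 := norm_add_sq_real (b • B) Δ
  rw [norm_smul, mul_pow, Real.norm_eq_abs, sq_abs, real_inner_smul_left] at h1
  have h2 := norm_add_sq_real ε Δ
  have h3 : 0 ≤ b⁻¹ * ‖b • B + Δ‖ ^ 2 := by positivity
  rw [h1] at h3
  have h4 : b⁻¹ * (b ^ 2 * ‖B‖ ^ 2 + 2 * (b * inner ℝ B Δ) + ‖Δ‖ ^ 2)
      = b * ‖B‖ ^ 2 + 2 * inner ℝ B Δ + b⁻¹ * ‖Δ‖ ^ 2 := by field_simp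
  rw [h4] at h3
  have h5 := sq_nonneg ‖ε + Δ‖
  simp only [inner_add_left, inner_add_right]
  linarith

end PrimalDual

/-! ### Tracking error and forward error. -/

section Tracking

variable {N d : ℕ} {w : Fin N → Fin N → ℝ} {Γ : SimpleGraph (Fin N)}

/-- The Laplacian ignores the consensus part, so Cauchy-Schwarz on its energy at the deviation
allows one factor ‖Lu‖ to be cancelled. -/
lemma norm_lap_le_mul_deviation {κ : ℝ} (hκ : 0 < κ)
    (hlap : ∀ u : Stack N d, ‖lap w d u‖ ^ 2 ≤ κ * inner ℝ (lap w d u) u) (u : Stack N d) :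
    ‖lap w d u‖ ≤ κ * ‖deviation N d u‖ := by
  have h1 := hlap (deviation N d u)
  rw [lap_deviation] at h1
  have h2 := real_inner_le_norm (lap w d u) (deviation N d u)
  by_contra h3
  push Not at h3
  have h4 : 0 ≤ κ * ‖deviation N d u‖ := by positivity
  nlinarith [norm_nonneg (lap w d u)]

/-- The deviation of the tracking estimates contracts, up to the change of the decisions. -/
lemma deviation_tracking_le (hw : IsGraphWeight Γ w) {κ C γ : ℝ} (hC : 0 < C)
    (hlap : ∀ u : Stack N d, ‖lap w d u‖ ^ 2 ≤ κ * inner ℝ (lap w d u) u)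
    (hpoin : ∀ u : Stack N d, ‖deviation N d u‖ ^ 2 ≤ C * inner ℝ (lap w d u) u)
    (hγ : 0 < γ) (hγκ : γ * κ ≤ 1) (u Δ : Stack N d) :
    ‖deviation N d (u - γ • lap w d u + Δ)‖ ^ 2 ≤ (1 - γ / (2 * C)) * ‖deviation N d u‖ ^ 2
      + (1 + (γ / (2 * C))⁻¹) * ‖Δ‖ ^ 2 := by
  set θ := γ / (2 * C) with hθ
  have hθ0 : 0 < θ := by positivity
  have e1 : deviation N d (u - γ • lap w d u + Δ)
      = (deviation N d u - γ • lap w d u) + deviation N d Δ := by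
    rw [map_add, map_sub, map_smul, deviation_eq_self (hw.sum_lap u)]
  set a := deviation N d u - γ • lap w d u with ha
  -- The gradient step gains γ⟨Lu, u⟩ ≥ (γ/C)‖deviation‖², which is 2θ. Half of this rate is spent
  -- below on Young's inequality, as (1 + θ)(1 - 2θ) ≤ 1 - θ.
  have h1 : ‖a‖ ^ 2 ≤ (1 - 2 * θ) * ‖deviation N d u‖ ^ 2 := by
    have h2 := norm_sub_sq_real (deviation N d u) (γ • lap w d u)
    rw [norm_smul, mul_pow, Real.norm_eq_abs, sq_abs, real_inner_smul_right, real_inner_comm,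
      ← lap_deviation u] at h2
    rw [ha, ← lap_deviation u, h2]
    have h3 := hlap (deviation N d u)
    have h4 := hpoin u
    have h4' : inner ℝ (lap w d u) u = inner ℝ (lap w d (deviation N d u)) (deviation N d u) := by
      rw [lap_deviation, hw.lap_symm u (deviation N d u), lap_deviation, hw.lap_symm]
    have h5 := hw.inner_lap_self_nonneg (deviation N d u)
    rw [h4'] at h4
    set I := inner ℝ (lap w d (deviation N d u)) (deviation N d u)
    have h6 : γ ^ 2 * ‖lap w d (deviation N d u)‖ ^ 2 ≤ γ * I := by
      have := mul_le_mul_of_nonneg_left h3 (sq_nonneg γ)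
      have := mul_le_mul_of_nonneg_right hγκ (mul_nonneg hγ.le h5)
      nlinarith
    have h7 : 2 * θ * ‖deviation N d u‖ ^ 2 ≤ γ * I := by
      have : 2 * θ = γ / C := by rw [hθ]; field_simp
      rw [this, div_mul_eq_mul_div, div_le_iff₀ hC]
      nlinarith
    linarith
  have h8 := norm_deviation_le Δ
  have h9 := pow_le_pow_left₀ (norm_nonneg _) h8 2
  set b := deviation N d Δ
  have h10 : ‖a + b‖ ^ 2 ≤ (1 + θ) * ‖a‖ ^ 2 + (1 + θ⁻¹) * ‖b‖ ^ 2 := by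
    have h11 := norm_add_sq_real a b
    have h12 := norm_sub_sq_real (θ • a) b
    rw [norm_smul, mul_pow, Real.norm_eq_abs, sq_abs, real_inner_smul_left] at h12
    have h13 : 0 ≤ θ⁻¹ * ‖θ • a - b‖ ^ 2 := by positivity
    rw [h12] at h13
    have h14 : θ⁻¹ * (θ ^ 2 * ‖a‖ ^ 2 - 2 * (θ * inner ℝ a b) + ‖b‖ ^ 2)
      = θ * ‖a‖ ^ 2 - 2 * inner ℝ a b + θ⁻¹ * ‖b‖ ^ 2 := by field_simp
    linarith
  rw [e1]
  have h15 : (1 + θ) * ‖a‖ ^ 2 ≤ (1 - θ) * ‖deviation N d u‖ ^ 2 := by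
    have := mul_le_mul_of_nonneg_left h1 (by positivity : 0 ≤ 1 + θ)
    nlinarith [sq_nonneg (θ * ‖deviation N d u‖)]
  have h16 : (1 + θ⁻¹) * ‖b‖ ^ 2 ≤ (1 + θ⁻¹) * ‖Δ‖ ^ 2 :=
    mul_le_mul_of_nonneg_left h9 (by positivity)
  linarith

/-- The noise must be paired with the old error `e`, known before the batch is drawn, and not with e
+ Δ. The price is a multiple of ‖Δ‖², and a small weight `b` on the deterministic part, which raises
that price. -/
lemma inner_forward_le {η ℓ b c κ : ℝ} (hb : 0 < b) (hκ : 0 < κ)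
    (hlap : ∀ u : Stack N d, ‖lap w d u‖ ^ 2 ≤ κ * inner ℝ (lap w d u) u)
    {Q F Fs ε e Δ u : Stack N d} (hQ : ‖Q - F‖ ≤ ℓ * ‖deviation N d u‖) (hF : ‖F - Fs‖ ≤ ℓ * ‖e‖)
    (hmono : η * ‖e‖ ^ 2 ≤ inner ℝ (F - Fs) e) :
    -2 * inner ℝ (Q - Fs + c • lap w d u + ε) (e + Δ) ≤
      -2 * η * ‖e‖ ^ 2 + 2 * ℓ * (‖deviation N d u‖ * ‖e‖) - 2 * c * inner ℝ (lap w d u) e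
      - 2 * inner ℝ ε e + b * (3 * (ℓ ^ 2 + c ^ 2 * κ ^ 2)) * (‖e‖ ^ 2 + ‖deviation N d u‖ ^ 2)
      + (b⁻¹ + 1) * ‖Δ‖ ^ 2 + ‖ε‖ ^ 2 := by
  refine (forward_error_le hb _ _ _ _).trans ?_
  have hL := norm_lap_le_mul_deviation hκ hlap u
  set L := lap w d u
  set v := ‖deviation N d u‖
  have h1 : Q - Fs + c • L = (Q - F) + (F - Fs) + c • L := by abel
  have h2 : ‖Q - Fs + c • L‖ ≤ ℓ * v + ℓ * ‖e‖ + |c| * (κ * v) := by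
    rw [h1]
    refine (norm_add₃_le).trans (add_le_add (add_le_add hQ hF) ?_)
    rw [norm_smul, Real.norm_eq_abs]
    exact mul_le_mul_of_nonneg_left hL (abs_nonneg c)
  have h3 : ‖Q - Fs + c • L‖ ^ 2 ≤ 3 * (ℓ ^ 2 + c ^ 2 * κ ^ 2) * (‖e‖ ^ 2 + v ^ 2) := by
    refine (pow_le_pow_left₀ (norm_nonneg _) h2 2).trans ?_
    have : 0 ≤ c ^ 2 * κ ^ 2 * ‖e‖ ^ 2 := by positivity
    have hc : c ^ 2 * κ ^ 2 * v ^ 2 = (|c| * (κ * v)) ^ 2 := by rw [mul_pow, mul_pow, sq_abs]; ring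
    nlinarith [sq_nonneg (ℓ * v - ℓ * ‖e‖), sq_nonneg (ℓ * v - |c| * (κ * v)),
      sq_nonneg (ℓ * ‖e‖ - |c| * (κ * v))]
  have h4 := mul_le_mul_of_nonneg_left h3 hb.le
  have h5 : inner ℝ (Q - Fs + c • L) e = inner ℝ (Q - F) e + inner ℝ (F - Fs) e + c * inner ℝ L e := by
    rw [h1, inner_add_left, inner_add_left, real_inner_smul_left]
  have h6 : -inner ℝ (Q - F) e ≤ ℓ * (v * ‖e‖) := by
    rw [← inner_neg_left]
    refine (real_inner_le_norm _ _).trans ?_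
    rw [norm_neg, ← mul_assoc]
    exact mul_le_mul_of_nonneg_right hQ (norm_nonneg _)
  rw [h5]
  linarith

end Tracking

/-! ### The algorithm as a primal-dual iteration. -/

lemma projNonneg_apply {d : ℕ} (v : Vec d) (r : Fin d) : projNonneg v r = max (v r) 0 := rfl

lemma projNonneg_variational {d : ℕ} (v : Vec d) {y : Vec d} (hy : ∀ r, 0 ≤ y r) :
    0 ≤ inner ℝ (projNonneg v - v) (y - projNonneg v) := by
  rw [PiLp.inner_apply]
  refine Finset.sum_nonneg fun r _ => ?_
  simp only [PiLp.sub_apply, projNonneg_apply, RCLike.inner_apply, conj_trivial]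
  rcases le_total (v r) 0 with h | h
  · rw [max_eq_right h]
    have := hy r
    nlinarith
  · rw [max_eq_left h]; simp

/-- Multiplication of each block by a scalar. -/
def blockScale {N : ℕ} (a : Fin N → ℝ) (d : ℕ) : Stack N d →ₗ[ℝ] Stack N d where
  toFun u := WithLp.toLp 2 fun i => a i • u i
  map_add' u v := by ext1 i; simp
  map_smul' c u := by ext1 i; simp [smul_comm c]

lemma blockScale_apply {N d : ℕ} (a : Fin N → ℝ) (u : Stack N d) (i : Fin N) :
    blockScale a d u i = a i • u i := rfl

lemma blockScale_symm {N d : ℕ} (a : Fin N → ℝ) (u v : Stack N d) :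
    inner ℝ (blockScale a d u) v = inner ℝ u (blockScale a d v) := by
  simp only [Stack.inner_eq, blockScale_apply, real_inner_smul_left, real_inner_smul_right]

lemma le_inner_blockScale {N d : ℕ} {a : Fin N → ℝ} {r : ℝ} (h : ∀ i, r ≤ a i) (u : Stack N d) :
    r * ‖u‖ ^ 2 ≤ inner ℝ (blockScale a d u) u := by
  rw [Stack.inner_eq, Stack.norm_sq_eq, Finset.mul_sum]
  refine Finset.sum_le_sum fun i _ => ?_
  rw [blockScale_apply, real_inner_smul_left, real_inner_self_eq_norm_sq]
  exact mul_le_mul_of_nonneg_right (h i) (sq_nonneg _)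

namespace AggGame

variable {N n m : ℕ} {Ξ : Fin N → Type u} [∀ i, MeasurableSpace (Ξ i)] {G : AggGame N n m Ξ}

/-- Block-diagonal operator of the coupling constraints. -/
def blockA (G : AggGame N n m Ξ) : Stack N n →ₗ[ℝ] Stack N m where
  toFun u := WithLp.toLp 2 fun i => G.A i (u i)
  map_add' u v := by ext1 i; simp
  map_smul' c u := by ext1 i; simp

lemma blockA_apply (u : Stack N n) (i : Fin N) : G.blockA u i = G.A i (u i) := rfl

lemma norm_blockA_sq_le (u : Stack N n) : ‖G.blockA u‖ ^ 2 ≤ (∑ i, ‖G.A i‖ ^ 2) * ‖u‖ ^ 2 := by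
  rw [Stack.norm_sq_eq, Stack.norm_sq_eq, Finset.mul_sum]
  refine Finset.sum_le_sum fun i _ => ?_
  rw [blockA_apply]
  refine (pow_le_pow_left₀ (norm_nonneg _) ((G.A i).le_opNorm (u i)) 2).trans ?_
  rw [mul_pow]
  exact mul_le_mul_of_nonneg_right (Finset.single_le_sum (f := fun j => ‖G.A j‖ ^ 2)
    (fun j _ => sq_nonneg _) (Finset.mem_univ i)) (sq_nonneg _)

/-- Stacked expected gradients at given estimates of the aggregate. -/
def stackExtGrad (G : AggGame N n m Ξ) (x u : Fin N → Vec n) : Stack N n :=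
  WithLp.toLp 2 fun i => G.extGrad i (x i) (u i)

/-- Stacked errors of the batch gradients. -/
def batchError (G : AggGame N n m Ξ) (M : ℕ) (ζ : ℕ → ∀ i, Ξ i) (x u : Fin N → Vec n) :
    Stack N n :=
  WithLp.toLp 2 fun i => G.gradSA M ζ i (x i) (u i) - G.extGrad i (x i) (u i)

/-- Primal-dual certificate of optimality: `ls` is the common multiplier and `zs` a vector of
zero sum that splits the slack of the coupling constraints among the agents. -/
structure IsKKT (G : AggGame N n m Ξ) (xs : Fin N → Vec n) (ls : Vec m) (zs : Stack N m) :
    Prop where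
  mem : xs ∈ G.localSet
  nonneg : ∀ r, 0 ≤ ls r
  sum_zs : ∑ i, zs i = 0
  slack : ∀ i, ∀ l : Vec m, (∀ r, 0 ≤ l r) → 0 ≤ inner ℝ (G.A i (xs i) - G.b i - zs i) (ls - l)
  stationary : ∀ i, ∀ y ∈ G.S i,
    0 ≤ inner ℝ (G.pseudograd i xs + (G.A i).adjoint ls) (y - xs i) + (G.g i y - G.g i (xs i))

/-- Subtracting the average residual r from each local residual produces a zero-sum `zs` and leaves
every agent with the same r ≤ 0, orthogonal to the multiplier. -/
lemma exists_isKKT (hN : 0 < N) (hloc : G.LocalCosts) (hs : G.Slater) {x : Fin N → Vec n}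
    (hx : x ∈ G.feasible)
    (hvi : ∀ y ∈ G.feasible,
      0 ≤ ∑ i, (inner ℝ (G.pseudograd i x) (y i - x i) + (G.g i (y i) - G.g i (x i)))) :
    ∃ ls zs, G.IsKKT x ls zs := by
  obtain ⟨ls, hls, hcs, hst⟩ := exists_kkt hloc hs hx hvi
  set r : Vec m := (N : ℝ)⁻¹ • ∑ i, (G.A i (x i) - G.b i) with hr
  have hr0 : ∀ j, r j ≤ 0 := by
    intro j
    have h1 := hx.2 j
    rw [hr, PiLp.smul_apply, Finset.sum_sub_distrib, PiLp.sub_apply, smul_eq_mul]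
    exact mul_nonpos_of_nonneg_of_nonpos (by positivity) (by linarith)
  refine ⟨ls, WithLp.toLp 2 fun i => G.A i (x i) - G.b i - r, hx.1, hls, ?_, ?_, hst⟩
  · simp only [Finset.sum_sub_distrib, Finset.sum_const, Finset.card_univ, Fintype.card_fin]
    rw [← Nat.cast_smul_eq_nsmul ℝ, hr, smul_smul, mul_inv_cancel₀ (by positivity), one_smul,
      Finset.sum_sub_distrib, sub_self]
  · intro i l hl
    simp only [sub_sub_cancel]
    have h1 : inner ℝ r ls = 0 := by
      rw [hr, real_inner_smul_left, real_inner_comm, hcs, mul_zero]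
    rw [inner_sub_right, h1, zero_sub, ← inner_neg_left, PiLp.inner_apply]
    refine Finset.sum_nonneg fun j _ => ?_
    simp only [PiLp.neg_apply, RCLike.inner_apply, conj_trivial]
    exact mul_nonneg (hl j) (neg_nonneg.2 (hr0 j))

namespace IsRun

variable {w : Fin N → Fin N → ℝ} {M : ℕ → ℕ} {c γ ν : ℝ} {α δ : Fin N → ℝ}
  {ζ : ℕ → ℕ → ∀ i, Ξ i} {x s : ℕ → Fin N → Vec n} {z lam : ℕ → Fin N → Vec m}
  {Γ : SimpleGraph (Fin N)}

lemma x_mem (hr : G.IsRun w M c γ ν α δ ζ x s z lam) (k : ℕ) : x k ∈ G.localSet := by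
  cases k with
  | zero => exact hr.init_x
  | succ k => exact fun i => (hr.step_x k i).1

lemma lam_nonneg (hr : G.IsRun w M c γ ν α δ ζ x s z lam) (k : ℕ) (i : Fin N) (r : Fin m) :
    0 ≤ lam k i r := by
  cases k with
  | zero => exact hr.init_lam i r
  | succ k => rw [hr.step_lam k i]; exact le_max_right _ _

lemma tracking_step (hr : G.IsRun w M c γ ν α δ ζ x s z lam) (k : ℕ) :
    (WithLp.toLp 2 (s (k + 1)) : Stack N n)
      = WithLp.toLp 2 (s k) - γ • lap w n (WithLp.toLp 2 (x k + s k)) := by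
  ext1 i
  exact hr.step_s k i

lemma sum_s (hw : IsGraphWeight Γ w) (hr : G.IsRun w M c γ ν α δ ζ x s z lam) (k : ℕ) :
    ∑ i, s k i = 0 := by
  induction k with
  | zero => exact Finset.sum_eq_zero fun i _ => hr.init_s i
  | succ k ih =>
    have h1 := hw.sum_lap (WithLp.toLp 2 (x k + s k) : Stack N n)
    simp only [hr.step_s, Finset.sum_sub_distrib, ih, ← Finset.smul_sum]
    change 0 - γ • ∑ i, lap w n (WithLp.toLp 2 (x k + s k)) i = 0
    rw [h1, smul_zero, sub_zero]

lemma avg_tracking (hw : IsGraphWeight Γ w) (hr : G.IsRun w M c γ ν α δ ζ x s z lam) (k : ℕ) :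
    avg (x k + s k) = avg (x k) := by
  simp only [avg, Pi.add_apply, Finset.sum_add_distrib, hr.sum_s hw k, add_zero]

/-- The start at zero keeps `z` in the range of the Laplacian, with an explicit preimage that moves
by ν times the current multipliers. -/
lemma z_eq (hr : G.IsRun w M c γ ν α δ ζ x s z lam) (k : ℕ) :
    (WithLp.toLp 2 (z k) : Stack N m)
      = lap w m (ν • ∑ j ∈ Finset.range k, WithLp.toLp 2 (lam j)) := by
  induction k with
  | zero =>
    simp only [Finset.range_zero, Finset.sum_empty, smul_zero, map_zero]
    ext1 i
    exact hr.init_z i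
  | succ k ih =>
    rw [Finset.sum_range_succ, smul_add, map_add, ← ih, map_smul]
    ext1 i
    exact hr.step_z k i

/-- The proximal inequality tested at the solution is added to stationarity tested at the new
iterate; the values of `g` cancel. -/
lemma prox_step (hloc : G.LocalCosts) (hα : ∀ i, 0 < α i)
    (hr : G.IsRun w M c γ ν α δ ζ x s z lam) {xs : Fin N → Vec n} {ls : Vec m} {zs : Stack N m}
    (hkkt : G.IsKKT xs ls zs) (k : ℕ) (i : Fin N) :
    0 ≤ inner ℝ ((α i)⁻¹ • (x (k + 1) i - x k i)) (xs i - x (k + 1) i)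
      + inner ℝ ((G.extGrad i (x k i) (x k i + s k i) - G.pseudograd i xs
          + c • laplacian w (x k + s k) i)
        + (G.gradSA (M k) (ζ k) i (x k i) (x k i + s k i)
          - G.extGrad i (x k i) (x k i + s k i))) (xs i - x (k + 1) i)
      + inner ℝ (lam k i - ls) (G.A i (xs i - x (k + 1) i)) := by
  have h1 := prox_variational (hloc i).2.2.2.1 (hα i).le (hr.step_x k i).1 (hr.step_x k i).2
    (hkkt.mem i)
  have h2 := hkkt.stationary i _ (hr.x_mem (k + 1) i)
  set q := G.gradSA (M k) (ζ k) i (x k i) (x k i + s k i) + (G.A i).adjoint (lam k i)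
    + c • laplacian w (x k + s k) i with hq
  have h3 : x (k + 1) i - (x k i - α i • q) = α i • ((α i)⁻¹ • (x (k + 1) i - x k i) + q) := by
    rw [smul_add _ _ q, smul_smul, mul_inv_cancel₀ (hα i).ne', one_smul]; abel
  rw [h3, real_inner_smul_left, ← mul_add] at h1
  have h4 := nonneg_of_mul_nonneg_right h1 (hα i)
  rw [← neg_sub (xs i) (x (k + 1) i), inner_neg_right, inner_add_left,
    ContinuousLinearMap.adjoint_inner_left] at h2
  rw [hq] at h4
  simp only [inner_add_left, inner_sub_left, ContinuousLinearMap.adjoint_inner_left] at h4 ⊢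
  linarith

/-- The projection inequality tested at the common multiplier is added to the slack condition tested
at the new multiplier. -/
lemma dual_step (hδ : ∀ i, 0 < δ i)
    (hr : G.IsRun w M c γ ν α δ ζ x s z lam) {xs : Fin N → Vec n} {ls : Vec m} {zs : Stack N m}
    (hkkt : G.IsKKT xs ls zs) (k : ℕ) (i : Fin N) :
    0 ≤ inner ℝ ((δ i)⁻¹ • (lam (k + 1) i - lam k i)) (ls - lam (k + 1) i)
      - inner ℝ (G.A i (x (k + 1) i - xs i) + G.A i (x (k + 1) i - x k i)
          - ((z (k + 1) i - zs i) + (z (k + 1) i - z k i))) (ls - lam (k + 1) i) := by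
  have h1 := projNonneg_variational (lam k i +
    δ i • (2 • G.A i (x (k + 1) i) - G.A i (x k i) - G.b i - 2 • z (k + 1) i + z k i)) hkkt.nonneg
  rw [← hr.step_lam k i] at h1
  have h2 := hkkt.slack i _ (hr.lam_nonneg (k + 1) i)
  set q := 2 • G.A i (x (k + 1) i) - G.A i (x k i) - G.b i - 2 • z (k + 1) i + z k i with hq
  have h3 : lam (k + 1) i - (lam k i + δ i • q)
      = δ i • ((δ i)⁻¹ • (lam (k + 1) i - lam k i) - q) := by
    rw [smul_sub, smul_smul, mul_inv_cancel₀ (hδ i).ne', one_smul]; abel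
  rw [h3, real_inner_smul_left] at h1
  have h4 := add_nonneg (nonneg_of_mul_nonneg_right h1 (hδ i)) h2
  rw [← inner_add_left] at h4
  rw [← inner_sub_left]
  have h5 : (δ i)⁻¹ • (lam (k + 1) i - lam k i) - (G.A i (x (k + 1) i - xs i)
      + G.A i (x (k + 1) i - x k i) - ((z (k + 1) i - zs i) + (z (k + 1) i - z k i)))
      = (δ i)⁻¹ • (lam (k + 1) i - lam k i) - q + (G.A i (xs i) - G.b i - zs i) := by
    rw [hq, map_sub, map_sub]
    module
  rw [h5]
  exact h4

end IsRun

/-- Preconditioned distance of an iterate `(x, ζ, lam)` to the primal-dual solution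
`(xs, ζs, ls)`, where `ζ` is a preimage of the dual consensus variable under the Laplacian. -/
def distForm (G : AggGame N n m Ξ) (w : Fin N → Fin N → ℝ) (ν : ℝ) (α δ : Fin N → ℝ)
    (p : Stack N n) (ζ l : Stack N m) : ℝ :=
  pdForm (blockScale (fun i => (α i)⁻¹) n) (blockScale (fun i => (δ i)⁻¹) m) (lap w m) G.blockA ν
    p ζ l

/-- Scaled running sum of the multipliers. -/
def dualSum (ν : ℝ) (lam : ℕ → Fin N → Vec m) (k : ℕ) : Stack N m :=
  ν • ∑ j ∈ Finset.range k, WithLp.toLp 2 (lam j)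

/-- The common multiplier, copied for each agent. -/
def copies (N : ℕ) (l : Vec m) : Stack N m := WithLp.toLp 2 fun _ => l

/-- Primal-dual descent of one iteration. -/
lemma IsRun.distForm_le {w : Fin N → Fin N → ℝ} {M : ℕ → ℕ} {c γ ν : ℝ} {α δ : Fin N → ℝ}
    {ζ : ℕ → ℕ → ∀ i, Ξ i} {x s : ℕ → Fin N → Vec n} {z lam : ℕ → Fin N → Vec m}
    {Γ : SimpleGraph (Fin N)} (hw : IsGraphWeight Γ w) (hloc : G.LocalCosts) (hα : ∀ i, 0 < α i)
    (hδ : ∀ i, 0 < δ i) (hν : 0 < ν) (hr : G.IsRun w M c γ ν α δ ζ x s z lam)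
    {xs : Fin N → Vec n} {ls : Vec m} {zs ζs : Stack N m} (hkkt : G.IsKKT xs ls zs)
    (hζs : lap w m ζs = zs) (k : ℕ) :
    G.distForm w ν α δ (WithLp.toLp 2 (x (k + 1)) - WithLp.toLp 2 xs) (dualSum ν lam (k + 1) - ζs)
        (WithLp.toLp 2 (lam (k + 1)) - copies N ls)
      ≤ G.distForm w ν α δ (WithLp.toLp 2 (x k) - WithLp.toLp 2 xs) (dualSum ν lam k - ζs)
        (WithLp.toLp 2 (lam k) - copies N ls)
      - G.distForm w ν α δ (WithLp.toLp 2 (x (k + 1)) - WithLp.toLp 2 (x k))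
        (dualSum ν lam (k + 1) - dualSum ν lam k)
        (WithLp.toLp 2 (lam (k + 1)) - WithLp.toLp 2 (lam k))
      - 2 * inner ℝ (G.stackExtGrad (x k) (x k + s k) - G.stackGrad (WithLp.toLp 2 xs)
          + c • lap w n (WithLp.toLp 2 (x k + s k))
          + G.batchError (M k) (ζ k) (x k) (x k + s k))
          (WithLp.toLp 2 (x (k + 1)) - WithLp.toLp 2 xs) := by
  refine pdForm_step hν.ne' (blockScale_symm _) (blockScale_symm _) hw.lap_symm ?_
    (lap_eq_zero_of_const (a := ls) fun i => rfl) ?_ ?_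
  · rw [dualSum, Finset.sum_range_succ, smul_add]; rfl
  · simp only [Stack.inner_eq, ← Finset.sum_add_distrib]
    exact Finset.sum_nonneg fun i _ => hr.prox_step hloc hα hkkt k i
  · have hz : ∀ j, lap w m (dualSum ν lam j) = WithLp.toLp 2 (z j) := fun j => (hr.z_eq j).symm
    rw [map_sub (lap w m) _ ζs, map_sub (lap w m) _ (dualSum ν lam k), hz, hz, hζs]
    simp only [Stack.inner_eq, ← Finset.sum_sub_distrib]
    exact Finset.sum_nonneg fun i _ => hr.dual_step hδ hkkt k i

/-- Constants of the game and of the graph that control the descent. -/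
structure HasConstants (G : AggGame N n m Ξ) (w : Fin N → Fin N → ℝ) (xs : Fin N → Vec n)
    (η ℓ κ C : ℝ) : Prop where
  η_pos : 0 < η
  ℓ_nonneg : 0 ≤ ℓ
  κ_pos : 0 < κ
  C_pos : 0 < C
  lap_le : ∀ (d : ℕ) (u : Stack N d), ‖lap w d u‖ ^ 2 ≤ κ * inner ℝ (lap w d u) u
  poincare : ∀ (d : ℕ) (u : Stack N d), ‖deviation N d u‖ ^ 2 ≤ C * inner ℝ (lap w d u) u
  monotone : ∀ x ∈ G.localSet, η * ‖(WithLp.toLp 2 x : Stack N n) - WithLp.toLp 2 xs‖ ^ 2 ≤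
    inner ℝ (G.stackGrad (WithLp.toLp 2 x) - G.stackGrad (WithLp.toLp 2 xs))
      (WithLp.toLp 2 x - WithLp.toLp 2 xs)
  lipschitz : ∀ x : Fin N → Vec n,
    ‖G.stackGrad (WithLp.toLp 2 x) - G.stackGrad (WithLp.toLp 2 xs)‖
      ≤ ℓ * ‖(WithLp.toLp 2 x : Stack N n) - WithLp.toLp 2 xs‖
  tracking : ∀ x u : Fin N → Vec n, avg u = avg x →
    ‖G.stackExtGrad x u - G.stackGrad (WithLp.toLp 2 x)‖
      ≤ ℓ * ‖deviation N n (WithLp.toLp 2 u)‖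

lemma exists_hasConstants {Γ : SimpleGraph (Fin N)} {w : Fin N → Fin N → ℝ}
    (hw : IsGraphWeight Γ w) (hsm : G.SmoothCosts) (hm : G.StronglyMonotone)
    {xs : Fin N → Vec n} (hxs : xs ∈ G.localSet) :
    ∃ η ℓ κ C : ℝ, G.HasConstants w xs η ℓ κ C := by
  have hN : 0 < N := by
    obtain ⟨i⟩ := hw.connected.nonempty
    exact i.pos
  obtain ⟨κ, hκ, hlap⟩ := hw.exists_norm_lap_le
  obtain ⟨C, hC, hpoin⟩ := hw.exists_poincare
  obtain ⟨L, hL, hext⟩ := exists_extGrad_lipschitz hN hsm hm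
  obtain ⟨⟨η, hη, hmono⟩, l, hl, hlip⟩ := hm
  refine ⟨η, max l √L, κ, C, hη, hl.le.trans (le_max_left _ _), hκ, hC, hlap, hpoin,
    fun x hx => ?_, fun x => ?_, fun x u hu => ?_⟩
  · rw [Stack.norm_sq_eq, Stack.inner_eq]
    exact hmono x hx xs hxs
  · refine le_trans ?_ (mul_le_mul_of_nonneg_right (le_max_left _ _) (norm_nonneg _))
    refine abs_le_of_sq_le_sq' ?_ (by positivity) |>.2
    rw [mul_pow, Stack.norm_sq_eq, Stack.norm_sq_eq]
    exact hlip x xs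
  · refine le_trans ?_ (mul_le_mul_of_nonneg_right (le_max_right _ _) (norm_nonneg _))
    refine abs_le_of_sq_le_sq' ?_ (by positivity) |>.2
    rw [mul_pow, Real.sq_sqrt hL, Stack.norm_sq_eq, Stack.norm_sq_eq]
    -- At the constant estimate `avg x` the extended gradient is the pseudogradient, so the error is
    -- Lipschitz in the deviation of `u`.
    have h1 := hext x u x (fun _ => avg x) hu (avg_const hN _)
    simp only [sub_self, norm_zero, ne_eq, OfNat.ofNat_ne_zero, not_false_eq_true, zero_pow,
      zero_add, ← hsm.pseudograd_eq] at h1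
    simp only [← hu] at h1
    exact h1

/-- Descent of the preconditioned distance along a run. -/
lemma IsRun.distForm_descent {w : Fin N → Fin N → ℝ} {M : ℕ → ℕ} {c γ ν : ℝ} {α δ : Fin N → ℝ}
    {ζ : ℕ → ℕ → ∀ i, Ξ i} {x s : ℕ → Fin N → Vec n} {z lam : ℕ → Fin N → Vec m}
    {Γ : SimpleGraph (Fin N)} (hw : IsGraphWeight Γ w) (hloc : G.LocalCosts) (hα : ∀ i, 0 < α i)
    (hδ : ∀ i, 0 < δ i) (hν : 0 < ν) (hr : G.IsRun w M c γ ν α δ ζ x s z lam)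
    {xs : Fin N → Vec n} {ls : Vec m} {zs ζs : Stack N m} (hkkt : G.IsKKT xs ls zs)
    (hζs : lap w m ζs = zs) {η ℓ κ C : ℝ} (hc : G.HasConstants w xs η ℓ κ C) {b β : ℝ}
    (hb : 0 < b) (hν1 : ν ≤ 1) (hαβ : ∀ i, (∑ i, ‖G.A i‖ ^ 2) + (b⁻¹ + 1 + β) ≤ (α i)⁻¹)
    (hδκ : ∀ i, 1 + κ ≤ (δ i)⁻¹) (k : ℕ) {X X' u : Stack N n}
    (hX : X = WithLp.toLp 2 (x k)) (hX' : X' = WithLp.toLp 2 (x (k + 1)))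
    (hu : u = WithLp.toLp 2 (x k + s k)) :
    G.distForm w ν α δ (X' - WithLp.toLp 2 xs) (dualSum ν lam (k + 1) - ζs)
        (WithLp.toLp 2 (lam (k + 1)) - copies N ls)
      ≤ G.distForm w ν α δ (X - WithLp.toLp 2 xs) (dualSum ν lam k - ζs)
        (WithLp.toLp 2 (lam k) - copies N ls)
      - β * ‖X' - X‖ ^ 2 - 2 * η * ‖X - WithLp.toLp 2 xs‖ ^ 2
      + 2 * ℓ * (‖deviation N n u‖ * ‖X - WithLp.toLp 2 xs‖)
      - 2 * c * inner ℝ (lap w n u) (X - WithLp.toLp 2 xs)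
      + b * (3 * (ℓ ^ 2 + c ^ 2 * κ ^ 2)) * (‖X - WithLp.toLp 2 xs‖ ^ 2 + ‖deviation N n u‖ ^ 2)
      + (‖G.batchError (M k) (ζ k) (x k) (x k + s k)‖ ^ 2
        - 2 * inner ℝ (G.batchError (M k) (ζ k) (x k) (x k + s k)) (X - WithLp.toLp 2 xs)) := by
  subst hX hX' hu
  have h1 := hr.distForm_le hw hloc hα hδ hν hkkt hζs k
  have h2 : (b⁻¹ + 1 + β) * ‖(WithLp.toLp 2 (x (k + 1)) : Stack N n) - WithLp.toLp 2 (x k)‖ ^ 2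
      ≤ G.distForm w ν α δ (WithLp.toLp 2 (x (k + 1)) - WithLp.toLp 2 (x k))
        (dualSum ν lam (k + 1) - dualSum ν lam k)
        (WithLp.toLp 2 (lam (k + 1)) - WithLp.toLp 2 (lam k)) :=
    le_pdForm hν hν1 hc.κ_pos (hc.lap_le m) norm_blockA_sq_le (le_inner_blockScale hαβ)
      (le_inner_blockScale hδκ) _ _ _
  have h3 := inner_forward_le (c := c) (ε := G.batchError (M k) (ζ k) (x k) (x k + s k))
    (Δ := (WithLp.toLp 2 (x (k + 1)) : Stack N n) - WithLp.toLp 2 (x k)) hb hc.κ_pos (hc.lap_le n)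
    (hc.tracking (x k) (x k + s k) (hr.avg_tracking hw k)) (hc.lipschitz (x k))
    (hc.monotone (x k) (hr.x_mem k))
  rw [sub_add_sub_cancel'] at h3
  linarith

end AggGame

/-! ### Pathwise descent in the two regimes, and boundedness of the estimates. -/

lemma mul_sum_le_of_descent {W e r : ℕ → ℝ} {a : ℝ} (hW : ∀ k, 0 ≤ W k)
    (h : ∀ k, W (k + 1) ≤ W k - a * e k + r k) (K : ℕ) :
    a * ∑ k ∈ Finset.range K, e k ≤ W 0 + ∑ k ∈ Finset.range K, r k := by
  have h1 : W K ≤ W 0 - a * ∑ k ∈ Finset.range K, e k + ∑ k ∈ Finset.range K, r k := by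
    induction K with
    | zero => simp
    | succ K ih =>
      rw [Finset.sum_range_succ, Finset.sum_range_succ]
      have := h K
      linarith
  have := hW K
  linarith

lemma continuous_pdForm {X Y T : Type*} [NormedAddCommGroup X] [InnerProductSpace ℝ X]
    [NormedAddCommGroup Y] [InnerProductSpace ℝ Y] [FiniteDimensional ℝ X] [FiniteDimensional ℝ Y]
    [TopologicalSpace T] (D : X →ₗ[ℝ] X) (D' K : Y →ₗ[ℝ] Y) (A : X →ₗ[ℝ] Y) (ν : ℝ) (ζ : Y)
    {f : T → X} {g : T → Y} (hf : Continuous f) (hg : Continuous g) :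
    Continuous fun t => pdForm D D' K A ν (f t) ζ (g t) := by
  have hD : Continuous D := D.continuous_of_finiteDimensional
  have hD' : Continuous D' := D'.continuous_of_finiteDimensional
  have hA : Continuous A := A.continuous_of_finiteDimensional
  unfold pdForm
  fun_prop

lemma cross_term_le {η : ℝ} (hη : 0 < η) (ℓ v e : ℝ) :
    2 * ℓ * (v * e) ≤ η * e ^ 2 + ℓ ^ 2 / η * v ^ 2 := by
  have e1 : η * e ^ 2 + ℓ ^ 2 / η * v ^ 2 - 2 * ℓ * (v * e) = (η * e - ℓ * v) ^ 2 / η := by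
    field_simp; ring
  have e2 : 0 ≤ (η * e - ℓ * v) ^ 2 / η := by positivity
  linarith

/-- Here I = ⟨Lu, u⟩, J = ⟨Lu, e⟩, `L` is the norm of Lu, `v` that of the deviation, and `T` the
potential of `s`. The J terms cancel; of the gain 2cI, one half pays for cγL² and the other for all
the terms in v². Of 2ηe², the amount ηe²/2 survives. -/
lemma large_gain_arith {Φ Φ' dd η e v ℓ c J I L γ κ C T t r : ℝ} (hη : 0 < η)
    (hγ : 0 < γ) (hγκ : γ * κ ≤ 1) (hc : 0 < c) (hcC : C * (ℓ ^ 2 / η + 1) < c)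
    (ht : t ≤ η / 2) (ht1 : t ≤ 1) (hI : 0 ≤ I) (hL : L ^ 2 ≤ κ * I) (hv : v ^ 2 ≤ C * I)
    (h : Φ' ≤ Φ - 0 * dd - 2 * η * e ^ 2 + 2 * ℓ * (v * e) - 2 * c * J + t * (e ^ 2 + v ^ 2) + r) :
    Φ' + (T - 2 * c * (I - J) + c * γ * L ^ 2) ≤ Φ + T - η / 2 * e ^ 2 + r := by
  have h9 : c * γ * L ^ 2 ≤ c * I := by
    have e1 := mul_le_mul_of_nonneg_left hL (mul_pos hc hγ).le
    have e2 := mul_le_mul_of_nonneg_right hγκ (mul_nonneg hc.le hI)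
    linarith
  have h10 : (ℓ ^ 2 / η + 1) * v ^ 2 ≤ c * I := by
    have e1 := mul_le_mul_of_nonneg_left hv (by positivity : 0 ≤ ℓ ^ 2 / η + 1)
    have e2 := mul_le_mul_of_nonneg_right hcC.le hI
    linarith
  have h11 := cross_term_le hη ℓ v e
  have h12 := mul_le_mul_of_nonneg_right ht (sq_nonneg e)
  have h13 := mul_le_mul_of_nonneg_right ht1 (sq_nonneg v)
  linarith

/-- The weight `τ` is such that the contraction gain τθv² equals the cost in v² of the estimation
error and of the consensus term; the growth τ(1 + θ⁻¹)d² is offset by the reserve in the primal-dual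
form. -/
lemma small_steps_arith {Φ Φ' d η e v v' ℓ c J κ τ θ t r : ℝ} (hη : 0 < η) (hθ : 0 < θ)
    (hc : 0 ≤ c) (hτ : τ = ((ℓ + c * κ) ^ 2 / η + 1) / θ) (ht : t ≤ η / 2) (ht1 : t ≤ 1)
    (hJ : -J ≤ κ * (v * e)) (hv' : v' ^ 2 ≤ (1 - θ) * v ^ 2 + (1 + θ⁻¹) * d ^ 2)
    (h : Φ' ≤ Φ - τ * (1 + θ⁻¹) * d ^ 2 - 2 * η * e ^ 2 + 2 * ℓ * (v * e) - 2 * c * J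
      + t * (e ^ 2 + v ^ 2) + r) :
    Φ' + τ * v' ^ 2 ≤ Φ + τ * v ^ 2 - η / 2 * e ^ 2 + r := by
  have hτ0 : 0 ≤ τ := by rw [hτ]; positivity
  have h3 := mul_le_mul_of_nonneg_left hv' hτ0
  have h5 := mul_le_mul_of_nonneg_left hJ hc
  have h11 := cross_term_le hη (ℓ + c * κ) v e
  have h12 := mul_le_mul_of_nonneg_right ht (sq_nonneg e)
  have h13 := mul_le_mul_of_nonneg_right ht1 (sq_nonneg v)
  have h14 : τ * θ = (ℓ + c * κ) ^ 2 / η + 1 := by rw [hτ, div_mul_cancel₀ _ hθ.ne']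
  have h15 : τ * θ * v ^ 2 = (ℓ + c * κ) ^ 2 / η * v ^ 2 + v ^ 2 := by rw [h14]; ring
  linarith

lemma norm_avg_le {N d : ℕ} {x : Fin N → Vec d} {D : ℝ} (hD : 0 ≤ D) (hx : ∀ i, ‖x i‖ ≤ D) :
    ‖avg x‖ ≤ D := by
  rcases Nat.eq_zero_or_pos N with rfl | hN
  · simpa [avg] using hD
  · have h1 : ‖∑ i, x i‖ ≤ N * D := by
      refine (norm_sum_le _ _).trans ((Finset.sum_le_sum fun i _ => hx i).trans ?_)
      simp
    rw [avg, norm_smul, norm_inv, Real.norm_natCast, inv_mul_le_iff₀ (by positivity)]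
    exact h1

namespace AggGame

variable {N n m : ℕ} {Ξ : Fin N → Type u} [∀ i, MeasurableSpace (Ξ i)] {G : AggGame N n m Ξ}

/-- Along every run, the summed squared distances to `xs` are controlled by the initialization and
by the errors of the batch gradients. -/
def DescentBound (G : AggGame N n m Ξ) (w : Fin N → Fin N → ℝ) (c γ ν : ℝ) (α δ : Fin N → ℝ)
    (xs : Fin N → Vec n) : Prop :=
  ∃ η : ℝ, 0 < η ∧ ∃ V : (Fin N → Vec n) × (Fin N → Vec m) → ℝ, Continuous V ∧
    ∀ (M : ℕ → ℕ) (ζ : ℕ → ℕ → ∀ i, Ξ i) (x s : ℕ → Fin N → Vec n) (z lam : ℕ → Fin N → Vec m),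
      G.IsRun w M c γ ν α δ ζ x s z lam → ∀ K : ℕ,
      η * ∑ k ∈ Finset.range K, ‖(WithLp.toLp 2 (x k) : Stack N n) - WithLp.toLp 2 xs‖ ^ 2
        ≤ V (x 0, lam 0) + ∑ k ∈ Finset.range K,
          (‖G.batchError (M k) (ζ k) (x k) (x k + s k)‖ ^ 2
            - 2 * inner ℝ (G.batchError (M k) (ζ k) (x k) (x k + s k))
              (WithLp.toLp 2 (x k) - WithLp.toLp 2 xs))

lemma continuous_initial_distForm (w : Fin N → Fin N → ℝ) (ν : ℝ) (α δ : Fin N → ℝ)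
    (Xs : Stack N n) (ζ Ls : Stack N m) :
    Continuous fun p : (Fin N → Vec n) × (Fin N → Vec m) =>
      G.distForm w ν α δ (WithLp.toLp 2 p.1 - Xs) ζ (WithLp.toLp 2 p.2 - Ls) := by
  exact continuous_pdForm _ _ _ _ _ _ (by fun_prop) (by fun_prop)

lemma dualSum_zero (ν : ℝ) (lam : ℕ → Fin N → Vec m) : dualSum ν lam 0 = 0 := by
  simp [dualSum]

lemma IsRun.estimate_step {w : Fin N → Fin N → ℝ} {M : ℕ → ℕ} {c γ ν : ℝ} {α δ : Fin N → ℝ}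
    {ζ : ℕ → ℕ → ∀ i, Ξ i} {x s : ℕ → Fin N → Vec n} {z lam : ℕ → Fin N → Vec m}
    (hr : G.IsRun w M c γ ν α δ ζ x s z lam) (k : ℕ) :
    (WithLp.toLp 2 (x (k + 1) + s (k + 1)) : Stack N n) = WithLp.toLp 2 (x k + s k)
      - γ • lap w n (WithLp.toLp 2 (x k + s k))
      + (WithLp.toLp 2 (x (k + 1)) - WithLp.toLp 2 (x k)) := by
  rw [WithLp.toLp_add, hr.tracking_step k, WithLp.toLp_add]
  abel

section Descent

variable {Γ : SimpleGraph (Fin N)} {w : Fin N → Fin N → ℝ} {xs : Fin N → Vec n} {ls : Vec m}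
  {zs : Stack N m} {η ℓ κ C c b γ ν : ℝ} {α δ : Fin N → ℝ}

/-- Descent for a large consensus gain. -/
lemma descentBound_of_large_gain (hw : IsGraphWeight Γ w) (hloc : G.LocalCosts)
    (hkkt : G.IsKKT xs ls zs) (hc : G.HasConstants w xs η ℓ κ C)
    (hcC : C * (ℓ ^ 2 / η + 1) < c) (hb : 0 < b)
    (hbη : b * (3 * (ℓ ^ 2 + c ^ 2 * κ ^ 2)) ≤ η / 2) (hb1 : b * (3 * (ℓ ^ 2 + c ^ 2 * κ ^ 2)) ≤ 1)
    (hα : ∀ i, 0 < α i) (hαb : ∀ i, (∑ i, ‖G.A i‖ ^ 2) + (b⁻¹ + 1) ≤ (α i)⁻¹)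
    (hγ : 0 < γ) (hγκ : γ * κ ≤ 1) (hν : 0 < ν) (hν1 : ν ≤ 1)
    (hδ : ∀ i, 0 < δ i) (hδκ : ∀ i, 1 + κ ≤ (δ i)⁻¹) : G.DescentBound w c γ ν α δ xs := by
  obtain ⟨ζs, hζs⟩ := hw.exists_lap_eq hkkt.sum_zs
  have hη := hc.η_pos
  have hC := hc.C_pos
  have hc0 : 0 < c := lt_of_le_of_lt (by positivity) hcC
  set Xs : Stack N n := WithLp.toLp 2 xs with hXs
  -- At equilibrium all the estimates equal the true average, so `Us - Xs` is the target value of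
  -- `s`.
  set Us : Stack N n := WithLp.toLp 2 fun _ => avg xs with hUs
  refine ⟨η / 2, by positivity, fun p => G.distForm w ν α δ (WithLp.toLp 2 p.1 - Xs) (0 - ζs)
    (WithLp.toLp 2 p.2 - copies N ls) + c / γ * ‖(0 : Stack N n) - (Us - Xs)‖ ^ 2,
    (continuous_initial_distForm w ν α δ _ _ _).add continuous_const, ?_⟩
  intro M ζ x s z lam hr K
  have h0 : (WithLp.toLp 2 (s 0) : Stack N n) = 0 := by
    ext1 i; exact hr.init_s i
  have key := mul_sum_le_of_descent (a := η / 2)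
    (W := fun k => G.distForm w ν α δ (WithLp.toLp 2 (x k) - Xs) (dualSum ν lam k - ζs)
      (WithLp.toLp 2 (lam k) - copies N ls)
      + c / γ * ‖(WithLp.toLp 2 (s k) : Stack N n) - (Us - Xs)‖ ^ 2)
    (e := fun k => ‖(WithLp.toLp 2 (x k) : Stack N n) - Xs‖ ^ 2)
    (r := fun k => ‖G.batchError (M k) (ζ k) (x k) (x k + s k)‖ ^ 2
      - 2 * inner ℝ (G.batchError (M k) (ζ k) (x k) (x k + s k)) (WithLp.toLp 2 (x k) - Xs))
    ?_ ?_ K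
  · simpa only [dualSum_zero, h0] using key
  · intro k
    have h1 : (b⁻¹ + 1) * ‖(WithLp.toLp 2 (x k) : Stack N n) - Xs‖ ^ 2
        ≤ G.distForm w ν α δ (WithLp.toLp 2 (x k) - Xs) (dualSum ν lam k - ζs)
          (WithLp.toLp 2 (lam k) - copies N ls) :=
      le_pdForm hν hν1 hc.κ_pos (hc.lap_le m) norm_blockA_sq_le (le_inner_blockScale hαb)
        (le_inner_blockScale hδκ) _ _ _
    have h2 : 0 ≤ (b⁻¹ + 1) * ‖(WithLp.toLp 2 (x k) : Stack N n) - Xs‖ ^ 2 := by positivity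
    have h3 : 0 ≤ c / γ * ‖(WithLp.toLp 2 (s k) : Stack N n) - (Us - Xs)‖ ^ 2 := by positivity
    exact add_nonneg (h2.trans h1) h3
  · intro k
    -- The potential of `s` does not see the increment of the decisions, so no reserve is needed.
    have h1 := hr.distForm_descent hw hloc hα hδ hν hkkt hζs hc hb hν1 (β := 0)
      (by simpa using hαb) hδκ k rfl rfl rfl
    simp only
    set X : Stack N n := WithLp.toLp 2 (x k)
    set S : Stack N n := WithLp.toLp 2 (s k) with hS
    set u : Stack N n := WithLp.toLp 2 (x k + s k) with hu
    have huX : u = X + S := by rw [hu, WithLp.toLp_add]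
    rw [hr.tracking_step k, ← hu, ← hS]
    have h2 : S - γ • lap w n u - (Us - Xs) = (S - (Us - Xs)) - γ • lap w n u := by abel
    have h3 := norm_sub_sq_real (S - (Us - Xs)) (γ • lap w n u)
    rw [norm_smul, mul_pow, Real.norm_eq_abs, sq_abs, real_inner_smul_right] at h3
    rw [h2, h3]
    have h4 : c / γ * (‖S - (Us - Xs)‖ ^ 2 - 2 * (γ * inner ℝ (S - (Us - Xs)) (lap w n u))
        + γ ^ 2 * ‖lap w n u‖ ^ 2) = c / γ * ‖S - (Us - Xs)‖ ^ 2
          - 2 * c * inner ℝ (S - (Us - Xs)) (lap w n u) + c * γ * ‖lap w n u‖ ^ 2 := by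
      field_simp
    have h5 : inner ℝ (S - (Us - Xs)) (lap w n u) = inner ℝ (lap w n u) u
        - inner ℝ (lap w n u) (X - Xs) := by
      -- The consensus vector `Us` is killed by the Laplacian, so the cross term of `s` yields ⟨Lu,
      -- u⟩ and exactly the ⟨Lu, e⟩ that cancels the primal one.
      have e1 : S - (Us - Xs) = u - (X - Xs) - Us := by rw [huX]; abel
      have e2 : inner ℝ (lap w n u) Us = 0 := by
        rw [hw.lap_symm, lap_eq_zero_of_const (a := avg xs) (fun i => rfl), inner_zero_right]
      rw [e1, real_inner_comm, inner_sub_right, e2, inner_sub_right, sub_zero]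
    rw [h4, h5]
    exact large_gain_arith hη hγ hγκ hc0 hcC hbη hb1 (hw.inner_lap_self_nonneg u)
      (hc.lap_le n u) (hc.poincare n u) h1

/-- Descent for an arbitrary consensus gain and small step sizes of the decisions. -/
lemma descentBound_of_small_steps (hw : IsGraphWeight Γ w) (hloc : G.LocalCosts)
    (hkkt : G.IsKKT xs ls zs) (hc : G.HasConstants w xs η ℓ κ C)
    (hc0 : 0 ≤ c) (hb : 0 < b)
    (hbη : b * (3 * (ℓ ^ 2 + c ^ 2 * κ ^ 2)) ≤ η / 2) (hb1 : b * (3 * (ℓ ^ 2 + c ^ 2 * κ ^ 2)) ≤ 1)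
    {θ τ : ℝ} (hθ : θ = γ / (2 * C)) (hτ : τ = ((ℓ + c * κ) ^ 2 / η + 1) / θ)
    (hα : ∀ i, 0 < α i)
    (hαb : ∀ i, (∑ i, ‖G.A i‖ ^ 2) + (b⁻¹ + 1 + τ * (1 + θ⁻¹)) ≤ (α i)⁻¹)
    (hγ : 0 < γ) (hγκ : γ * κ ≤ 1) (hν : 0 < ν) (hν1 : ν ≤ 1)
    (hδ : ∀ i, 0 < δ i) (hδκ : ∀ i, 1 + κ ≤ (δ i)⁻¹) : G.DescentBound w c γ ν α δ xs := by
  obtain ⟨ζs, hζs⟩ := hw.exists_lap_eq hkkt.sum_zs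
  have hη := hc.η_pos
  have hC := hc.C_pos
  have hκ := hc.κ_pos
  have hθ0 : 0 < θ := by rw [hθ]; positivity
  have hτ0 : 0 < τ := by rw [hτ]; positivity
  set Xs : Stack N n := WithLp.toLp 2 xs with hXs
  have hdc : Continuous (deviation N n) :=
    AddMonoidHomClass.continuous_of_bound _ 1 fun u => by simpa using norm_deviation_le u
  refine ⟨η / 2, by positivity, fun p => G.distForm w ν α δ (WithLp.toLp 2 p.1 - Xs) (0 - ζs)
    (WithLp.toLp 2 p.2 - copies N ls) + τ * ‖deviation N n (WithLp.toLp 2 p.1)‖ ^ 2,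
    (continuous_initial_distForm w ν α δ _ _ _).add (by fun_prop), ?_⟩
  intro M ζ x s z lam hr K
  have h0 : x 0 + s 0 = x 0 := by
    funext i; simp [hr.init_s i]
  have key := mul_sum_le_of_descent (a := η / 2)
    (W := fun k => G.distForm w ν α δ (WithLp.toLp 2 (x k) - Xs) (dualSum ν lam k - ζs)
      (WithLp.toLp 2 (lam k) - copies N ls)
      + τ * ‖deviation N n (WithLp.toLp 2 (x k + s k))‖ ^ 2)
    (e := fun k => ‖(WithLp.toLp 2 (x k) : Stack N n) - Xs‖ ^ 2)
    (r := fun k => ‖G.batchError (M k) (ζ k) (x k) (x k + s k)‖ ^ 2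
      - 2 * inner ℝ (G.batchError (M k) (ζ k) (x k) (x k + s k)) (WithLp.toLp 2 (x k) - Xs))
    ?_ ?_ K
  · simpa only [dualSum_zero, h0] using key
  · intro k
    have h1 : (b⁻¹ + 1 + τ * (1 + θ⁻¹)) * ‖(WithLp.toLp 2 (x k) : Stack N n) - Xs‖ ^ 2
        ≤ G.distForm w ν α δ (WithLp.toLp 2 (x k) - Xs) (dualSum ν lam k - ζs)
          (WithLp.toLp 2 (lam k) - copies N ls) :=
      le_pdForm hν hν1 hc.κ_pos (hc.lap_le m) norm_blockA_sq_le (le_inner_blockScale hαb)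
        (le_inner_blockScale hδκ) _ _ _
    have h2 : 0 ≤ (b⁻¹ + 1 + τ * (1 + θ⁻¹)) * ‖(WithLp.toLp 2 (x k) : Stack N n) - Xs‖ ^ 2 := by
      positivity
    exact add_nonneg (h2.trans h1) (by positivity)
  · intro k
    have h1 := hr.distForm_descent hw hloc hα hδ hν hkkt hζs hc hb hν1 hαb hδκ k rfl rfl rfl
    simp only
    set X : Stack N n := WithLp.toLp 2 (x k)
    set u : Stack N n := WithLp.toLp 2 (x k + s k) with hu
    rw [hr.estimate_step k, ← hu]
    have h2 := deviation_tracking_le hw hC (hc.lap_le n) (hc.poincare n) hγ hγκ u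
      (WithLp.toLp 2 (x (k + 1)) - X)
    rw [← hθ] at h2
    have h4 : -inner ℝ (lap w n u) (X - Xs) ≤ κ * (‖deviation N n u‖ * ‖X - Xs‖) := by
      rw [← inner_neg_left]
      refine (real_inner_le_norm _ _).trans ?_
      rw [norm_neg, ← mul_assoc]
      exact mul_le_mul_of_nonneg_right (norm_lap_le_mul_deviation hκ (hc.lap_le n) u)
        (norm_nonneg _)
    exact small_steps_arith hη hθ0 hc0 hτ hbη hb1 h4 h2 h1

end Descent

/-- The estimates of the aggregate are bounded along the runs. -/
lemma exists_estimate_bound {Γ : SimpleGraph (Fin N)} {w : Fin N → Fin N → ℝ}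
    (hw : IsGraphWeight Γ w) (hloc : G.LocalCosts) {xs : Fin N → Vec n} {η ℓ κ C γ : ℝ}
    (hc : G.HasConstants w xs η ℓ κ C) (hγ : 0 < γ) (hγκ : γ * κ ≤ 1) :
    ∃ R : ℝ, ∀ (c ν : ℝ) (α δ : Fin N → ℝ) (M : ℕ → ℕ) (ζ : ℕ → ℕ → ∀ i, Ξ i)
      (x s : ℕ → Fin N → Vec n) (z lam : ℕ → Fin N → Vec m),
      G.IsRun w M c γ ν α δ ζ x s z lam → ∀ k,
        ‖(WithLp.toLp 2 (x k) : Stack N n)‖ ≤ R ∧ ∀ i, ‖x k i + s k i‖ ≤ R := by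
  have hB : ∀ i, ∃ B, ∀ y ∈ G.S i, ‖y‖ ≤ B := fun i => (hloc i).2.1.isBounded.exists_norm_le
  choose B hB using hB
  set D : ℝ := √(∑ i, B i ^ 2) with hD
  have hX : ∀ y ∈ G.localSet, ‖(WithLp.toLp 2 y : Stack N n)‖ ≤ D := by
    intro y hy
    refine Real.le_sqrt_of_sq_le ?_
    rw [Stack.norm_sq_eq]
    exact Finset.sum_le_sum fun i _ => pow_le_pow_left₀ (norm_nonneg _) (hB i _ (hy i)) 2
  have hD0 : 0 ≤ D := Real.sqrt_nonneg _
  have hC := hc.C_pos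
  set θ := γ / (2 * C) with hθ
  have hθ0 : 0 < θ := by positivity
  set T := (1 + θ⁻¹) * (2 * D) ^ 2 with hT
  have hT0 : 0 ≤ T := by positivity
  -- An invariant level for q ↦ (1 - θ)q + T: `D ^ 2` covers the start, `T / θ` gives θQ ≥ T, and
  -- the extra `T` covers the case θ > 1.
  set Q := D ^ 2 + T + T / θ with hQ
  have hTθ : 0 ≤ T / θ := by positivity
  have hthird : 0 ≤ √Q := Real.sqrt_nonneg _
  refine ⟨√Q + D, ?_⟩
  intro c ν α δ M ζ x s z lam hr k
  refine ⟨(hX _ (hr.x_mem k)).trans (by linarith), fun i => ?_⟩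
  have hdev : ∀ k, ‖deviation N n (WithLp.toLp 2 (x k + s k))‖ ^ 2
      ≤ Q := by
    intro k
    induction k with
    | zero =>
      have h0 : x 0 + s 0 = x 0 := by
        funext i; simp [hr.init_s i]
      rw [h0]
      have h1 := (norm_deviation_le _).trans (hX _ (hr.x_mem 0))
      have h2 := pow_le_pow_left₀ (norm_nonneg _) h1 2
      linarith
    | succ k ih =>
      rw [hr.estimate_step k]
      refine (deviation_tracking_le hw hC (hc.lap_le n) (hc.poincare n) hγ hγκ _ _).trans ?_
      rw [← hθ]
      have h1 : ‖(WithLp.toLp 2 (x (k + 1)) : Stack N n) - WithLp.toLp 2 (x k)‖ ≤ 2 * D := by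
        refine (norm_sub_le _ _).trans ?_
        have := hX _ (hr.x_mem k)
        have := hX _ (hr.x_mem (k + 1))
        linarith
      have h2 := pow_le_pow_left₀ (norm_nonneg _) h1 2
      have h3 := mul_le_mul_of_nonneg_left h2 (by positivity : 0 ≤ 1 + θ⁻¹)
      have h4 : θ * (T / θ) = T := mul_div_cancel₀ _ hθ0.ne'
      have h5 : (1 - θ) * ‖deviation N n (WithLp.toLp 2 (x k + s k))‖ ^ 2 ≤ Q - T := by
        rcases le_total 0 (1 - θ) with h6 | h6
        · refine (mul_le_mul_of_nonneg_left ih h6).trans ?_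
          have := mul_nonneg hθ0.le (sq_nonneg D)
          have := mul_nonneg hθ0.le hT0
          rw [hQ]
          linarith
        · refine (mul_nonpos_of_nonpos_of_nonneg h6 (sq_nonneg _)).trans ?_
          rw [hQ]
          linarith [sq_nonneg D]
      linarith
  have h1 : ‖deviation N n (WithLp.toLp 2 (x k + s k)) i‖
      ≤ √Q :=
    (PiLp.norm_apply_le _ i).trans (Real.le_sqrt_of_sq_le (hdev k))
  have h2 : ‖avg (x k + s k)‖ ≤ D := by
    rw [hr.avg_tracking hw]
    exact norm_avg_le hD0 fun j =>
      (PiLp.norm_apply_le (WithLp.toLp 2 (x k) : Stack N n) j).trans (hX _ (hr.x_mem k))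
  have h3 : x k i + s k i = deviation N n (WithLp.toLp 2 (x k + s k)) i + avg (x k + s k) := by
    rw [deviation_apply]; simp
  rw [h3]
  exact (norm_add_le _ _).trans (add_le_add h1 h2)

end AggGame

/-! ### Measurability of the gradients and of the iterates. -/

lemma Vec.measurable_of_inner {T : Type*} [MeasurableSpace T] {d : ℕ} {f : T → Vec d}
    (h : ∀ v, Measurable fun t => (inner ℝ (f t) v : ℝ)) : Measurable f := by
  have h1 : Measurable fun t => WithLp.ofLp (f t) := by
    rw [measurable_pi_iff]
    intro r
    have := h (EuclideanSpace.single r 1)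
    simpa [EuclideanSpace.inner_single_right] using this
  exact (WithLp.measurable_toLp 2 _).comp h1

lemma Vec.continuous_of_inner {T : Type*} [TopologicalSpace T] {d : ℕ} {f : T → Vec d}
    (h : ∀ v, Continuous fun t => (inner ℝ (f t) v : ℝ)) : Continuous f := by
  have h1 : Continuous fun t => WithLp.ofLp (f t) := by
    refine continuous_pi fun r => ?_
    have := h (EuclideanSpace.single r 1)
    simpa [EuclideanSpace.inner_single_right] using this
  exact (PiLp.continuous_toLp 2 _).comp h1

lemma measurable_projNonneg {d : ℕ} : Measurable (projNonneg : Vec d → Vec d) := by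
  refine (WithLp.measurable_toLp 2 _).comp (measurable_pi_iff.2 fun r => ?_)
  have : Measurable fun v : Vec d => v r :=
    (measurable_pi_apply r).comp (WithLp.measurable_ofLp 2 _)
  exact this.max measurable_const

namespace AggGame

variable {N n m : ℕ} {Ξ : Fin N → Type u} [∀ i, MeasurableSpace (Ξ i)] {G : AggGame N n m Ξ}

/-- Each component is a pointwise limit of difference quotients of `f`, which is measurable in the
sample. -/
lemma SmoothCosts.measurable_sampleGrad_apply (h : G.SmoothCosts) (i : Fin N) (x y : Vec n) :
    Measurable (G.sampleGrad i x y) := by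
  refine Vec.measurable_of_inner fun v => ?_
  simp only [h.inner_sampleGrad]
  set e : Vec n × Vec n := (v, (N : ℝ)⁻¹ • v)
  refine measurable_of_tendsto_metrizable
    (f := fun (k : ℕ) ξ => ((k : ℝ) + 1) * (G.f i (x + ((k : ℝ) + 1)⁻¹ • e.1)
      (y + ((k : ℝ) + 1)⁻¹ • e.2) ξ - G.f i x y ξ))
    (fun k => ((h.measurable i _ _).sub (h.measurable i _ _)).const_mul _) ?_
  rw [tendsto_pi_nhds]
  intro ξ
  have hd := (h.differentiable i ξ (x, y)).hasFDerivAt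
  have hline : HasDerivAt (fun s : ℝ => ((x, y) : Vec n × Vec n) + s • e) e 0 := by
    simpa using ((hasDerivAt_id (0 : ℝ)).smul_const e).const_add ((x, y) : Vec n × Vec n)
  have h0 : ((x, y) : Vec n × Vec n) + (0 : ℝ) • e = (x, y) := by simp
  have h2 := (HasFDerivAt.comp_hasDerivAt (0 : ℝ) (h0.symm ▸ hd) hline).tendsto_slope_zero_right
  have h3 : Tendsto (fun k : ℕ => ((k : ℝ) + 1)⁻¹) atTop (𝓝[>] 0) := by
    refine tendsto_nhdsWithin_iff.2 ⟨?_, Eventually.of_forall fun k => ?_⟩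
    · simpa using tendsto_one_div_add_atTop_nhds_zero_nat (𝕜 := ℝ)
    · exact inv_pos.2 (by positivity : (0 : ℝ) < k + 1)
  have h4 := h2.comp h3
  simpa [Function.comp_def] using h4

lemma SmoothCosts.continuous_sampleGrad (h : G.SmoothCosts) (i : Fin N) (ξ : Ξ i) :
    Continuous fun p : Vec n × Vec n => G.sampleGrad i p.1 p.2 ξ := by
  refine Vec.continuous_of_inner fun v => ?_
  simp only [h.inner_sampleGrad]
  exact ((h.contDiff i ξ).continuous_fderiv one_ne_zero).clm_apply continuous_const

/-- A Carathéodory function: continuous in the point, measurable in the sample. -/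
lemma SmoothCosts.measurable_sampleGrad (h : G.SmoothCosts) (i : Fin N) :
    Measurable fun p : (Vec n × Vec n) × Ξ i => G.sampleGrad i p.1.1 p.1.2 p.2 :=
  measurable_uncurry_of_continuous_of_measurable
    (u := fun (p : Vec n × Vec n) (ξ : Ξ i) => G.sampleGrad i p.1 p.2 ξ)
    (fun ξ => h.continuous_sampleGrad i ξ) fun p => h.measurable_sampleGrad_apply i p.1 p.2

lemma SmoothCosts.measurable_gradSA (h : G.SmoothCosts) (i : Fin N) {T : Type*} [MeasurableSpace T]
    {f g : T → Vec n} {ζ : ℕ → T → ∀ i, Ξ i} (hf : Measurable f) (hg : Measurable g)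
    (hζ : ∀ t, Measurable (ζ t)) {M : ℕ} :
    Measurable fun θ => G.gradSA M (fun t => ζ t θ) i (f θ) (g θ) := by
  have h1 : ∀ t, Measurable fun θ => G.sampleGrad i (f θ) (g θ) (ζ t θ i) := by
    intro t
    have h0 : Measurable fun θ => ((f θ, g θ), ζ t θ i) :=
      (hf.prodMk hg).prodMk ((measurable_pi_apply i).comp (hζ t))
    have h3 := (h.measurable_sampleGrad i).comp h0
    simpa only [Function.comp_def] using h3
  have h2 : Measurable fun θ => ∑ t ∈ Finset.range M, G.sampleGrad i (f θ) (g θ) (ζ t θ i) :=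
    Finset.measurable_sum _ fun t _ => h1 t
  exact h2.const_smul (M : ℝ)⁻¹

lemma SmoothCosts.measurable_extGrad [IsProbabilityMeasure G.law] (h : G.SmoothCosts) (i : Fin N) :
    Measurable fun p : Vec n × Vec n => G.extGrad i p.1 p.2 := by
  have h0 : Measurable fun q : (Vec n × Vec n) × (∀ i, Ξ i) => (q.1, q.2 i) :=
    measurable_fst.prodMk ((measurable_pi_apply i).comp measurable_snd)
  exact ((h.measurable_sampleGrad i).comp h0).stronglyMeasurable.integral_prod_right'.measurable

/-- Stacked errors of the gradients at one sample. -/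
def sampleError (G : AggGame N n m Ξ) (p : (Fin N → Vec n) × (Fin N → Vec n)) (ω : ∀ i, Ξ i) :
    Stack N n :=
  WithLp.toLp 2 fun i => G.sampleGrad i (p.1 i) (p.2 i) (ω i) - G.extGrad i (p.1 i) (p.2 i)

lemma SmoothCosts.measurable_sampleError [IsProbabilityMeasure G.law] (h : G.SmoothCosts) :
    Measurable fun q : ((Fin N → Vec n) × (Fin N → Vec n)) × (∀ i, Ξ i) =>
      G.sampleError q.1 q.2 := by
  refine (WithLp.measurable_toLp 2 _).comp (measurable_pi_iff.2 fun i => ?_)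
  have h1 : Measurable fun q : ((Fin N → Vec n) × (Fin N → Vec n)) × (∀ i, Ξ i) =>
      (q.1.1 i, q.1.2 i) := by fun_prop
  have h2 : Measurable fun q : ((Fin N → Vec n) × (Fin N → Vec n)) × (∀ i, Ξ i) =>
      ((q.1.1 i, q.1.2 i), q.2 i) := by fun_prop
  exact ((h.measurable_sampleGrad i).comp h2).sub ((h.measurable_extGrad i).comp h1)

lemma batchError_eq {M : ℕ} (hM : 0 < M) (ζ : ℕ → ∀ i, Ξ i) (x u : Fin N → Vec n) :
    G.batchError M ζ x u = (M : ℝ)⁻¹ • ∑ t ∈ Finset.range M, G.sampleError (x, u) (ζ t) := by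
  ext1 i
  have h1 : (∑ t ∈ Finset.range M, G.sampleError (x, u) (ζ t)) i
      = ∑ t ∈ Finset.range M, G.sampleError (x, u) (ζ t) i := by simp
  rw [PiLp.smul_apply, h1]
  simp only [batchError, sampleError, gradSA, Finset.sum_sub_distrib, smul_sub, Finset.sum_const,
    Finset.card_range]
  rw [← Nat.cast_smul_eq_nsmul ℝ, smul_smul, inv_mul_cancel₀ (by positivity), one_smul]

lemma SmoothCosts.integrable_sampleError [IsProbabilityMeasure G.law] (h : G.SmoothCosts)
    (p : (Fin N → Vec n) × (Fin N → Vec n)) : Integrable (G.sampleError p) G.law := by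
  have h1 : Integrable (fun ω i => G.sampleGrad i (p.1 i) (p.2 i) (ω i)
      - G.extGrad i (p.1 i) (p.2 i)) G.law :=
    Integrable.of_eval fun i => (h.integrable_grad i _ _).sub (integrable_const _)
  exact (PiLp.continuousLinearEquiv 2 ℝ (fun _ : Fin N => Vec n)).symm.toContinuousLinearMap.integrable_comp
    h1

lemma SmoothCosts.integral_sampleError [IsProbabilityMeasure G.law] (h : G.SmoothCosts)
    (p : (Fin N → Vec n) × (Fin N → Vec n)) : ∫ ω, G.sampleError p ω ∂G.law = 0 := by
  ext1 i
  have h1 := (PiLp.proj 2 (fun _ : Fin N => Vec n) (𝕜 := ℝ) i).integral_comp_comm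
    (h.integrable_sampleError p)
  change (PiLp.proj 2 (fun _ : Fin N => Vec n) (𝕜 := ℝ) i) (∫ ω, G.sampleError p ω ∂G.law) = 0
  rw [← h1]
  change ∫ ω, (G.sampleGrad i (p.1 i) (p.2 i) (ω i) - G.extGrad i (p.1 i) (p.2 i)) ∂G.law = 0
  rw [integral_sub (h.integrable_grad i _ _) (integrable_const _)]
  simp [extGrad]

/-- Nonexpansiveness gives both uniqueness and continuity. The iterates are specified only by the
proximal property, so their measurability has to come from here. -/
lemma exists_measurable_prox (hloc : G.LocalCosts) (i : Fin N) {a : ℝ} (ha : 0 ≤ a) :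
    ∃ P : Vec n → Vec n, Measurable P ∧ ∀ v p, IsProx (G.S i) (G.g i) a v p → p = P v := by
  choose P hPS hP using exists_prox (hloc i).1 (hloc i).2.1 (hloc i).2.2.2.2 ha
  have hg := (hloc i).2.2.2.1
  refine ⟨P, ?_, fun v p hp => ?_⟩
  · refine (LipschitzWith.of_dist_le_mul (K := 1) fun v v' => ?_).continuous.measurable
    rw [dist_eq_norm, dist_eq_norm, NNReal.coe_one, one_mul]
    exact prox_nonexpansive hg ha (hPS v) (hP v) (hPS v') (hP v')
  · have h1 := prox_nonexpansive hg ha hp.1 hp.2 (hPS v) (hP v)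
    rw [sub_self, norm_zero] at h1
    exact sub_eq_zero.1 (norm_le_zero_iff.1 h1)

lemma measurable_laplacian {T : Type*} [MeasurableSpace T] {d : ℕ} (w : Fin N → Fin N → ℝ)
    {u : T → Fin N → Vec d} (hu : Measurable u) (i : Fin N) :
    Measurable fun t => laplacian w (u t) i := by
  have h : ∀ j, Measurable fun t => u t j := fun j => (measurable_pi_apply j).comp hu
  unfold laplacian
  exact Finset.measurable_sum _ fun j _ => ((h i).sub (h j)).const_smul (w i j)

/-- The iterates are measurable functions of the initialization and of the past samples. -/
lemma measurable_run {w : Fin N → Fin N → ℝ} {M : ℕ → ℕ} {c γ ν : ℝ} {α δ : Fin N → ℝ}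
    (hloc : G.LocalCosts) (hsm : G.SmoothCosts) (hα : ∀ i, 0 < α i)
    {Θ : Type v} [MeasurableSpace Θ] {ζ : ℕ → ℕ → Θ → ∀ i, Ξ i}
    {x s : ℕ → Θ → Fin N → Vec n} {z lam : ℕ → Θ → Fin N → Vec m}
    (hr : ∀ θ, G.IsRun w M c γ ν α δ (fun k t => ζ k t θ)
      (fun k => x k θ) (fun k => s k θ) (fun k => z k θ) (fun k => lam k θ))
    (hx : Measurable (x 0)) (hlam : Measurable (lam 0)) {K : ℕ}
    (hζ : ∀ k < K, ∀ t, Measurable (ζ k t)) :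
    ∀ k ≤ K, Measurable (x k) ∧ Measurable (s k) ∧ Measurable (z k) ∧ Measurable (lam k) := by
  intro k
  induction k with
  | zero =>
    intro _
    refine ⟨hx, ?_, ?_, hlam⟩
    · have : s 0 = fun _ _ => 0 := by funext θ i; exact (hr θ).init_s i
      rw [this]; exact measurable_const
    · have : z 0 = fun _ _ => 0 := by funext θ i; exact (hr θ).init_z i
      rw [this]; exact measurable_const
  | succ k ih =>
    intro hk
    obtain ⟨hxk, hsk, hzk, hlk⟩ := ih (by omega)
    have hx' : ∀ i, Measurable fun θ => x k θ i := fun i => (measurable_pi_apply i).comp hxk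
    have hs' : ∀ i, Measurable fun θ => s k θ i := fun i => (measurable_pi_apply i).comp hsk
    have hz' : ∀ i, Measurable fun θ => z k θ i := fun i => (measurable_pi_apply i).comp hzk
    have hl' : ∀ i, Measurable fun θ => lam k θ i := fun i => (measurable_pi_apply i).comp hlk
    have hlapx : ∀ i, Measurable fun θ => laplacian w (x k θ + s k θ) i :=
      measurable_laplacian w (hxk.add hsk)
    have hxn : ∀ i, Measurable fun θ => x (k + 1) θ i := by
      intro i
      obtain ⟨P, hP, hPx⟩ := exists_measurable_prox hloc i (hα i).le
      have h1 : (fun θ => x (k + 1) θ i) = fun θ => P (x k θ i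
          - α i • (G.gradSA (M k) (fun t => ζ k t θ) i (x k θ i) (x k θ i + s k θ i)
            + (G.A i).adjoint (lam k θ i) + c • laplacian w (x k θ + s k θ) i)) := by
        funext θ
        exact hPx _ _ ((hr θ).step_x k i)
      rw [h1]
      have h2 : Measurable fun θ =>
          G.gradSA (M k) (fun t => ζ k t θ) i (x k θ i) (x k θ i + s k θ i) := hsm.measurable_gradSA i (hx' i) ((hx' i).add (hs' i)) (hζ k (by omega))
      have h3 : Measurable fun θ => (G.A i).adjoint (lam k θ i) :=
        (ContinuousLinearMap.measurable _).comp (hl' i)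
      exact hP.comp ((hx' i).sub (((h2.add h3).add ((hlapx i).const_smul c)).const_smul (α i)))
    have hzn : ∀ i, Measurable fun θ => z (k + 1) θ i := by
      intro i
      have h1 : (fun θ => z (k + 1) θ i) = fun θ => z k θ i + ν • laplacian w (lam k θ) i := by
        funext θ; exact (hr θ).step_z k i
      rw [h1]
      exact (hz' i).add ((measurable_laplacian w hlk i).const_smul ν)
    refine ⟨measurable_pi_iff.2 hxn, measurable_pi_iff.2 fun i => ?_, measurable_pi_iff.2 hzn,
      measurable_pi_iff.2 fun i => ?_⟩
    · have h1 : (fun θ => s (k + 1) θ i) = fun θ => s k θ i - γ • laplacian w (x k θ + s k θ) i := by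
        funext θ; exact (hr θ).step_s k i
      rw [h1]
      exact (hs' i).sub ((hlapx i).const_smul γ)
    · have h1 : (fun θ => lam (k + 1) θ i) = fun θ => projNonneg (lam k θ i +
          δ i • (2 • G.A i (x (k + 1) θ i) - G.A i (x k θ i) - G.b i - 2 • z (k + 1) θ i
            + z k θ i)) := by
        funext θ; exact (hr θ).step_lam k i
      rw [h1]
      have hA : ∀ {y : Θ → Vec n}, Measurable y → Measurable fun θ => G.A i (y θ) := fun hy =>
        (G.A i).measurable.comp hy
      have h2 : Measurable fun θ => 2 • G.A i (x (k + 1) θ i) - G.A i (x k θ i) - G.b i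
          - 2 • z (k + 1) θ i + z k θ i :=
        (((((hA (hxn i)).const_smul (2 : ℕ)).sub (hA (hx' i))).sub_const _).sub
          ((hzn i).const_smul (2 : ℕ))).add (hz' i)
      exact measurable_projNonneg.comp ((hl' i).add (h2.const_smul (δ i)))

end AggGame

/-! ### Independence of a sample from the past. -/

section Independence

variable {Θ : Type*} {m m0 : MeasurableSpace Θ} {μ : Measure Θ} [IsProbabilityMeasure μ]

/-- If `J` is independent of the pair `(B, C)` and `B` of `C`, then `(J, B)` is independent
of `C`. -/
lemma indepFun_prodMk_left {α β γ : Type*} [MeasurableSpace α] [MeasurableSpace β]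
    [MeasurableSpace γ] {J : Θ → α} {B : Θ → β} {C : Θ → γ} (hJ : Measurable J)
    (hB : Measurable B) (hC : Measurable C) (h : IndepFun J (fun θ => (B θ, C θ)) μ)
    (hBC : IndepFun B C μ) : IndepFun (fun θ => (J θ, B θ)) C μ := by
  have hJB : IndepFun J B μ := h.comp measurable_id measurable_fst
  rw [indepFun_iff_map_prod_eq_prod_map_map hJ.aemeasurable (hB.prodMk hC).aemeasurable] at h
  rw [indepFun_iff_map_prod_eq_prod_map_map hB.aemeasurable hC.aemeasurable] at hBC
  rw [indepFun_iff_map_prod_eq_prod_map_map hJ.aemeasurable hB.aemeasurable] at hJB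
  rw [indepFun_iff_map_prod_eq_prod_map_map (hJ.prodMk hB).aemeasurable hC.aemeasurable, hJB]
  have : IsProbabilityMeasure (μ.map J) := Measure.isProbabilityMeasure_map hJ.aemeasurable
  have : IsProbabilityMeasure (μ.map B) := Measure.isProbabilityMeasure_map hB.aemeasurable
  have : IsProbabilityMeasure (μ.map C) := Measure.isProbabilityMeasure_map hC.aemeasurable
  -- After reassociation both sides are the law of (J, (B, C)), which factors completely.
  apply MeasurableEquiv.prodAssoc.map_measurableEquiv_injective
  rw [Measure.prodAssoc_prod, ← hBC, ← h,
    Measure.map_map MeasurableEquiv.prodAssoc.measurable ((hJ.prodMk hB).prodMk hC)]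
  rfl

/-- In a family of independent variables that is independent of `J`, each variable is independent
of any function of `J` and of the other variables. -/
lemma exists_measurableSpace_indep {ι α β : Type*} [MeasurableSpace α] [MeasurableSpace β]
    {J : Θ → α} {Z : ι → Θ → β} (hJ : Measurable J) (hZ : ∀ i, Measurable (Z i))
    (hind : iIndepFun Z μ) (hJZ : IndepFun J (fun θ i => Z i θ) μ) (p : ι) :
    ∃ m' : MeasurableSpace Θ, m' ≤ m0 ∧
      Indep m' (MeasurableSpace.comap (Z p) inferInstance) μ ∧
      Measurable[m'] J ∧ ∀ q, q ≠ p → Measurable[m'] (Z q) := by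
  set B : Θ → ({q // q ≠ p} → β) := fun θ q => Z q θ with hB
  have hBm : Measurable B := measurable_pi_iff.2 fun q => hZ q
  have hBC : IndepFun B (Z p) μ := by
    rw [iIndepFun_iff_iIndep] at hind
    have h1 := indep_iSup_of_disjoint (fun i => (hZ i).comap_le) hind
      (S := {p}ᶜ) (T := {p}) (by simp)
    rw [IndepFun_iff_Indep]
    refine indep_of_indep_of_le_left (indep_of_indep_of_le_right h1 ?_) ?_
    · exact le_iSup₂_of_le p rfl le_rfl
    · rw [← measurable_iff_comap_le]
      refine @measurable_pi_lambda Θ {q // q ≠ p} (fun _ => β) (_) _ B fun q => ?_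
      rw [measurable_iff_comap_le]
      exact le_iSup₂_of_le (f := fun i (_ : i ∈ ({p}ᶜ : Set ι)) =>
        MeasurableSpace.comap (Z i) inferInstance) q.1 q.2 le_rfl
  have h2 : IndepFun J (fun θ => (B θ, Z p θ)) μ := by
    have h3 : Measurable fun f : ι → β => ((fun q : {q // q ≠ p} => f q), f p) := by fun_prop
    exact hJZ.comp measurable_id h3
  have h4 := indepFun_prodMk_left hJ hBm (hZ p) h2 hBC
  have h5 : Measurable[MeasurableSpace.comap (fun θ => (J θ, B θ)) inferInstance]
      (fun θ => (J θ, B θ)) := comap_measurable _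
  refine ⟨MeasurableSpace.comap (fun θ => (J θ, B θ)) inferInstance, (hJ.prodMk hBm).comap_le,
    (IndepFun_iff_Indep _ _ _).1 h4, measurable_fst.comp h5, fun q hq => ?_⟩
  exact (measurable_pi_apply (⟨q, hq⟩ : {q // q ≠ p})).comp (measurable_snd.comp h5)

lemma map_prodMk_eq {α β : Type*} [MeasurableSpace α] [MeasurableSpace β]
    {Y : Θ → α} {C : Θ → β} {law : Measure β} (hm : m ≤ m0)
    (hY : Measurable[m] Y) (hC : Measurable C)
    (hind : Indep m (MeasurableSpace.comap C inferInstance) μ) (hlaw : μ.map C = law) :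
    μ.map (fun θ => (Y θ, C θ)) = (μ.map Y).prod law := by
  have h1 : IndepFun Y C μ := by
    rw [IndepFun_iff_Indep]
    exact indep_of_indep_of_le_left hind (measurable_iff_comap_le.1 hY)
  rw [indepFun_iff_map_prod_eq_prod_map_map (hY.mono hm le_rfl).aemeasurable hC.aemeasurable] at h1
  rw [h1, hlaw]

end Independence

/-! ### Moments of the gradient noise. -/

section Moments

variable {Θ : Type*} {m m0 : MeasurableSpace Θ} {μ : Measure Θ} {E : Type*} [NormedAddCommGroup E]
  {α β : Type*} [MeasurableSpace α] [MeasurableSpace β]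
  {Y : Θ → α} {C : Θ → β} {law : Measure β} {H : α → β → E}

/-- Centered noise is orthogonal to the past. -/
lemma integral_inner_noise_eq_zero [IsProbabilityMeasure μ] [IsProbabilityMeasure law]
    [InnerProductSpace ℝ E] [CompleteSpace E] [MeasurableSpace E] [BorelSpace E]
    [SecondCountableTopology E] (hm : m ≤ m0) (hY : Measurable[m] Y) (hC : Measurable C)
    (hind : Indep m (MeasurableSpace.comap C inferInstance) μ) (hlaw : μ.map C = law)
    (hH : Measurable fun q : α × β => H q.1 q.2) (hHi : ∀ y, Integrable (H y) law)
    (hH0 : ∀ y, ∫ ω, H y ω ∂law = 0) {ψ : Θ → E} (hψ : Measurable[m] ψ)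
    (hint : Integrable (fun θ => (inner ℝ (ψ θ) (H (Y θ) (C θ)) : ℝ)) μ) :
    ∫ θ, (inner ℝ (ψ θ) (H (Y θ) (C θ)) : ℝ) ∂μ = 0 := by
  have hYψ : Measurable[m] fun θ => (ψ θ, Y θ) := hψ.prodMk hY
  have h1 := map_prodMk_eq hm hYψ hC hind hlaw
  have h2 : Measurable fun θ => ((ψ θ, Y θ), C θ) := (hYψ.mono hm le_rfl).prodMk hC
  have h3 : Measurable fun q : (E × α) × β => (q.1.2, q.2) := by fun_prop
  have h4 := hH.comp h3
  have h5 : Measurable fun q : (E × α) × β => (inner ℝ q.1.1 (H q.1.2 q.2) : ℝ) :=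
    (measurable_fst.comp measurable_fst).inner h4
  have : IsProbabilityMeasure (μ.map fun θ => (ψ θ, Y θ)) :=
    Measure.isProbabilityMeasure_map (hYψ.mono hm le_rfl).aemeasurable
  have h6 := integral_map (μ := μ) h2.aemeasurable h5.aestronglyMeasurable
  -- The joint law is a product, so Fubini freezes the past and the inner integral of the noise
  -- vanishes.
  rw [← h6, h1, integral_prod]
  · refine integral_eq_zero_of_ae (Eventually.of_forall fun y => ?_)
    simp only [Pi.zero_apply]
    rw [integral_inner (hHi y.2), hH0, inner_zero_right]
  · rw [← h1, integrable_map_measure h5.aestronglyMeasurable h2.aemeasurable]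
    exact hint

/-- Tonelli with the past frozen. The lower integral requires no prior integrability, so this bound
is the source of the square integrability of the noise. -/
lemma lintegral_noise_le [IsProbabilityMeasure μ] [IsProbabilityMeasure law] [MeasurableSpace E]
    [BorelSpace E] (hm : m ≤ m0) (hY : Measurable[m] Y) (hC : Measurable C)
    (hind : Indep m (MeasurableSpace.comap C inferInstance) μ) (hlaw : μ.map C = law)
    (hH : Measurable fun q : α × β => H q.1 q.2) {V : ENNReal}
    (hV : ∀ θ, ∫⁻ ω, ENNReal.ofReal (‖H (Y θ) ω‖ ^ 2) ∂law ≤ V) :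
    ∫⁻ θ, ENNReal.ofReal (‖H (Y θ) (C θ)‖ ^ 2) ∂μ ≤ V := by
  have h1 := map_prodMk_eq hm hY hC hind hlaw
  have hY' : Measurable Y := hY.mono hm le_rfl
  have h5 : Measurable fun q : α × β => ENNReal.ofReal (‖H q.1 q.2‖ ^ 2) :=
    (hH.norm.pow_const 2).ennreal_ofReal
  have : IsProbabilityMeasure (μ.map Y) := Measure.isProbabilityMeasure_map hY'.aemeasurable
  have h6 := lintegral_map (μ := μ) h5 (hY'.prodMk hC)
  rw [← h6, h1, lintegral_prod _ h5.aemeasurable, lintegral_map h5.lintegral_prod_right' hY']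
  refine (lintegral_mono hV).trans ?_
  simp

lemma MeasureTheory.MemLp.integrable_inner_two [InnerProductSpace ℝ E] {f g : Θ → E} (hf : MemLp f 2 μ)
    (hg : MemLp g 2 μ) : Integrable (fun θ => (inner ℝ (f θ) (g θ) : ℝ)) μ := by
  have h1 := (L2.integrable_inner (𝕜 := ℝ) (hf.toLp f) (hg.toLp g))
  refine h1.congr ?_
  filter_upwards [hf.coeFn_toLp, hg.coeFn_toLp] with θ h2 h3
  rw [h2, h3]

lemma memLp_two_of_lintegral_le [MeasurableSpace E] [BorelSpace E]
    [SecondCountableTopology E] {f : Θ → E} (hf : Measurable f) {V : ℝ}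
    (hV : ∫⁻ θ, ENNReal.ofReal (‖f θ‖ ^ 2) ∂μ ≤ ENNReal.ofReal V) : MemLp f 2 μ := by
  rw [memLp_two_iff_integrable_sq_norm hf.aestronglyMeasurable]
  refine ⟨(hf.norm.pow_const 2).aestronglyMeasurable, ?_⟩
  rw [hasFiniteIntegral_iff_ofReal (Eventually.of_forall fun θ => sq_nonneg _)]
  exact hV.trans_lt ENNReal.ofReal_lt_top

lemma integral_le_of_lintegral_le {f : Θ → ℝ} (hf : Measurable f) (hf0 : ∀ θ, 0 ≤ f θ) {V : ℝ}
    (hV0 : 0 ≤ V) (hV : ∫⁻ θ, ENNReal.ofReal (f θ) ∂μ ≤ ENNReal.ofReal V) : ∫ θ, f θ ∂μ ≤ V := by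
  rw [integral_eq_lintegral_of_nonneg_ae (Eventually.of_forall hf0) hf.aestronglyMeasurable]
  exact ENNReal.toReal_le_of_le_ofReal hV0 hV

/-- Second moment of the mean of `M` orthogonal variables. -/
lemma integral_norm_sq_mean_le [InnerProductSpace ℝ E] {h : ℕ → Θ → E} {V : ℝ} {M : ℕ} (hM : 0 < M)
    (hh : ∀ t, MemLp (h t) 2 μ) (hV : ∀ t, ∫ θ, ‖h t θ‖ ^ 2 ∂μ ≤ V)
    (horth : ∀ t t', t ≠ t' → ∫ θ, (inner ℝ (h t θ) (h t' θ) : ℝ) ∂μ = 0) :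
    ∫ θ, ‖(M : ℝ)⁻¹ • ∑ t ∈ Finset.range M, h t θ‖ ^ 2 ∂μ ≤ V / M := by
  have h1 : ∀ θ, ‖(M : ℝ)⁻¹ • ∑ t ∈ Finset.range M, h t θ‖ ^ 2
      = (M : ℝ)⁻¹ ^ 2 * ∑ t ∈ Finset.range M, ∑ t' ∈ Finset.range M,
        (inner ℝ (h t θ) (h t' θ) : ℝ) := by
    intro θ
    rw [norm_smul, mul_pow, Real.norm_eq_abs, sq_abs, ← real_inner_self_eq_norm_sq, sum_inner]
    simp only [inner_sum]
  simp only [h1]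
  rw [integral_const_mul, integral_finsetSum _ fun t _ =>
    integrable_finsetSum _ fun t' _ => (hh t).integrable_inner_two (hh t')]
  have h2 : ∀ t ∈ Finset.range M, ∫ θ, ∑ t' ∈ Finset.range M, (inner ℝ (h t θ) (h t' θ) : ℝ) ∂μ
      ≤ V := by
    intro t ht
    rw [integral_finsetSum _ fun t' _ => (hh t).integrable_inner_two (hh t'),
      Finset.sum_eq_single t (fun t' _ h' => horth t t' h'.symm) (fun h' => absurd ht h')]
    simp only [real_inner_self_eq_norm_sq]
    exact hV t
  have h3 := Finset.sum_le_sum h2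
  rw [Finset.sum_const, Finset.card_range, nsmul_eq_mul] at h3
  refine (mul_le_mul_of_nonneg_left h3 (sq_nonneg _)).trans (le_of_eq ?_)
  have : (M : ℝ) ≠ 0 := by positivity
  field_simp

/-- Nonnegative variables whose expectations have bounded partial sums vanish almost surely. -/
lemma ae_tendsto_zero_of_sum_integral_le {f : ℕ → Θ → ℝ} (hf : ∀ k, Measurable (f k))
    (hf0 : ∀ k θ, 0 ≤ f k θ) (hfi : ∀ k, Integrable (f k) μ) {B : ℝ}
    (hB : ∀ K, ∑ k ∈ Finset.range K, ∫ θ, f k θ ∂μ ≤ B) :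
    ∀ᵐ θ ∂μ, Tendsto (fun k => f k θ) atTop (𝓝 0) := by
  have h1 : ∫⁻ θ, ∑' k, ENNReal.ofReal (f k θ) ∂μ ≤ ENNReal.ofReal B := by
    rw [lintegral_tsum fun k => (hf k).ennreal_ofReal.aemeasurable]
    refine ENNReal.tsum_le_of_sum_range_le fun K => ?_
    have h2 : ∀ k, ∫⁻ θ, ENNReal.ofReal (f k θ) ∂μ = ENNReal.ofReal (∫ θ, f k θ ∂μ) := fun k =>
      (ofReal_integral_eq_lintegral_ofReal (hfi k) (Eventually.of_forall (hf0 k))).symm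
    simp only [h2]
    rw [← ENNReal.ofReal_sum_of_nonneg fun k _ => integral_nonneg (hf0 k)]
    exact ENNReal.ofReal_le_ofReal (hB K)
  have h3 : ∀ᵐ θ ∂μ, ∑' k, ENNReal.ofReal (f k θ) < ⊤ :=
    ae_lt_top (Measurable.tsum fun k => (hf k).ennreal_ofReal)
      (h1.trans_lt ENNReal.ofReal_lt_top).ne
  filter_upwards [h3] with θ hθ
  have h4 := ENNReal.tendsto_atTop_zero_of_tsum_ne_top hθ.ne
  have h5 := (ENNReal.tendsto_toReal ENNReal.zero_ne_top).comp h4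
  simpa [Function.comp_def, ENNReal.toReal_ofReal (hf0 _ θ)] using h5

end Moments

lemma IsBatchSize.exists_sum_le {M : ℕ → ℕ} (hM : IsBatchSize M) :
    ∃ B : ℝ, ∀ K, ∑ k ∈ Finset.range K, ((M k : ℝ))⁻¹ ≤ B := by
  obtain ⟨hpos, C, k₀, a, hC, hk₀, ha, hMk⟩ := hM
  have h1 : Summable fun k : ℕ => (M k : ℝ)⁻¹ := by
    -- The growth condition says nothing about the batch at k = 0.
    rw [← summable_nat_add_iff 1]
    have h2 : Summable fun k : ℕ => C⁻¹ * (((k + 1 : ℕ) : ℝ) ^ (a + 1))⁻¹ :=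
      ((summable_nat_add_iff 1).2 (Real.summable_nat_rpow_inv.2 (by linarith))).mul_left _
    refine Summable.of_nonneg_of_le (fun k => by positivity) (fun k => ?_) h2
    rw [← mul_inv]
    have h3 := hMk (k + 1) (by omega)
    refine inv_anti₀ (by positivity) (le_trans ?_ h3)
    refine mul_le_mul_of_nonneg_left ?_ hC.le
    exact Real.rpow_le_rpow (by positivity) (by linarith) (by linarith)
  exact ⟨∑' k, (M k : ℝ)⁻¹, fun K => h1.sum_le_tsum _ fun k _ => by positivity⟩

/-! ### Almost sure convergence. -/

namespace AggGame

variable {N n m : ℕ} {Ξ : Fin N → Type u} [∀ i, MeasurableSpace (Ξ i)] {G : AggGame N n m Ξ}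

/-- The iterates of an iteration are independent of each of its samples, also jointly with the
other samples of the batch. -/
lemma exists_past {w : Fin N → Fin N → ℝ} {M : ℕ → ℕ} {c γ ν : ℝ} {α δ : Fin N → ℝ}
    (hloc : G.LocalCosts) (hsm : G.SmoothCosts) (hα : ∀ i, 0 < α i)
    {Θ : Type v} [m0 : MeasurableSpace Θ] {μ : Measure Θ} [IsProbabilityMeasure μ]
    {ζ : ℕ → ℕ → Θ → ∀ i, Ξ i}
    {x s : ℕ → Θ → Fin N → Vec n} {z lam : ℕ → Θ → Fin N → Vec m}
    (hζ : ∀ k t, Measurable (ζ k t)) (hind : iIndepFun (fun p : ℕ × ℕ => ζ p.1 p.2) μ)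
    (hx : Measurable (x 0)) (hlam : Measurable (lam 0))
    (hinit : IndepFun (fun θ => (x 0 θ, lam 0 θ)) (fun θ (p : ℕ × ℕ) => ζ p.1 p.2 θ) μ)
    (hr : ∀ θ, G.IsRun w M c γ ν α δ (fun k t => ζ k t θ)
      (fun k => x k θ) (fun k => s k θ) (fun k => z k θ) (fun k => lam k θ)) (k t : ℕ) :
    ∃ m' : MeasurableSpace Θ, m' ≤ m0 ∧
      Indep m' (MeasurableSpace.comap (ζ k t) inferInstance) μ ∧
      Measurable[m'] (fun θ => (x 0 θ, lam 0 θ)) ∧ Measurable[m'] (x k) ∧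
      Measurable[m'] (fun θ => (x k θ, x k θ + s k θ)) ∧ ∀ t', t' ≠ t → Measurable[m'] (ζ k t') := by
  obtain ⟨m', hm', hI, hJ, hq⟩ := exists_measurableSpace_indep (hx.prodMk hlam)
    (fun p : ℕ × ℕ => hζ p.1 p.2) hind hinit (k, t)
  -- Measurability of the run is applied with `m'` as the ambient σ-algebra: the iterates at `k` use
  -- only the initialization and earlier batches.
  obtain ⟨h1, h2, -, -⟩ := @measurable_run N n m Ξ _ G w M c γ ν α δ hloc hsm hα Θ m' ζ x s z lam hr
    (measurable_fst.comp hJ) (measurable_snd.comp hJ) k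
    (fun j hj t' => hq (j, t') fun h => hj.ne (congrArg Prod.fst h)) k le_rfl
  exact ⟨m', hm', hI, hJ, h1, h1.prodMk (h1.add h2),
    fun t' ht' => hq (k, t') fun h => ht' (congrArg Prod.snd h)⟩

/-- The descent bound and the bound of the estimates yield almost sure convergence. -/
lemma convergesAS_of_descentBound [IsProbabilityMeasure G.law] {w : Fin N → Fin N → ℝ}
    {c γ ν R : ℝ} {α δ : Fin N → ℝ} {xs : Fin N → Vec n}
    (hloc : G.LocalCosts) (hsm : G.SmoothCosts) (hvar : G.BoundedVariance) (hα : ∀ i, 0 < α i)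
    (hR : ∀ (M : ℕ → ℕ) (ζ : ℕ → ℕ → ∀ i, Ξ i)
      (x s : ℕ → Fin N → Vec n) (z lam : ℕ → Fin N → Vec m),
      G.IsRun w M c γ ν α δ ζ x s z lam → ∀ k,
        ‖(WithLp.toLp 2 (x k) : Stack N n)‖ ≤ R ∧ ∀ i, ‖x k i + s k i‖ ≤ R)
    (hdesc : G.DescentBound w c γ ν α δ xs) :
    AggGame.ConvergesAS.{u, v} G w c γ ν α δ xs := by
  intro M hM Θ m0 μ hμ ζ x s z lam hζ hlaw hind hx hlam hinit hr
  obtain ⟨η, hη, V, hV, hdesc⟩ := hdesc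
  obtain ⟨σ, hσ, hvarσ⟩ := hvar R
  obtain ⟨B, hB⟩ := hM.exists_sum_le
  have hpast := exists_past hloc hsm hα hζ hind hx hlam hinit hr
  have hxm : ∀ k, Measurable (x k) := fun k => by
    obtain ⟨m', hm', -, -, h, -⟩ := hpast k 0
    exact h.mono hm' le_rfl
  set Y : ℕ → Θ → (Fin N → Vec n) × (Fin N → Vec n) := fun k θ => (x k θ, x k θ + s k θ) with hY
  set e : ℕ → Θ → Stack N n := fun k θ => WithLp.toLp 2 (x k θ) - WithLp.toLp 2 xs with he
  set E : ℕ → ℕ → Θ → Stack N n := fun k t θ => G.sampleError (Y k θ) (ζ k t θ) with hE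
  set ε : ℕ → Θ → Stack N n := fun k θ => (M k : ℝ)⁻¹ • ∑ t ∈ Finset.range (M k), E k t θ with hε
  have hEm : ∀ k t (m' : MeasurableSpace Θ), Measurable[m'] (Y k) → Measurable[m'] (ζ k t) →
      Measurable[m'] (E k t) := by
    intro k t m' h1 h2
    have h3 : Measurable[m'] fun θ => (Y k θ, ζ k t θ) := h1.prodMk h2
    have h4 := hsm.measurable_sampleError.comp h3
    exact h4
  have hYm : ∀ k, Measurable (Y k) := fun k => by
    obtain ⟨m', hm', -, -, -, h, -⟩ := hpast k 0
    exact h.mono hm' le_rfl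
  have hsec : ∀ k t, ∫⁻ θ, ENNReal.ofReal (‖E k t θ‖ ^ 2) ∂μ ≤ ENNReal.ofReal (σ ^ 2) := by
    intro k t
    obtain ⟨m', hm', hI, -, -, hYm', -⟩ := hpast k t
    refine lintegral_noise_le hm' hYm' (hζ k t) hI (hlaw k t) hsm.measurable_sampleError fun θ => ?_
    simp only [Stack.norm_sq_eq]
    exact hvarσ _ ((hr θ).x_mem k) _ ((hR _ _ _ _ _ _ (hr θ) k).2)
  have hEmeas : ∀ k t, Measurable (E k t) := fun k t => hEm k t m0 (hYm k) (hζ k t)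
  have hE2 : ∀ k t, MemLp (E k t) 2 μ := fun k t =>
    memLp_two_of_lintegral_le (hEmeas k t) (hsec k t)
  have hEsq : ∀ k t, ∫ θ, ‖E k t θ‖ ^ 2 ∂μ ≤ σ ^ 2 := fun k t =>
    integral_le_of_lintegral_le ((hEmeas k t).norm.pow_const 2) (fun θ => sq_nonneg _)
      (sq_nonneg _) (hsec k t)
  -- `ψ` may depend on the other samples of the same batch, which covers both the orthogonality
  -- within a batch and the pairing with the current error.
  have hnoise : ∀ k t (ψ : Θ → Stack N n), MemLp ψ 2 μ →
      (∀ m' : MeasurableSpace Θ, Measurable[m'] (fun θ => (x 0 θ, lam 0 θ)) → Measurable[m'] (x k) →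
        Measurable[m'] (Y k) → (∀ t', t' ≠ t → Measurable[m'] (ζ k t')) → Measurable[m'] ψ) →
      ∫ θ, (inner ℝ (ψ θ) (E k t θ) : ℝ) ∂μ = 0 := by
    intro k t ψ hψ2 hψ
    obtain ⟨m', hm', hI, hJm', hxm', hYm', hζm'⟩ := hpast k t
    exact integral_inner_noise_eq_zero hm' hYm' (hζ k t) hI (hlaw k t) hsm.measurable_sampleError
      hsm.integrable_sampleError hsm.integral_sampleError (hψ m' hJm' hxm' hYm' hζm')
      (hψ2.integrable_inner_two (hE2 k t))
  have hεsq : ∀ k, ∫ θ, ‖ε k θ‖ ^ 2 ∂μ ≤ σ ^ 2 / M k := fun k =>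
    integral_norm_sq_mean_le (hM.1 k) (hE2 k) (hEsq k) fun t t' htt' =>
      hnoise k t' _ (hE2 k t) fun m' _ _ hYm' hζm' => hEm k t m' hYm' (hζm' t htt')
  have hε2 : ∀ k, MemLp (ε k) 2 μ := fun k =>
    (memLp_finsetSum (Finset.range (M k)) fun t _ => hE2 k t).const_smul (M k : ℝ)⁻¹
  have hem : ∀ k (m' : MeasurableSpace Θ), Measurable[m'] (x k) → Measurable[m'] (e k) := by
    intro k m' h
    have h1 := (WithLp.measurable_toLp 2 (Fin N → Vec n)).comp h
    exact h1.sub_const _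
  have heb : ∀ k θ, ‖e k θ‖ ≤ R + ‖(WithLp.toLp 2 xs : Stack N n)‖ := fun k θ =>
    (norm_sub_le _ _).trans (add_le_add (hR _ _ _ _ _ _ (hr θ) k).1 le_rfl)
  have hconv : ∀ r : ℕ, ∀ᵐ θ ∂μ, Tendsto
      (fun k => {θ | V (x 0 θ, lam 0 θ) ≤ r}.indicator 1 θ * ‖e k θ‖ ^ 2) atTop (𝓝 (0 : ℝ)) := by
    intro r
    -- The random initialization need not make `V` integrable, so expectations are taken on this
    -- event. It depends on the initialization only, hence the truncated error `ψ` is still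
    -- orthogonal to the noise.
    set D : Set Θ := {θ | V (x 0 θ, lam 0 θ) ≤ r} with hD
    have hDm : ∀ m' : MeasurableSpace Θ, Measurable[m'] (fun θ => (x 0 θ, lam 0 θ)) →
        MeasurableSet[m'] D := fun m' h =>
      (hV.measurable.comp h) measurableSet_Iic
    set φ : Θ → ℝ := D.indicator 1 with hφ
    have hφm : ∀ m' : MeasurableSpace Θ, Measurable[m'] (fun θ => (x 0 θ, lam 0 θ)) →
        Measurable[m'] φ := fun m' h => measurable_one.indicator (hDm m' h)
    have hφ01 : ∀ θ, φ θ = 0 ∨ (φ θ = 1 ∧ θ ∈ D) := by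
      intro θ
      by_cases h : θ ∈ D
      · exact Or.inr ⟨by simp [hφ, h], h⟩
      · exact Or.inl (by simp [hφ, h])
    have hφ0 : ∀ θ, 0 ≤ φ θ := fun θ => by rcases hφ01 θ with h | h <;> simp [h]
    have hφ1 : ∀ θ, φ θ ≤ 1 := fun θ => by rcases hφ01 θ with h | h <;> simp [h]
    have hφx := hφm m0 (hx.prodMk hlam)
    set ψ : ℕ → Θ → Stack N n := fun k θ => φ θ • e k θ with hψ
    have hψm : ∀ k (m' : MeasurableSpace Θ), Measurable[m'] (fun θ => (x 0 θ, lam 0 θ)) →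
        Measurable[m'] (x k) → Measurable[m'] (ψ k) := fun k m' h1 h2 =>
      (hφm m' h1).smul (hem k m' h2)
    have hψ2 : ∀ k, MemLp (ψ k) 2 μ := fun k =>
      MemLp.of_bound (hψm k m0 (hx.prodMk hlam) (hxm k)).aestronglyMeasurable
        (R + ‖(WithLp.toLp 2 xs : Stack N n)‖) (Eventually.of_forall fun θ => by
          rw [hψ, norm_smul, Real.norm_eq_abs, abs_of_nonneg (hφ0 θ)]
          exact (mul_le_of_le_one_left (norm_nonneg _) (hφ1 θ)).trans (heb k θ))
    have hψε : ∀ k, ∫ θ, (inner ℝ (ψ k θ) (ε k θ) : ℝ) ∂μ = 0 := by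
      intro k
      simp only [hε, inner_smul_right, inner_sum]
      rw [integral_const_mul, integral_finsetSum _ fun t _ =>
        (hψ2 k).integrable_inner_two (hE2 k t)]
      rw [Finset.sum_eq_zero fun t _ => hnoise k t _ (hψ2 k) fun m' h1 h2 _ _ => hψm k m' h1 h2,
        mul_zero]
    have hfm : ∀ k, Measurable fun θ => φ θ * ‖e k θ‖ ^ 2 := fun k =>
      hφx.mul ((hem k m0 (hxm k)).norm.pow_const 2)
    have hf0 : ∀ k θ, 0 ≤ φ θ * ‖e k θ‖ ^ 2 := fun k θ => mul_nonneg (hφ0 θ) (sq_nonneg _)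
    have hfi : ∀ k, Integrable (fun θ => φ θ * ‖e k θ‖ ^ 2) μ := fun k =>
      Integrable.of_bound (hfm k).aestronglyMeasurable
        ((R + ‖(WithLp.toLp 2 xs : Stack N n)‖) ^ 2) (Eventually.of_forall fun θ => by
          rw [Real.norm_eq_abs, abs_of_nonneg (hf0 k θ)]
          exact (mul_le_of_le_one_left (sq_nonneg _) (hφ1 θ)).trans
            (pow_le_pow_left₀ (norm_nonneg _) (heb k θ) 2))
    refine ae_tendsto_zero_of_sum_integral_le hfm hf0 hfi (B := (r + σ ^ 2 * B) / η) fun K => ?_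
    rw [le_div_iff₀ hη, mul_comm, ← integral_finsetSum _ fun k _ => hfi k, ← integral_const_mul]
    have hgi : ∀ k, Integrable (fun θ => ‖ε k θ‖ ^ 2 - 2 * (inner ℝ (ψ k θ) (ε k θ) : ℝ)) μ :=
      fun k => ((memLp_two_iff_integrable_sq_norm (hε2 k).1).1 (hε2 k)).sub
        (((hψ2 k).integrable_inner_two (hε2 k)).const_mul 2)
    -- Off the event the left side vanishes and the right side is nonnegative; on it the descent
    -- bound applies with V ≤ r.
    have hpath : ∀ θ, η * ∑ k ∈ Finset.range K, φ θ * ‖e k θ‖ ^ 2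
        ≤ r + ∑ k ∈ Finset.range K, (‖ε k θ‖ ^ 2 - 2 * (inner ℝ (ψ k θ) (ε k θ) : ℝ)) := by
      intro θ
      rcases hφ01 θ with h | ⟨h, hθ⟩
      · simp only [hψ, h, zero_smul, inner_zero_left, zero_mul, Finset.sum_const_zero, mul_zero,
          sub_zero]
        exact add_nonneg (Nat.cast_nonneg r) (Finset.sum_nonneg fun _ _ => sq_nonneg _)
      · have h1 := hdesc M (fun k t => ζ k t θ) _ _ _ _ (hr θ) K
        simp only [hψ, h, one_smul, one_mul]
        have h2 : ∀ k, G.batchError (M k) (fun t => ζ k t θ) (x k θ) (x k θ + s k θ) = ε k θ :=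
          fun k => batchError_eq (hM.1 k) _ _ _
        simp only [h2] at h1
        refine h1.trans (add_le_add hθ (le_of_eq ?_))
        exact Finset.sum_congr rfl fun k _ => by rw [real_inner_comm]
    refine (integral_mono ((integrable_finsetSum _ fun k _ => hfi k).const_mul η)
      ((integrable_const _).add (integrable_finsetSum _ fun k _ => hgi k)) hpath).trans ?_
    simp only [Pi.add_apply]
    rw [integral_add (integrable_const _) (integrable_finsetSum _ fun k _ => hgi k),
      integral_finsetSum _ fun k _ => hgi k, integral_const]
    simp only [probReal_univ, one_smul]
    refine add_le_add le_rfl ?_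
    have h3 : ∀ k ∈ Finset.range K, ∫ θ, (‖ε k θ‖ ^ 2 - 2 * (inner ℝ (ψ k θ) (ε k θ) : ℝ)) ∂μ
        ≤ σ ^ 2 * (M k : ℝ)⁻¹ := by
      intro k _
      rw [integral_sub ((memLp_two_iff_integrable_sq_norm (hε2 k).1).1 (hε2 k))
        (((hψ2 k).integrable_inner_two (hε2 k)).const_mul 2), integral_const_mul, hψε, mul_zero,
        sub_zero, ← div_eq_mul_inv]
      exact hεsq k
    refine (Finset.sum_le_sum h3).trans ?_
    rw [← Finset.mul_sum]
    exact mul_le_mul_of_nonneg_left (hB K) (sq_nonneg _)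
  -- The events {V ≤ r}, for natural r, cover the whole space.
  rw [← ae_all_iff] at hconv
  filter_upwards [hconv] with θ hθ
  obtain ⟨r, hr'⟩ := exists_nat_ge (V (x 0 θ, lam 0 θ))
  have h1 := hθ r
  have h2 : {θ | V (x 0 θ, lam 0 θ) ≤ r}.indicator (1 : Θ → ℝ) θ = 1 := by
    rw [Set.indicator_of_mem (show θ ∈ {θ | V (x 0 θ, lam 0 θ) ≤ r} from hr')]; rfl
  simp only [h2, one_mul] at h1
  have h3 : Tendsto (fun k => ‖e k θ‖) atTop (𝓝 0) := by
    have := h1.sqrt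
    simpa using this
  have h4 : Tendsto (fun k => (WithLp.toLp 2 (x k θ) : Stack N n)) atTop
      (𝓝 (WithLp.toLp 2 xs)) := tendsto_iff_norm_sub_tendsto_zero.2 h3
  exact ((PiLp.continuous_ofLp 2 (fun _ : Fin N => Vec n)).tendsto _).comp h4

lemma exists_young_parameter {η T : ℝ} (hη : 0 < η) (hT : 0 ≤ T) :
    ∃ b : ℝ, 0 < b ∧ b * T ≤ η / 2 ∧ b * T ≤ 1 := by
  refine ⟨min (η / 2) 1 / (T + 1), by positivity, ?_⟩
  have h1 : min (η / 2) 1 / (T + 1) * T ≤ min (η / 2) 1 := by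
    rw [div_mul_eq_mul_div, div_le_iff₀ (by positivity)]
    have : 0 ≤ min (η / 2) 1 := by positivity
    nlinarith
  exact ⟨h1.trans (min_le_left _ _), h1.trans (min_le_right _ _)⟩

end AggGame

lemma le_inv_of_lt_inv {a b : ℝ} (ha : 0 < a) (hb : 0 < b) (h : b < a⁻¹) : a ≤ b⁻¹ :=
  (le_inv_comm₀ ha hb).2 h.le

end

/-! ### Choice of the gain and of the step-size bounds. -/

theorem theorem4 {N n m : ℕ} {Ξ : Fin N → Type u} [∀ i, MeasurableSpace (Ξ i)]
    (G : AggGame N n m Ξ) [IsProbabilityMeasure G.law]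
    (hloc : G.LocalCosts) (hslater : G.Slater) (hsmooth : G.SmoothCosts)
    (hmono : G.StronglyMonotone) (hvar : G.BoundedVariance)
    (Γ : SimpleGraph (Fin N)) (w : Fin N → Fin N → ℝ) (hw : IsGraphWeight Γ w) :
    ∃ xs : Fin N → Vec n, G.IsVSGNE xs ∧ (∀ y, G.IsVSGNE y → y = xs) ∧
      -- large consensus gain: bounds for all the step sizes, uniform in the tracking step
      (∃ cmin : ℝ, 0 ≤ cmin ∧ ∀ c : ℝ, cmin < c →
        ∃ αbar γbar νbar δbar : ℝ, 0 < αbar ∧ 0 < γbar ∧ 0 < νbar ∧ 0 < δbar ∧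
          ∀ (α δ : Fin N → ℝ) (γ ν : ℝ),
            (∀ i, 0 < α i ∧ α i < αbar) → (0 < γ ∧ γ < γbar) → (0 < ν ∧ ν < νbar) →
            (∀ i, 0 < δ i ∧ δ i < δbar) →
            AggGame.ConvergesAS.{u, v} G w c γ ν α δ xs) ∧
      -- arbitrary consensus gain: the other step-size bounds may depend on the tracking step
      (∀ c : ℝ, 0 < c → ∃ γbar : ℝ, 0 < γbar ∧ ∀ γ : ℝ, 0 < γ → γ < γbar →
        ∃ αbar νbar δbar : ℝ, 0 < αbar ∧ 0 < νbar ∧ 0 < δbar ∧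
          ∀ (α δ : Fin N → ℝ) (ν : ℝ),
            (∀ i, 0 < α i ∧ α i < αbar) → (0 < ν ∧ ν < νbar) →
            (∀ i, 0 < δ i ∧ δ i < δbar) →
            AggGame.ConvergesAS.{u, v} G w c γ ν α δ xs) := by
  have hN : 0 < N := by
    obtain ⟨i⟩ := hw.connected.nonempty
    exact i.pos
  obtain ⟨xs, hxs, hvi⟩ := AggGame.exists_variational hloc hslater hmono
  obtain ⟨ls, zs, hkkt⟩ := AggGame.exists_isKKT hN hloc hslater hxs hvi
  obtain ⟨η, ℓ, κ, C, hc⟩ := AggGame.exists_hasConstants hw hsmooth hmono hxs.1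
  have hη := hc.η_pos
  have hκ := hc.κ_pos
  have hC := hc.C_pos
  have hℓ := hc.ℓ_nonneg
  have hγκ : ∀ {γ : ℝ}, γ < κ⁻¹ → γ * κ ≤ 1 := fun h => by
    have := mul_le_mul_of_nonneg_right h.le hκ.le
    rwa [inv_mul_cancel₀ hκ.ne'] at this
  have hA : 0 ≤ ∑ i, ‖G.A i‖ ^ 2 := Finset.sum_nonneg fun _ _ => sq_nonneg _
  refine ⟨xs, ⟨AggGame.isSGNE_of_variational hsmooth hxs hvi, hvi⟩,
    fun y hy => AggGame.variational_unique hmono hxs hy.1.1 hvi hy.2,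
    ⟨C * (ℓ ^ 2 / η + 1), by positivity, fun c hcC => ?_⟩, fun c hc0 => ?_⟩
  · obtain ⟨b, hb, hbη, hb1⟩ := AggGame.exists_young_parameter hη
      (by positivity : 0 ≤ 3 * (ℓ ^ 2 + c ^ 2 * κ ^ 2))
    refine ⟨((∑ i, ‖G.A i‖ ^ 2) + (b⁻¹ + 1))⁻¹, κ⁻¹, 1, (1 + κ)⁻¹, by positivity, by positivity,
      one_pos, by positivity, fun α δ γ ν hα hγ hν hδ => ?_⟩
    -- `R` depends on `γ`, but it enters only the variance, so the step-size bounds above remain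
    -- uniform in `γ`.
    obtain ⟨R, hR⟩ := AggGame.exists_estimate_bound hw hloc hc hγ.1 (hγκ hγ.2)
    exact AggGame.convergesAS_of_descentBound hloc hsmooth hvar (fun i => (hα i).1)
      (hR c ν α δ)
      (AggGame.descentBound_of_large_gain hw hloc hkkt hc hcC hb hbη hb1 (fun i => (hα i).1)
        (fun i => le_inv_of_lt_inv (by positivity) (hα i).1 (hα i).2) hγ.1 (hγκ hγ.2) hν.1 hν.2.le
        (fun i => (hδ i).1) fun i => le_inv_of_lt_inv (by positivity) (hδ i).1 (hδ i).2)
  · obtain ⟨b, hb, hbη, hb1⟩ := AggGame.exists_young_parameter hη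
      (by positivity : 0 ≤ 3 * (ℓ ^ 2 + c ^ 2 * κ ^ 2))
    refine ⟨κ⁻¹, by positivity, fun γ hγ hγ1 => ?_⟩
    -- The contraction rate, and with it the weight `τ` and the bound on `α`, is determined by `γ`;
    -- this is why `γ` is fixed first.
    obtain ⟨θ, hθ⟩ : ∃ θ, θ = γ / (2 * C) := ⟨_, rfl⟩
    obtain ⟨τ, hτ⟩ : ∃ τ, τ = ((ℓ + c * κ) ^ 2 / η + 1) / θ := ⟨_, rfl⟩
    have hθ0 : 0 < θ := by rw [hθ]; positivity
    have hτ0 : 0 < τ := by rw [hτ]; positivity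
    refine ⟨((∑ i, ‖G.A i‖ ^ 2) + (b⁻¹ + 1 + τ * (1 + θ⁻¹)))⁻¹, 1, (1 + κ)⁻¹, by positivity,
      one_pos, by positivity, fun α δ ν hα hν hδ => ?_⟩
    obtain ⟨R, hR⟩ := AggGame.exists_estimate_bound hw hloc hc hγ (hγκ hγ1)
    exact AggGame.convergesAS_of_descentBound hloc hsmooth hvar (fun i => (hα i).1)
      (hR c ν α δ)
      (AggGame.descentBound_of_small_steps hw hloc hkkt hc hc0.le hb hbη hb1 hθ hτ
        (fun i => (hα i).1) (fun i => le_inv_of_lt_inv (by positivity) (hα i).1 (hα i).2) hγ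
        (hγκ hγ1) hν.1 hν.2.le (fun i => (hδ i).1)
        fun i => le_inv_of_lt_inv (by positivity) (hδ i).1 (hδ i).2)
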